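/- Let $k\ge 3$ be an integer. Then the following two statements are equivalent. 1. There are a real $\varepsilon>0$ (with $\varepsilon<k$) and an algorithm for $k$-Coloring with running time $O\big((k-\varepsilon)^{\mathrm{pw}}\, N^{O(1)}\big)$: the input is a simple graph $G$ with vertex set $\{0,\dots,n-1\}$, given by a list of its edges, together with a path decomposition of $G$ of width $\mathrm{pw}$, and the algorithm decides whether $G$ has a proper coloring with $k$ colors. 2. The Primal Pathwidth-Strong Exponential Time Hypothesis (PP-SETH) is false. Here the PP-SETH is the following hypothesis: for all $\varepsilon>0$ (with $\varepsilon<2$) there is no algorithm that takes as input a 3-SAT instance $\phi$ (a CNF formula in which each clause has at most three literals) and a path decomposition of width $\mathrm{pw}$ of its primal graph (the graph on the variables of $\phi$ in which two distinct variables are adjacent if they appear together in a clause), and decides whether $\phi$ is satisfiable in time $O\big((2-\varepsilon)^{\mathrm{pw}}\, N^{O(1)}\big)$. In both cases $N$ is the size of the input. The constants hidden in the $O$-notation may depend on $k$, on $\varepsilon$ and on the algorithm, but not on the input. Algorithms are deterministic programs of a random access machine, with running time measured under the logarithmic cost criterion. A path decomposition of a graph is a finite sequence of sets of vertices (bags)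 such that every vertex lies in some bag, the two ends of every edge lie in a common bag, and the bags that contain a given vertex are consecutive in the sequence; its width is the maximum size of a bag minus one (taken to be $0$ if all bags are empty). -/

import Mathlib

namespace PathwidthSETH

/-! ### Random access machines with logarithmic cost -/

/-- Programs of a random access machine, in structured form. The machine has registers
`R 0, R 1, …` and random access memories (arrays) `A 0, A 1, …`, all of whose cells hold natural
numbers. A given program mentions only finitely many registers and arrays. -/
inductive Program : Type
  /-- `R i := c` -/
  | const (i c : ℕ) : Program
  /-- `R i := R j + R l` -/
  | add (i j l : ℕ) : Program
  /-- `R i := max (R j - R l) 0` -/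
  | sub (i j l : ℕ) : Program
  /-- `R i := A a [R j]` (indirect addressing) -/
  | load (i a j : ℕ) : Program
  /-- `A a [R i] := R j` (indirect addressing) -/
  | store (a i j : ℕ) : Program
  /-- first `P`, then `Q` -/
  | seq (P Q : Program) : Program
  /-- if `R i ≠ 0` then `P` else `Q` -/
  | ite (i : ℕ) (P Q : Program) : Program
  /-- while `R i ≠ 0` do `P` -/
  | while (i : ℕ) (P : Program) : Program

/-- Configuration of the machine: the contents of the registers and of the arrays. -/
structure State : Type where
  reg : ℕ → ℕ
  arr : ℕ → ℕ → ℕ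

/-- Overwrite register `i` by the value `v`. -/
def State.setReg (s : State) (i v : ℕ) : State :=
  ⟨Function.update s.reg i v, s.arr⟩

/-- Overwrite the cell with address `p` of array `a` by the value `v`. -/
def State.setArr (s : State) (a p v : ℕ) : State :=
  ⟨s.reg, Function.update s.arr a (Function.update (s.arr a) p v)⟩

/-- `Exec P s s' t`: started in the configuration `s`, the program `P` halts in the configuration
`s'`, after running for time `t`. Time is counted under the logarithmic cost criterion: every
instruction and every test costs one plus the bit lengths of the numbers (addresses included)
that it handles. -/
inductive Exec : Program → State → State → ℕ → Prop
  | const (s : State) (i c : ℕ) :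
      Exec (.const i c) s (s.setReg i c) (1 + c.size)
  | add (s : State) (i j l : ℕ) :
      Exec (.add i j l) s (s.setReg i (s.reg j + s.reg l))
        (1 + (s.reg j).size + (s.reg l).size)
  | sub (s : State) (i j l : ℕ) :
      Exec (.sub i j l) s (s.setReg i (s.reg j - s.reg l))
        (1 + (s.reg j).size + (s.reg l).size)
  | load (s : State) (i a j : ℕ) :
      Exec (.load i a j) s (s.setReg i (s.arr a (s.reg j)))
        (1 + (s.reg j).size + (s.arr a (s.reg j)).size)
  | store (s : State) (a i j : ℕ) :
      Exec (.store a i j) s (s.setArr a (s.reg i) (s.reg j))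
        (1 + (s.reg i).size + (s.reg j).size)
  | seq {P Q : Program} {s s₁ s₂ : State} {t₁ t₂ : ℕ} :
      Exec P s s₁ t₁ → Exec Q s₁ s₂ t₂ → Exec (.seq P Q) s s₂ (t₁ + t₂)
  | ite_true {i : ℕ} {P Q : Program} {s s₁ : State} {t : ℕ} :
      s.reg i ≠ 0 → Exec P s s₁ t → Exec (.ite i P Q) s s₁ (1 + (s.reg i).size + t)
  | ite_false {i : ℕ} {P Q : Program} {s s₁ : State} {t : ℕ} :
      s.reg i = 0 → Exec Q s s₁ t → Exec (.ite i P Q) s s₁ (1 + (s.reg i).size + t)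
  | while_done {i : ℕ} {P : Program} {s : State} :
      s.reg i = 0 → Exec (.while i P) s s (1 + (s.reg i).size)
  | while_step {i : ℕ} {P : Program} {s s₁ s₂ : State} {t₁ t₂ : ℕ} :
      s.reg i ≠ 0 → Exec P s s₁ t₁ → Exec (.while i P) s₁ s₂ t₂ →
        Exec (.while i P) s s₂ (1 + (s.reg i).size + t₁ + t₂)

/-- Initial configuration on the input word `w`: the word is stored in array `0`, its length is in
register `0`, and everything else is `0`. -/
def initial (w : List ℕ) : State where
  reg := fun i => if i = 0 then w.length else 0
  arr := fun a p => if a = 0 then w.getD p 0 else 0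

/-- The decision problem `yes` on the inputs `ι`, written as words by `enc` and with parameter `p`,
is solved by an algorithm in time `O(β ^ p · N ^ O(1))`, where `N` is the size of the input. The
algorithm answers yes by halting with a non-zero number in register `0`. -/
def SolvableInTime {ι : Type} (enc : ι → List ℕ) (yes : ι → Prop) (p : ι → ℕ) (β : ℝ) :
    Prop :=
  ∃ (P : Program) (C c : ℕ), ∀ x : ι, ∃ (s : State) (t : ℕ),
    Exec P (initial (enc x)) s t ∧ (s.reg 0 ≠ 0 ↔ yes x) ∧
      (t : ℝ) ≤ C * β ^ p x * ((enc x).length : ℝ) ^ c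

/-! ### Path decompositions -/

/-- The sequence of bags `B` is a path decomposition of the graph `G`. -/
structure IsPathDecomposition {V : Type} (G : SimpleGraph V) (B : List (Finset V)) : Prop where
  vertex_mem : ∀ v : V, ∃ b ∈ B, v ∈ b
  edge_mem : ∀ v w : V, G.Adj v w → ∃ b ∈ B, v ∈ b ∧ w ∈ b
  interval : ∀ (v : V) (i j l : ℕ), i ≤ j → j ≤ l →
    v ∈ B.getD i ∅ → v ∈ B.getD l ∅ → v ∈ B.getD j ∅

/-- The width: the maximum size of a bag minus one (and `0` if there are no non-empty bags). -/
def width {V : Type} (B : List (Finset V)) : ℕ :=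
  (B.map Finset.card).foldr max 0 - 1

/-- The sequence of bags that is given by a list of lists of vertices. -/
def bagSets {n : ℕ} (B : List (List (Fin n))) : List (Finset (Fin n)) :=
  B.map List.toFinset

/-! ### Words -/

/-- A list is written as its length, followed by its entries. -/
def encodeList {α : Type} (f : α → List ℕ) (l : List α) : List ℕ :=
  l.length :: l.flatMap f

/-- Bags are written as lists of lists of vertices. -/
def encodeBags {n : ℕ} (B : List (List (Fin n))) : List ℕ :=
  encodeList (encodeList fun v : Fin n => [(v : ℕ)]) B

/-! ### Coloring -/

/-- The graph on the vertices `0, …, n - 1` with the listed edges. -/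
def edgeGraph {n : ℕ} (E : List (Fin n × Fin n)) : SimpleGraph (Fin n) :=
  SimpleGraph.fromRel fun v w => (v, w) ∈ E

/-- Input of `k`-Coloring: a graph, given as a list of edges, and a path decomposition of it. -/
structure ColoringInstance : Type where
  n : ℕ
  edges : List (Fin n × Fin n)
  bags : List (List (Fin n))
  loopless : ∀ e ∈ edges, e.1 ≠ e.2
  decomposition : IsPathDecomposition (edgeGraph edges) (bagSets bags)

/-- The input of `k`-Coloring as a word. -/
def ColoringInstance.encode (I : ColoringInstance) : List ℕ :=
  I.n :: (encodeList (fun e : Fin I.n × Fin I.n => [(e.1 : ℕ), (e.2 : ℕ)]) I.edges ++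
    encodeBags I.bags)

/-- `k`-Coloring is solvable in time `O(β ^ pw · N ^ O(1))`, where `pw` is the width of the path
decomposition in the input, and `N` is the size of the input. -/
def ColoringSolvableInTime (k : ℕ) (β : ℝ) : Prop :=
  SolvableInTime ColoringInstance.encode (fun I => (edgeGraph I.edges).Colorable k)
    (fun I => width (bagSets I.bags)) β

/-! ### Satisfiability -/

/-- A literal over `n` variables: `(x, true)` stands for `x` and `(x, false)` for `¬ x`. -/
abbrev Literal (n : ℕ) : Type := Fin n × Bool

/-- A formula in conjunctive normal form over `n` variables, as a list of clauses. -/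
abbrev CNF (n : ℕ) : Type := List (List (Literal n))

/-- The formula has a satisfying assignment. -/
def CNF.Satisfiable {n : ℕ} (φ : CNF n) : Prop :=
  ∃ σ : Fin n → Bool, ∀ C ∈ φ, ∃ l ∈ C, σ l.1 = l.2

/-- The primal graph: two distinct variables are adjacent if they appear together in a clause. -/
def CNF.primalGraph {n : ℕ} (φ : CNF n) : SimpleGraph (Fin n) :=
  SimpleGraph.fromRel fun x y => ∃ C ∈ φ, (∃ b, (x, b) ∈ C) ∧ ∃ b, (y, b) ∈ C

/-- Input of 3-SAT: a formula with at most three literals in each clause, and a path decomposition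
of its primal graph. -/
structure ThreeSATInstance : Type where
  n : ℕ
  formula : CNF n
  bags : List (List (Fin n))
  arity : ∀ C ∈ formula, C.length ≤ 3
  decomposition : IsPathDecomposition formula.primalGraph (bagSets bags)

/-- The input of 3-SAT as a word. -/
def ThreeSATInstance.encode (I : ThreeSATInstance) : List ℕ :=
  I.n :: (encodeList (encodeList fun l : Literal I.n => [(l.1 : ℕ), l.2.toNat]) I.formula ++
    encodeBags I.bags)

/-- 3-SAT is solvable in time `O(β ^ pw · N ^ O(1))`, where `pw` is the width of the path
decomposition of the primal graph in the input, and `N` is the size of the input. -/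
def ThreeSATSolvableInTime (β : ℝ) : Prop :=
  SolvableInTime ThreeSATInstance.encode (fun I => I.formula.Satisfiable)
    (fun I => width (bagSets I.bags)) β

/-- The Primal Pathwidth-Strong Exponential Time Hypothesis: for no `ε > 0` is 3-SAT solvable in
time `(2 - ε) ^ pw · N ^ O(1)`. -/
def PPSETH : Prop :=
  ∀ ε : ℝ, 0 < ε → ε < 2 → ¬ ThreeSATSolvableInTime (2 - ε)

end PathwidthSETH

/-!
Both problems ask for an assignment that satisfies local constraints along a path decomposition;
they differ in the size `a` of the alphabet, and a dynamic program over the bags has about `a ^ pw`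
states. To pass from an alphabet of size `a` to one of size `b`, every bag gets its own copies of
its variables, which are gathered into blocks of `t`, and a block is written as `q` digits in base
`b`, where `q` is the least number with `a ^ t ≤ b ^ q`. Consistency of neighboring bags and the
constraints of the problem become forbidden patterns of digits, and each of these is expressed by a
gadget that adds only `O(1)` to the size of a bag. The new width is `(pw / t) * q + O(1)`, so that
an algorithm with base `β < b` yields one with base `β ^ (q / t)`, and as `q / t` tends to
`log a / log b`, this is less than `a` if `t` is large.

That the new instance can be computed in polynomial time is shown without writing its program:
functions of a word that are computable in polynomial time are closed under arithmetic, bounded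
sums and search, and words are written by nested loops.
-/

namespace PathwidthSETH

section RunningTime

open Polynomial

/-! ### Programs -/

theorem State.reg_setReg (s : State) (i v j : ℕ) :
    (s.setReg i v).reg j = if j = i then v else s.reg j :=
  Function.update_apply ..

theorem State.arr_setReg (s : State) (i v : ℕ) : (s.setReg i v).arr = s.arr := rfl

theorem State.reg_setArr (s : State) (a p v : ℕ) : (s.setArr a p v).reg = s.reg := rfl

theorem State.arr_setArr (s : State) (a p v b q : ℕ) :
    (s.setArr a p v).arr b q = if b = a ∧ q = p then v else s.arr b q := by
  simp only [State.setArr, Function.update_apply]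
  split_ifs <;> simp_all

/-- The configurations `s` and `s'` differ at most in the registers from `d` on. -/
def State.AgreeBelow (d : ℕ) (s s' : State) : Prop :=
  s'.arr = s.arr ∧ ∀ i < d, s'.reg i = s.reg i

theorem State.AgreeBelow.trans {d : ℕ} {s₁ s₂ s₃ : State} (h : s₁.AgreeBelow d s₂)
    (h' : s₂.AgreeBelow d s₃) : s₁.AgreeBelow d s₃ :=
  ⟨h'.1.trans h.1, fun i hi => (h'.2 i hi).trans (h.2 i hi)⟩

theorem State.AgreeBelow.mono {d d' : ℕ} {s s' : State} (h : s.AgreeBelow d' s') (hd : d ≤ d') :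
    s.AgreeBelow d s' :=
  ⟨h.1, fun i hi => h.2 i (hi.trans_le hd)⟩

theorem State.agreeBelow_setReg {d i : ℕ} (s : State) (v : ℕ) (hi : d ≤ i) :
    s.AgreeBelow d (s.setReg i v) :=
  ⟨rfl, fun _ hj => by rw [State.reg_setReg, if_neg (by omega)]⟩

/-- Started in the configuration `s`, the program `P` halts within time `t`, in a configuration
that satisfies `A`. -/
def Program.HaltsWithin (P : Program) (s : State) (t : ℕ) (A : State → Prop) : Prop :=
  ∃ s' t', Exec P s s' t' ∧ t' ≤ t ∧ A s'

theorem size_le_self (n : ℕ) : n.size ≤ n := Nat.size_le.2 Nat.lt_two_pow_self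

namespace Program

section

variable {P Q : Program} {s : State} {t u i j l : ℕ} {A B : State → Prop}

theorem HaltsWithin.mono (h : P.HaltsWithin s t A) (htu : t ≤ u) (hAB : ∀ s', A s' → B s') :
    P.HaltsWithin s u B := by
  obtain ⟨s', t', he, ht, hA⟩ := h
  exact ⟨s', t', he, ht.trans htu, hAB s' hA⟩

theorem HaltsWithin.seq (hP : P.HaltsWithin s t A)
    (hQ : ∀ s', A s' → Q.HaltsWithin s' u B) : (P.seq Q).HaltsWithin s (t + u) B := by
  obtain ⟨s₁, t₁, he₁, ht₁, hA⟩ := hP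
  obtain ⟨s₂, t₂, he₂, ht₂, hB⟩ := hQ s₁ hA
  exact ⟨s₂, t₁ + t₂, he₁.seq he₂, Nat.add_le_add ht₁ ht₂, hB⟩

theorem haltsWithin_const (i c : ℕ) (s : State) :
    (Program.const i c).HaltsWithin s (1 + c) (· = s.setReg i c) :=
  ⟨_, _, .const s i c, Nat.add_le_add_left (size_le_self c) 1, rfl⟩

theorem haltsWithin_load (i a j : ℕ) (s : State) :
    (Program.load i a j).HaltsWithin s (1 + s.reg j + s.arr a (s.reg j))
      (· = s.setReg i (s.arr a (s.reg j))) :=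
  ⟨_, _, .load s i a j, by gcongr <;> exact size_le_self _, rfl⟩

theorem HaltsWithin.ite {R : Program} (hi : s.reg i ≤ u) (hP : s.reg i ≠ 0 → P.HaltsWithin s t A)
    (hR : s.reg i = 0 → R.HaltsWithin s t A) : (Program.ite i P R).HaltsWithin s (1 + u + t) A := by
  have hsize := (size_le_self (s.reg i)).trans hi
  by_cases h : s.reg i = 0
  · obtain ⟨s', t', he, ht, hA⟩ := hR h
    exact ⟨s', _, .ite_false h he, by gcongr, hA⟩
  · obtain ⟨s', t', he, ht, hA⟩ := hP h
    exact ⟨s', _, .ite_true h he, by gcongr, hA⟩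

/-- The instruction `R i := R j`. -/
def copy (i j : ℕ) : Program := .seq (.const i 0) (.add i j i)

theorem haltsWithin_copy (hij : i ≠ j) (s : State) :
    (copy i j).HaltsWithin s (2 + s.reg j) (· = s.setReg i (s.reg j)) := by
  refine ⟨_, _, .seq (.const s i 0) (.add _ i j i), ?_, ?_⟩
  · have := size_le_self (s.reg j)
    simp only [State.reg_setReg, hij.symm, if_false, if_true, Nat.size_zero]
    omega
  · simp [State.setReg, hij.symm, Function.update_idem]

/-- Counts up in register `c`, counts down in register `c + 1`, and uses register `c + 2`. -/
def advance (c : ℕ) : Program :=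
  .seq (.const (c + 2) 1) (.seq (.add c c (c + 2)) (.sub (c + 1) (c + 1) (c + 2)))

theorem haltsWithin_advance (c : ℕ) (s : State) :
    (advance c).HaltsWithin s (6 + s.reg c + s.reg (c + 1)) fun s' =>
      s.AgreeBelow c s' ∧ s'.reg c = s.reg c + 1 ∧ s'.reg (c + 1) = s.reg (c + 1) - 1 := by
  refine ⟨_, _, .seq (.const s _ 1) (.seq (.add _ c c _) (.sub _ _ (c + 1) _)), ?_, ?_, ?_, ?_⟩
  · have := size_le_self (s.reg c)
    have := size_le_self (s.reg (c + 1))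
    simp only [State.reg_setReg, Nat.size_one, left_eq_add, add_right_inj, if_true, if_false,
      OfNat.ofNat_ne_zero, OfNat.one_ne_ofNat, add_eq_left, one_ne_zero]
    omega
  · exact ((s.agreeBelow_setReg _ (by omega)).trans
      (State.agreeBelow_setReg _ _ le_rfl)).trans (State.agreeBelow_setReg _ _ (by omega))
  · simp [State.reg_setReg]
  · simp [State.reg_setReg]

/-- Runs `P` repeatedly, counting the rounds in register `c`; the number of rounds left is in
register `c + 1`. -/
def loop (c : ℕ) (P : Program) : Program := .while (c + 1) (.seq P (advance c))

theorem haltsWithin_loop {c k r : ℕ} {I : ℕ → State → Prop}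
    (hI : ∀ i s s', s.AgreeBelow c s' → I i s → I i s')
    (hP : ∀ i < k + r, ∀ s, s.reg c = i → I i s → P.HaltsWithin s t fun s' =>
      I (i + 1) s' ∧ s'.reg c = s.reg c ∧ s'.reg (c + 1) = s.reg (c + 1))
    (hk : s.reg c = k) (hr : s.reg (c + 1) = r) (hs : I k s) :
    (loop c P).HaltsWithin s (1 + r * (7 + 2 * (k + r) + t)) (I (k + r)) := by
  induction r generalizing k s with
  | zero => exact ⟨s, _, .while_done hr, by simp [hr], hs⟩
  | succ r ih =>
    obtain ⟨s₁, t₁, he₁, ht₁, hI₁, hk₁, hr₁⟩ := hP k (by omega) s hk hs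
    obtain ⟨s₂, t₂, he₂, ht₂, hs₂, hk₂, hr₂⟩ := haltsWithin_advance c s₁
    obtain ⟨s₃, t₃, he₃, ht₃, hI₃⟩ := ih (s := s₂) (k := k + 1)
      (fun i hi => hP i (by omega)) (by omega) (by omega) (hI _ _ _ hs₂ hI₁)
    rw [add_right_comm k 1 r] at ht₃ hI₃
    refine ⟨s₃, _, .while_step (by omega) (he₁.seq he₂) he₃, ?_, hI₃⟩
    have := size_le_self (s.reg (c + 1))
    rw [Nat.succ_mul]
    have : r * (7 + 2 * (k + r + 1) + t) = r * (7 + 2 * (k + (r + 1)) + t) := by ring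
    omega

/-- Runs `P` as often as the number that `Q` puts into register `c + 1` says. -/
def forLoop (c : ℕ) (Q P : Program) : Program := .seq (.const c 0) (.seq Q (loop c P))

theorem haltsWithin_forLoop {c r : ℕ} {I : ℕ → State → Prop}
    (hI : ∀ i s s', s.AgreeBelow c s' → I i s → I i s')
    (hQ : ∀ s', s.AgreeBelow c s' →
      Q.HaltsWithin s' u fun s'' => s'.AgreeBelow (c + 1) s'' ∧ s''.reg (c + 1) = r)
    (hP : ∀ i < r, ∀ s, s.reg c = i → I i s → P.HaltsWithin s t fun s' =>
      I (i + 1) s' ∧ s'.reg c = s.reg c ∧ s'.reg (c + 1) = s.reg (c + 1))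
    (hs : I 0 s) :
    (forLoop c Q P).HaltsWithin s (1 + (u + (1 + r * (7 + 2 * r + t)))) (I r) := by
  refine (haltsWithin_const c 0 s).seq fun s₁ hs₁ => ?_
  have hs₁c : s₁.reg c = 0 := by simp [hs₁, State.reg_setReg]
  have hss₁ : s.AgreeBelow c s₁ := hs₁ ▸ s.agreeBelow_setReg 0 le_rfl
  refine (hQ s₁ hss₁).seq fun s₂ ⟨hs₁s₂, hs₂r⟩ => ?_
  have := haltsWithin_loop (k := 0) hI (by simpa using hP)
    ((hs₁s₂.2 c c.lt_succ_self).trans hs₁c) hs₂r (hI _ _ _ (hss₁.trans (hs₁s₂.mono c.le_succ)) hs)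
  rwa [Nat.zero_add] at this

end

end Program

/-! ### Polynomial time computations -/

/-- A context consists of a word, which a program finds in array `0`, and of finitely many further
numbers, which it finds in registers. Pairing with `ℕ` adds a number (such as a loop variable). -/
class Context (α : Type) where
  word : α → List ℕ
  vals : α → List ℕ

instance : Context (List ℕ) := ⟨fun w => w, fun _ => []⟩

instance {α : Type} [Context α] : Context (α × ℕ) :=
  ⟨fun x => Context.word x.1, fun x => x.2 :: Context.vals x.1⟩

/-- All numbers in the context are at most `M`. -/
def Context.Bounded {α : Type} [Context α] (x : α) (M : ℕ) : Prop :=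
  (∀ v ∈ Context.word x, v ≤ M) ∧ ∀ v ∈ Context.vals x, v ≤ M

/-- The configuration `s` holds the context `x`, with its numbers in the registers `ℓ`, all of
them below `d`. -/
structure Context.Stored {α : Type} [Context α] (ℓ : List ℕ) (d : ℕ) (x : α) (s : State) :
    Prop where
  lt : ∀ r ∈ ℓ, r < d
  vals : ℓ.map s.reg = Context.vals x
  word : ∀ p, s.arr 0 p = (Context.word x).getD p 0

/-- A numerical function of the context that is computed in polynomial time. Wherever the context
is stored, there is a program that keeps all arrays and the registers below a given register `d`,
and leaves the value in `d`. The values and the running time are bounded by a polynomial in any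
bound for the numbers in the context. -/
def PolyComputable {α : Type} [Context α] (f : α → ℕ) : Prop :=
  ∃ T : ℕ[X], (∀ x M, Context.Bounded x M → f x ≤ T.eval M) ∧
    ∀ (ℓ : List ℕ) (d : ℕ), ∃ P : Program, ∀ x s M, Context.Bounded x M →
      Context.Stored ℓ d x s →
        P.HaltsWithin s (T.eval M) fun s' => s.AgreeBelow d s' ∧ s'.reg d = f x

/-- A property of the context that is decided in polynomial time. -/
def PolyDecidable {α : Type} [Context α] (p : α → Prop) : Prop :=
  ∃ f : α → ℕ, PolyComputable f ∧ ∀ x, f x ≠ 0 ↔ p x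

section

variable {α : Type} [Context α]

namespace Context

theorem Bounded.mono {x : α} {M M' : ℕ} (h : Bounded x M) (hM : M ≤ M') : Bounded x M' :=
  ⟨fun v hv => (h.1 v hv).trans hM, fun v hv => (h.2 v hv).trans hM⟩

theorem Bounded.pair {x : α} {n M : ℕ} (h : Bounded x M) (hn : n ≤ M) : Bounded (x, n) M :=
  ⟨h.1, List.forall_mem_cons.2 ⟨hn, h.2⟩⟩

theorem Bounded.fst {x : α × ℕ} {M : ℕ} (h : Bounded x M) : Bounded x.1 M :=
  ⟨h.1, (List.forall_mem_cons.1 h.2).2⟩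

theorem Bounded.snd {x : α × ℕ} {M : ℕ} (h : Bounded x M) : x.2 ≤ M :=
  (List.forall_mem_cons.1 h.2).1

theorem Bounded.getD_le {x : α} {M : ℕ} (h : Bounded x M) (p : ℕ) : (word x).getD p 0 ≤ M := by
  rcases lt_or_ge p (word x).length with hp | hp
  · rw [List.getD_eq_getElem _ _ hp]
    exact h.1 _ (List.getElem_mem hp)
  · rw [List.getD_eq_default _ _ hp]
    exact M.zero_le

variable {ℓ : List ℕ} {d : ℕ} {x : α} {s s' : State}

theorem Stored.frame (h : Stored ℓ d x s) (ha : s'.arr 0 = s.arr 0)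
    (hr : ∀ i < d, s'.reg i = s.reg i) : Stored ℓ d x s' :=
  ⟨h.lt, h.vals ▸ List.map_congr_left fun r hr' => hr r (h.lt r hr'), fun p => ha ▸ h.word p⟩

theorem Stored.of_agreeBelow (h : Stored ℓ d x s) (hs : s.AgreeBelow d s') : Stored ℓ d x s' :=
  h.frame (congrFun hs.1 0) hs.2

theorem Stored.mono {d' : ℕ} (h : Stored ℓ d x s) (hd : d ≤ d') : Stored ℓ d' x s :=
  ⟨fun r hr => (h.lt r hr).trans_le hd, h.vals, h.word⟩

theorem Stored.cons {r : ℕ} (h : Stored ℓ d x s) (hr : r < d) : Stored (r :: ℓ) d (x, s.reg r) s :=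
  ⟨List.forall_mem_cons.2 ⟨hr, h.lt⟩, congrArg (s.reg r :: ·) h.vals, h.word⟩

end Context

open Context

namespace PolyComputable

variable {f g : α → ℕ}

theorem congr (hf : PolyComputable f) (h : ∀ x, g x = f x) : PolyComputable g :=
  funext h ▸ hf

theorem const (n : ℕ) : PolyComputable fun _ : α => n := by
  refine ⟨C (1 + n), fun _ _ _ => by simp, fun ℓ d => ⟨.const d n, fun x s M _ _ => ?_⟩⟩
  rw [eval_C]
  refine (Program.haltsWithin_const d n s).mono le_rfl ?_
  rintro _ rfl
  exact ⟨s.agreeBelow_setReg n le_rfl, by simp [State.reg_setReg]⟩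

theorem fst (hf : PolyComputable f) : PolyComputable fun x : α × ℕ => f x.1 := by
  obtain ⟨T, hT, h⟩ := hf
  refine ⟨T, fun x M hx => hT _ _ hx.fst, fun ℓ d => ?_⟩
  obtain ⟨P, hP⟩ := h ℓ.tail d
  refine ⟨P, fun x s M hx hs => hP x.1 s M hx.fst ⟨fun r hr => hs.lt r (List.mem_of_mem_tail hr),
    ?_, hs.word⟩⟩
  rw [List.map_tail, hs.vals]
  rfl

theorem snd : PolyComputable fun x : α × ℕ => x.2 := by
  refine ⟨2 + X, fun x M hx => by simpa using hx.snd.trans (Nat.le_add_left M 2), ?_⟩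
  rintro (_ | ⟨r, ℓ⟩) d
  · exact ⟨.const 0 0, fun x s M _ hs => absurd hs.vals (by simp [Context.vals])⟩
  · refine ⟨.copy d r, fun x s M hx hs => ?_⟩
    have hr : s.reg r = x.2 := (List.cons.inj hs.vals).1
    refine (Program.haltsWithin_copy (hs.lt r List.mem_cons_self).ne' s).mono ?_ ?_
    · simpa [hr] using hx.snd
    · rintro _ rfl
      exact ⟨s.agreeBelow_setReg _ le_rfl, by simp [State.reg_setReg, hr]⟩

theorem read (hf : PolyComputable f) : PolyComputable fun x => (word x).getD (f x) 0 := by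
  obtain ⟨T, hT, h⟩ := hf
  refine ⟨T + (1 + T + X), fun x M hx => ?_, fun ℓ d => ?_⟩
  · have := hx.getD_le (f x)
    simp only [eval_add, eval_X]
    omega
  obtain ⟨P, hP⟩ := h ℓ d
  refine ⟨.seq P (.load d 0 d), fun x s M hx hs => ?_⟩
  rw [eval_add]
  refine (hP x s M hx hs).seq fun s₁ ⟨hs₁, hd⟩ =>
    (Program.haltsWithin_load d 0 d s₁).mono ?_ ?_
  · have := hT x M hx
    have := hx.getD_le (f x)
    simp only [hd, hs₁.1, hs.word, eval_add, eval_one, eval_X]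
    omega
  · rintro _ rfl
    exact ⟨hs₁.trans (s₁.agreeBelow_setReg _ le_rfl),
      by simp only [State.reg_setReg, if_true, hd, hs₁.1, hs.word]⟩

theorem binary {op : ℕ → ℕ → ℕ} {instr : ℕ → ℕ → ℕ → Program}
    (hinstr : ∀ s i j l, Exec (instr i j l) s (s.setReg i (op (s.reg j) (s.reg l)))
      (1 + (s.reg j).size + (s.reg l).size))
    (hop : ∀ m n, op m n ≤ m + n) (hf : PolyComputable f) (hg : PolyComputable g) :
    PolyComputable fun x => op (f x) (g x) := by
  obtain ⟨T, hT, hf⟩ := hf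
  obtain ⟨U, hU, hg⟩ := hg
  refine ⟨T + (U + (1 + T + U)), fun x M hx => (hop _ _).trans ?_, fun ℓ d => ?_⟩
  · have := hT x M hx
    have := hU x M hx
    simp only [eval_add, eval_one]
    omega
  obtain ⟨P, hP⟩ := hf ℓ d
  obtain ⟨Q, hQ⟩ := hg ℓ (d + 1)
  refine ⟨.seq P (.seq Q (instr d d (d + 1))), fun x s M hx hs => ?_⟩
  rw [eval_add, eval_add]
  refine (hP x s M hx hs).seq fun s₁ ⟨hs₁, hd₁⟩ => (hQ x s₁ M hx
    ((hs.of_agreeBelow hs₁).mono d.le_succ)).seq fun s₂ ⟨hs₂, hd₂⟩ =>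
      ⟨_, _, hinstr s₂ d d (d + 1), ?_, ?_, ?_⟩
  · have := (size_le_self (s₂.reg d)).trans (hs₂.2 d d.lt_succ_self ▸ hd₁ ▸ hT x M hx)
    have := (size_le_self (s₂.reg (d + 1))).trans (hd₂ ▸ hU x M hx)
    simp only [eval_add, eval_one]
    omega
  · exact hs₁.trans ((hs₂.mono d.le_succ).trans (s₂.agreeBelow_setReg _ le_rfl))
  · rw [State.reg_setReg, if_pos rfl, hs₂.2 d d.lt_succ_self, hd₁, hd₂]

theorem add (hf : PolyComputable f) (hg : PolyComputable g) :
    PolyComputable fun x => f x + g x :=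
  binary Exec.add (fun _ _ => le_rfl) hf hg

theorem sub (hf : PolyComputable f) (hg : PolyComputable g) :
    PolyComputable fun x => f x - g x :=
  binary Exec.sub (fun m n => (m.sub_le n).trans (m.le_add_right n)) hf hg

theorem ite {p : α → Prop} [DecidablePred p] (hp : PolyDecidable p) (hf : PolyComputable f)
    (hg : PolyComputable g) : PolyComputable fun x => if p x then f x else g x := by
  obtain ⟨c, ⟨S, hS, hc⟩, hcp⟩ := hp
  obtain ⟨T, hT, hf⟩ := hf
  obtain ⟨U, hU, hg⟩ := hg
  refine ⟨S + (1 + S + (T + U)), fun x M hx => ?_, fun ℓ d => ?_⟩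
  · have := hT x M hx
    have := hU x M hx
    simp only [eval_add, eval_one]
    split_ifs <;> omega
  obtain ⟨P, hP⟩ := hc ℓ d
  obtain ⟨Q, hQ⟩ := hf ℓ d
  obtain ⟨R, hR⟩ := hg ℓ d
  refine ⟨.seq P (.ite d Q R), fun x s M hx hs => ?_⟩
  simp only [eval_add, eval_one]
  refine (hP x s M hx hs).seq fun s₁ ⟨hs₁, hd₁⟩ => .ite (hd₁ ▸ hS x M hx) (fun h => ?_) fun h => ?_
  · refine (hQ x s₁ M hx (hs.of_agreeBelow hs₁)).mono le_self_add fun s₂ ⟨hs₂, hd₂⟩ =>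
      ⟨hs₁.trans hs₂, ?_⟩
    rw [hd₂, if_pos ((hcp x).1 (hd₁ ▸ h))]
  · refine (hR x s₁ M hx (hs.of_agreeBelow hs₁)).mono le_add_self fun s₂ ⟨hs₂, hd₂⟩ =>
      ⟨hs₁.trans hs₂, ?_⟩
    rw [hd₂, if_neg fun hx => (hcp x).2 hx (hd₁ ▸ h)]

/-- The bound `B` on the intermediate values excludes iterated squaring. -/
theorem recursion {n : α → ℕ} {F : α → ℕ → ℕ} {step : (α × ℕ) × ℕ → ℕ} (hn : PolyComputable n)
    (h0 : PolyComputable fun x => F x 0) (hstep : PolyComputable step)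
    (hF : ∀ x i, F x (i + 1) = step ((x, i), F x i)) (B : ℕ[X])
    (hB : ∀ x M, Bounded x M → ∀ i ≤ n x, F x i ≤ B.eval M) :
    PolyComputable fun x => F x (n x) := by
  obtain ⟨S, hS, hn⟩ := hn
  obtain ⟨T, -, h0⟩ := h0
  obtain ⟨U, -, hstep⟩ := hstep
  set K : ℕ[X] := X + S + B with hK
  refine ⟨B + (T + (1 + (S + (1 + S * (7 + 2 * S + (U.comp K + (2 + B))))))), fun x M hx =>
    (hB x M hx _ le_rfl).trans (by rw [eval_add]; exact le_self_add), fun ℓ d => ?_⟩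
  obtain ⟨P, hP⟩ := h0 ℓ d
  obtain ⟨Q, hQ⟩ := hn ℓ (d + 2)
  obtain ⟨R, hR⟩ := hstep (d :: (d + 1) :: ℓ) (d + 3)
  refine ⟨.seq P (.forLoop (d + 1) Q (.seq R (.copy d (d + 3)))), fun x s M hx hs => ?_⟩
  have hSM := hS x M hx
  have body : ∀ i < n x, ∀ s', s'.reg (d + 1) = i → s.AgreeBelow d s' ∧ s'.reg d = F x i →
      (Program.seq R (.copy d (d + 3))).HaltsWithin s' (U.eval (K.eval M) + (2 + B.eval M))
        fun s'' => (s.AgreeBelow d s'' ∧ s''.reg d = F x (i + 1)) ∧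
          s''.reg (d + 1) = s'.reg (d + 1) ∧ s''.reg (d + 1 + 1) = s'.reg (d + 1 + 1) := by
    rintro i hi s' rfl ⟨hs', hd⟩
    have hBi := hB x M hx _ hi.le
    have hBi' := hB x M hx (s'.reg (d + 1) + 1) hi
    have hMK : M + S.eval M + B.eval M = K.eval M := by simp [hK]
    refine (hR _ s' _ (((hx.mono (by omega)).pair (by omega)).pair (by omega))
      ((((hs.of_agreeBelow hs').mono (by omega)).cons (by omega)).cons
        (by omega))).seq fun s₁ ⟨hs₁, hd₁⟩ => ?_
    rw [hd, ← hF] at hd₁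
    refine (Program.haltsWithin_copy (by omega) s₁).mono (by omega) ?_
    rintro _ rfl
    simp only [State.reg_setReg, if_true, hd₁, hs₁.2 (d + 1) (by omega),
      hs₁.2 (d + 1 + 1) (by omega), Nat.succ_ne_self, Nat.add_eq_left, OfNat.ofNat_ne_zero,
      add_assoc, Nat.reduceAdd, if_false, and_true]
    exact hs'.trans ((hs₁.mono (by omega)).trans (s₁.agreeBelow_setReg _ le_rfl))
  refine ((hP x s M hx hs).seq fun s₁ ⟨hs₁, hd₁⟩ => Program.haltsWithin_forLoop (c := d + 1)
    (I := fun i s' => s.AgreeBelow d s' ∧ s'.reg d = F x i)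
    (fun i s₁ s₂ h h' => ⟨h'.1.trans (h.mono d.le_succ), (h.2 d d.lt_succ_self).trans h'.2⟩)
    (fun s₂ hs₂ => hQ x s₂ M hx (((hs.of_agreeBelow hs₁).mono d.le_succ).of_agreeBelow hs₂ |>.mono
      (d + 1).le_succ)) body ⟨hs₁, hd₁⟩).mono ?_ fun _ h => h
  simp only [eval_add, eval_mul, eval_comp, eval_one, eval_ofNat]
  refine le_add_left ?_
  gcongr

end PolyComputable

end

open Context

section

variable {α : Type} [Context α]

theorem PolyComputable.sum {n : α → ℕ} {g : α → ℕ → ℕ} (hn : PolyComputable n)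
    (hg : PolyComputable fun x : α × ℕ => g x.1 x.2) :
    PolyComputable fun x => ∑ i ∈ Finset.range (n x), g x i := by
  obtain ⟨S, hS, -⟩ := id hn
  obtain ⟨U, hU, -⟩ := id hg
  refine recursion (F := fun x k => ∑ i ∈ Finset.range k, g x i)
    (step := fun y => y.2 + g y.1.1 y.1.2) hn (const 0) (snd.add hg.fst)
    (fun _ _ => Finset.sum_range_succ _ _)
    (S * U.comp (X + S)) fun x M hx k hk => ?_
  have hSM := hS x M hx
  calc ∑ i ∈ Finset.range k, g x i ≤ k * U.eval (M + S.eval M) := by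
        simpa using Finset.sum_le_card_nsmul (Finset.range k) (g x) _ fun i hi =>
          hU (x, i) _ ((hx.mono le_self_add).pair (by have := Finset.mem_range.1 hi; omega))
    _ ≤ S.eval M * U.eval (M + S.eval M) := Nat.mul_le_mul_right _ (hk.trans hSM)
    _ = (S * U.comp (X + S)).eval M := by simp

theorem PolyComputable.mul {f g : α → ℕ} (hf : PolyComputable f) (hg : PolyComputable g) :
    PolyComputable fun x => f x * g x :=
  (sum (g := fun x _ => g x) hf hg.fst).congr fun x => by simp

namespace PolyDecidable

variable {p q : α → Prop} {f g n : α → ℕ}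

theorem congr (hp : PolyDecidable p) (h : ∀ x, q x ↔ p x) : PolyDecidable q :=
  (funext fun x => propext (h x) : q = p) ▸ hp

theorem lt (hf : PolyComputable f) (hg : PolyComputable g) : PolyDecidable fun x => f x < g x :=
  ⟨_, hg.sub hf, fun x => by omega⟩

theorem not (hp : PolyDecidable p) : PolyDecidable fun x => ¬ p x := by
  obtain ⟨f, hf, h⟩ := hp
  exact ⟨_, (PolyComputable.const 1).sub hf, fun x => by beta_reduce; rw [← h x]; omega⟩

theorem or (hp : PolyDecidable p) (hq : PolyDecidable q) : PolyDecidable fun x => p x ∨ q x := by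
  obtain ⟨f, hf, h⟩ := hp
  obtain ⟨g, hg, h'⟩ := hq
  exact ⟨_, hf.add hg, fun x => by beta_reduce; rw [← h x, ← h' x]; omega⟩

theorem and (hp : PolyDecidable p) (hq : PolyDecidable q) : PolyDecidable fun x => p x ∧ q x :=
  (hp.not.or hq.not).not.congr fun x => by tauto

theorem le (hf : PolyComputable f) (hg : PolyComputable g) : PolyDecidable fun x => f x ≤ g x :=
  (lt hg hf).not.congr fun _ => not_lt.symm

theorem eq (hf : PolyComputable f) (hg : PolyComputable g) : PolyDecidable fun x => f x = g x :=
  ((le hf hg).and (le hg hf)).congr fun _ => le_antisymm_iff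

theorem exists_lt {p : α → ℕ → Prop} (hn : PolyComputable n)
    (hp : PolyDecidable fun x : α × ℕ => p x.1 x.2) :
    PolyDecidable fun x => ∃ i < n x, p x i := by
  obtain ⟨f, hf, h⟩ := hp
  refine ⟨_, .sum (g := fun x i => f (x, i)) hn hf, fun x => ?_⟩
  simp only [Ne, Finset.sum_eq_zero_iff, Finset.mem_range, not_forall, exists_prop]
  exact exists_congr fun i => and_congr_right fun _ => h (x, i)

theorem forall_lt {p : α → ℕ → Prop} (hn : PolyComputable n)
    (hp : PolyDecidable fun x : α × ℕ => p x.1 x.2) :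
    PolyDecidable fun x => ∀ i < n x, p x i :=
  (exists_lt (p := fun x i => ¬ p x i) hn hp.not).not.congr fun x => by push Not; rfl

end PolyDecidable

/-- The largest value of `g` below `n`. -/
def maxBelow (n : ℕ) (g : ℕ → ℕ) : ℕ := (Finset.range n).sup g

/-- The digit of weight `b ^ i` of `x` in base `b`. -/
def digit (b x i : ℕ) : ℕ := x / b ^ i % b

namespace PolyComputable

variable {f g n : α → ℕ}

theorem count {p : α → ℕ → Prop} [∀ x, DecidablePred (p x)] (hn : PolyComputable n)
    (hp : PolyDecidable fun x : α × ℕ => p x.1 x.2) :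
    PolyComputable fun x => ((Finset.range (n x)).filter (p x)).card :=
  (sum (g := fun x i => if p x i then 1 else 0) hn (ite hp (const 1) (const 0))).congr
    fun _ => Finset.card_filter _ _

theorem div (hf : PolyComputable f) (hg : PolyComputable g) :
    PolyComputable fun x => f x / g x := by
  refine (count (p := fun x i => 0 < g x ∧ (i + 1) * g x ≤ f x) hf ((PolyDecidable.lt (const 0)
    hg.fst).and (.le ((snd.add (const 1)).mul hg.fst) hf.fst))).congr fun x => ?_
  rcases Nat.eq_zero_or_pos (g x) with h | h
  · simp [h]
  · have : (Finset.range (f x)).filter (fun i => 0 < g x ∧ (i + 1) * g x ≤ f x) =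
        Finset.range (f x / g x) := by
      ext i
      have := Nat.div_le_self (f x) (g x)
      simp only [Finset.mem_filter, Finset.mem_range, ← Nat.le_div_iff_mul_le h]
      omega
    rw [this, Finset.card_range]

theorem mod (hf : PolyComputable f) (hg : PolyComputable g) : PolyComputable fun x => f x % g x :=
  (hf.sub (hg.mul (hf.div hg))).congr fun _ => Nat.mod_eq_sub_mul_div

theorem max (hf : PolyComputable f) (hg : PolyComputable g) :
    PolyComputable fun x => max (f x) (g x) :=
  (hf.add (hg.sub hf)).congr fun x => by omega

theorem maxBelow {g : α → ℕ → ℕ} (hn : PolyComputable n)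
    (hg : PolyComputable fun x : α × ℕ => g x.1 x.2) :
    PolyComputable fun x => maxBelow (n x) (g x) := by
  obtain ⟨S, hS, -⟩ := id hn
  obtain ⟨U, hU, -⟩ := id hg
  refine recursion (F := fun x k => PathwidthSETH.maxBelow k (g x))
    (step := fun y => Max.max (g y.1.1 y.1.2) y.2) hn (const 0) (hg.fst.max snd)
    (fun x i => by simp [PathwidthSETH.maxBelow, Finset.range_add_one]) (U.comp (X + S))
    fun x M hx k hk => Finset.sup_le fun i hi => ?_
  have hSM := hS x M hx
  have hik := Finset.mem_range.1 hi
  simpa using hU (x, i) _ ((hx.mono le_self_add).pair (show i ≤ M + S.eval M by omega))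

theorem div_pow (b : ℕ) (hf : PolyComputable f) (hg : PolyComputable g) :
    PolyComputable fun x => f x / b ^ g x := by
  obtain ⟨S, hS, -⟩ := id hf
  exact recursion (F := fun x k => f x / b ^ k) (step := fun y => y.2 / b) hg
    (hf.congr fun x => by simp) (snd.div (const b))
    (fun x i => by rw [pow_succ, Nat.div_div_eq_div_mul]) S
    fun x M hx i _ => (Nat.div_le_self _ _).trans (hS x M hx)

theorem digit (b : ℕ) (hf : PolyComputable f) (hg : PolyComputable g) :
    PolyComputable fun x => digit b (f x) (g x) :=
  (div_pow b hf hg).mod (const b)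

end PolyComputable

end

/-! ### Words written in polynomial time -/

/-- The output `out` is stored in array `1`, and its length in the first cell of array `2`. -/
structure State.HasOutput (s : State) (out : List ℕ) : Prop where
  cells : ∀ p, s.arr 1 p = out.getD p 0
  length : s.arr 2 0 = out.length

/-- The configurations `s` and `s'` differ at most in the registers from `d` on and in the arrays
`1` and `2`, which are reserved for the output. -/
structure State.AgreeUpToOutput (d : ℕ) (s s' : State) : Prop where
  arr : ∀ a, a ≠ 1 → a ≠ 2 → s'.arr a = s.arr a
  reg : ∀ i < d, s'.reg i = s.reg i

theorem State.AgreeUpToOutput.trans {d : ℕ} {s₁ s₂ s₃ : State} (h : s₁.AgreeUpToOutput d s₂)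
    (h' : s₂.AgreeUpToOutput d s₃) : s₁.AgreeUpToOutput d s₃ :=
  ⟨fun a h₁ h₂ => (h'.arr a h₁ h₂).trans (h.arr a h₁ h₂),
    fun i hi => (h'.reg i hi).trans (h.reg i hi)⟩

theorem State.AgreeUpToOutput.mono {d d' : ℕ} {s s' : State} (h : s.AgreeUpToOutput d' s')
    (hd : d ≤ d') : s.AgreeUpToOutput d s' :=
  ⟨h.arr, fun i hi => h.reg i (hi.trans_le hd)⟩

theorem State.AgreeBelow.agreeUpToOutput {d : ℕ} {s s' : State} (h : s.AgreeBelow d s') :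
    s.AgreeUpToOutput d s' :=
  ⟨fun a _ _ => congrFun h.1 a, h.2⟩

theorem State.HasOutput.of_agreeBelow {d : ℕ} {s s' : State} {out : List ℕ} (h : s.HasOutput out)
    (hs : s.AgreeBelow d s') : s'.HasOutput out :=
  ⟨fun p => hs.1 ▸ h.cells p, hs.1 ▸ h.length⟩

theorem getD_append_singleton (l : List ℕ) (v p : ℕ) :
    (l ++ [v]).getD p 0 = if p = l.length then v else l.getD p 0 := by
  simp only [List.getD_eq_getElem?_getD]
  rcases lt_trichotomy p l.length with h | rfl | h
  · rw [if_neg h.ne, List.getElem?_append_left h]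
  · simp
  · rw [if_neg h.ne', List.getElem?_eq_none h.le, List.getElem?_eq_none (by simp; omega)]

theorem length_flatMap_range_le {β : Type*} {g : ℕ → List β} {k m : ℕ}
    (hg : ∀ i < k, (g i).length ≤ m) : ((List.range k).flatMap g).length ≤ k * m := by
  rw [List.length_flatMap]
  refine (List.sum_le_card_nsmul _ m fun v hv => ?_).trans (by simp)
  obtain ⟨i, hi, rfl⟩ := List.mem_map.1 hv
  exact hg i (List.mem_range.1 hi)

/-- Appends the number in register `d` to the output. -/
def Program.push (d : ℕ) : Program :=
  .seq (.const (d + 1) 0) (.seq (.load (d + 2) 2 (d + 1)) (.seq (.store 1 (d + 2) d)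
    (.seq (.const (d + 3) 1) (.seq (.add (d + 2) (d + 2) (d + 3)) (.store 2 (d + 1) (d + 2))))))

theorem Program.haltsWithin_push {s : State} {out : List ℕ} (d : ℕ) (hs : s.HasOutput out) :
    (push d).HaltsWithin s (10 + s.reg d + 4 * out.length) fun s' =>
      s.AgreeUpToOutput d s' ∧ s'.HasOutput (out ++ [s.reg d]) := by
  refine ⟨_, _, .seq (.const _ _ _) (.seq (.load _ _ _ _) (.seq (.store _ _ _ _)
    (.seq (.const _ _ _) (.seq (.add _ _ _ _) (.store _ _ _ _))))), ?_, ⟨?_, ?_⟩, ?_, ?_⟩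
  · have := size_le_self (s.reg d)
    have := size_le_self out.length
    have := size_le_self (out.length + 1)
    simp only [State.reg_setReg, State.reg_setArr, State.arr_setReg, hs.length, if_true, if_false,
      Nat.size_zero, Nat.size_one, Nat.add_left_cancel_iff, Nat.left_eq_add, Nat.reduceEqDiff,
      OfNat.ofNat_ne_zero, OfNat.one_ne_ofNat, one_ne_zero]
    omega
  · intro a h₁ h₂
    funext p
    simp [State.arr_setArr, State.arr_setReg, h₁, h₂]
  · intro i hi
    simp only [State.reg_setReg, State.reg_setArr]
    iterate 4 rw [if_neg (by omega)]
  · intro p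
    rw [getD_append_singleton, ← hs.cells]
    simp [State.arr_setArr, State.arr_setReg, State.reg_setReg, State.reg_setArr, hs.length]
  · simp [State.arr_setArr, State.arr_setReg, State.reg_setReg, State.reg_setArr, hs.length]

section

variable {α : Type} [Context α]

/-- A function from the context to words that is written in polynomial time: wherever the context
is stored, there is a program that appends the word to the output and otherwise only uses the
registers from `d` on. The running time is bounded by a polynomial in any bound for the numbers in
the context and for the length of the previous output. -/
def PolyWritable (f : α → List ℕ) : Prop :=
  ∃ T : ℕ[X], (∀ x M, Bounded x M → (f x).length ≤ T.eval M) ∧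
    ∀ (ℓ : List ℕ) (d : ℕ), ∃ P : Program, ∀ x s M out, Bounded x M → Stored ℓ d x s →
      s.HasOutput out → out.length ≤ M →
        P.HaltsWithin s (T.eval M) fun s' => s.AgreeUpToOutput d s' ∧ s'.HasOutput (out ++ f x)

theorem Context.Stored.of_agreeUpToOutput {ℓ : List ℕ} {d : ℕ} {x : α} {s s' : State}
    (h : Stored ℓ d x s) (hs : s.AgreeUpToOutput d s') : Stored ℓ d x s' :=
  h.frame (hs.arr 0 (by decide) (by decide)) hs.reg

namespace PolyWritable

theorem congr {f g : α → List ℕ} (hf : PolyWritable f) (h : ∀ x, g x = f x) : PolyWritable g :=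
  funext h ▸ hf

theorem singleton {f : α → ℕ} (hf : PolyComputable f) : PolyWritable fun x => [f x] := by
  obtain ⟨T, hT, h⟩ := hf
  refine ⟨T + (10 + T + 4 * X), fun x M _ => ?_, fun ℓ d => ?_⟩
  · simp only [List.length_singleton, eval_add, eval_ofNat]
    omega
  obtain ⟨P, hP⟩ := h ℓ d
  refine ⟨.seq P (.push d), fun x s M out hx hs ho hM => ?_⟩
  rw [eval_add]
  refine (hP x s M hx hs).seq fun s₁ ⟨hs₁, hd₁⟩ =>
    (Program.haltsWithin_push d (ho.of_agreeBelow hs₁)).mono ?_ fun s₂ ⟨hs₂, ho₂⟩ =>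
      ⟨hs₁.agreeUpToOutput.trans hs₂, by rwa [hd₁] at ho₂⟩
  have := hT x M hx
  simp only [hd₁, eval_add, eval_mul, eval_ofNat, eval_X]
  omega

theorem append {f g : α → List ℕ} (hf : PolyWritable f) (hg : PolyWritable g) :
    PolyWritable fun x => f x ++ g x := by
  obtain ⟨T, hT, hf⟩ := hf
  obtain ⟨U, hU, hg⟩ := hg
  refine ⟨T + U.comp (X + T), fun x M hx => ?_, fun ℓ d => ?_⟩
  · simpa using Nat.add_le_add (hT x M hx) (hU x _ (hx.mono (le_self_add (b := T.eval M))))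
  obtain ⟨P, hP⟩ := hf ℓ d
  obtain ⟨Q, hQ⟩ := hg ℓ d
  refine ⟨.seq P Q, fun x s M out hx hs ho hM => ?_⟩
  have hlen : (out ++ f x).length ≤ M + T.eval M := by
    simpa using Nat.add_le_add hM (hT x M hx)
  refine ((hP x s M out hx hs ho hM).seq fun s₁ ⟨hs₁, ho₁⟩ =>
    (hQ x s₁ _ _ (hx.mono le_self_add) (hs.of_agreeUpToOutput hs₁) ho₁ hlen).mono le_rfl
      fun s₂ ⟨hs₂, ho₂⟩ => ⟨hs₁.trans hs₂, List.append_assoc .. ▸ ho₂⟩).mono ?_ fun _ h => h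
  simp

theorem cons {f : α → ℕ} {g : α → List ℕ} (hf : PolyComputable f) (hg : PolyWritable g) :
    PolyWritable fun x => f x :: g x :=
  (singleton hf).append hg

theorem flatMap {n : α → ℕ} {g : α → ℕ → List ℕ} (hn : PolyComputable n)
    (hg : PolyWritable fun x : α × ℕ => g x.1 x.2) :
    PolyWritable fun x => (List.range (n x)).flatMap (g x) := by
  obtain ⟨S, hS, hn⟩ := hn
  obtain ⟨U, hU, hg⟩ := hg
  set L : ℕ[X] := S * U.comp (X + S) with hL
  have length_le : ∀ x M, Bounded x M → ∀ k ≤ n x,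
      ((List.range k).flatMap (g x)).length ≤ L.eval M := fun x M hx k hk => by
    have hSM := hS x M hx
    refine (length_flatMap_range_le fun i hi => hU (x, i) _ ((hx.mono le_self_add).pair
      (show i ≤ M + S.eval M by omega))).trans ?_
    simpa [hL] using Nat.mul_le_mul_right _ (hk.trans hSM)
  set K : ℕ[X] := X + S + L with hK
  refine ⟨L + (1 + (S + (1 + S * (7 + 2 * S + U.comp K)))), fun x M hx =>
    (length_le x M hx _ le_rfl).trans (by simp), fun ℓ d => ?_⟩
  obtain ⟨Q, hQ⟩ := hn ℓ (d + 1)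
  obtain ⟨R, hR⟩ := hg (d :: ℓ) (d + 2)
  refine ⟨.forLoop d Q R, fun x s M out hx hs ho hM => ?_⟩
  have hSM := hS x M hx
  have body : ∀ i < n x, ∀ s', s'.reg d = i → s.AgreeUpToOutput d s' ∧
      s'.HasOutput (out ++ (List.range i).flatMap (g x)) →
      R.HaltsWithin s' (U.eval (K.eval M)) fun s'' => (s.AgreeUpToOutput d s'' ∧
        s''.HasOutput (out ++ (List.range (i + 1)).flatMap (g x))) ∧
          s''.reg d = s'.reg d ∧ s''.reg (d + 1) = s'.reg (d + 1) := by
    rintro i hi s' rfl ⟨hs', ho'⟩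
    have hlen := length_le x M hx _ hi.le
    have hMK : M + S.eval M + L.eval M = K.eval M := by simp [hK]
    refine (hR _ s' _ _ ((hx.mono (by omega)).pair (by omega))
      (((hs.of_agreeUpToOutput hs').mono (by omega)).cons (by omega)) ho'
      (by rw [List.length_append]; omega)).mono le_rfl fun s₁ ⟨hs₁, ho₁⟩ =>
        ⟨⟨hs'.trans (hs₁.mono (by omega)), ?_⟩, hs₁.reg d (by omega), hs₁.reg _ (by omega)⟩
    rwa [List.range_succ, List.flatMap_append, List.flatMap_singleton, ← List.append_assoc]
  refine (Program.haltsWithin_forLoop (r := n x)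
    (I := fun i s' => s.AgreeUpToOutput d s' ∧
      s'.HasOutput (out ++ (List.range i).flatMap (g x)))
    (fun i s₁ s₂ h h' => ⟨h'.1.trans h.agreeUpToOutput, h'.2.of_agreeBelow h⟩)
    (fun s₁ hs₁ => hQ x s₁ M hx ((hs.of_agreeBelow hs₁).mono d.le_succ)) body
    ⟨⟨fun _ _ _ => rfl, fun _ _ => rfl⟩, by simpa using ho⟩).mono ?_ fun _ h => h
  simp only [eval_add, eval_mul, eval_comp, eval_one, eval_ofNat]
  refine le_add_left ?_
  gcongr

end PolyWritable

end

/-! ### Reductions -/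

/-- All registers that the program mentions are below this number. -/
def Program.regBound : Program → ℕ
  | .const i _ => i + 1
  | .add i j l => max (i + 1) (max (j + 1) (l + 1))
  | .sub i j l => max (i + 1) (max (j + 1) (l + 1))
  | .load i _ j => max (i + 1) (j + 1)
  | .store _ i j => max (i + 1) (j + 1)
  | .seq P Q => max P.regBound Q.regBound
  | .ite i P Q => max (i + 1) (max P.regBound Q.regBound)
  | .while i P => max (i + 1) P.regBound

theorem Exec.reg_of_regBound_le {P : Program} {s s' : State} {t : ℕ} (h : Exec P s s' t) {i : ℕ}
    (hi : P.regBound ≤ i) : s'.reg i = s.reg i := by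
  induction h with
  | const | add | sub | load =>
    simp only [Program.regBound] at hi
    rw [State.reg_setReg, if_neg (by omega)]
  | store | while_done => rfl
  | seq _ _ ih ih' => exact (ih' (le_of_max_le_right hi)).trans (ih (le_of_max_le_left hi))
  | ite_true _ _ ih => exact ih (le_of_max_le_left (le_of_max_le_right hi))
  | ite_false _ _ ih => exact ih (le_of_max_le_right (le_of_max_le_right hi))
  | while_step _ _ _ ih ih' => exact (ih' hi).trans (ih (le_of_max_le_right hi))

/-- The program with its registers renamed by `ρ` and its arrays renamed by `τ`. -/
def Program.rename (ρ τ : ℕ → ℕ) : Program → Program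
  | .const i c => .const (ρ i) c
  | .add i j l => .add (ρ i) (ρ j) (ρ l)
  | .sub i j l => .sub (ρ i) (ρ j) (ρ l)
  | .load i a j => .load (ρ i) (τ a) (ρ j)
  | .store a i j => .store (τ a) (ρ i) (ρ j)
  | .seq P Q => .seq (P.rename ρ τ) (Q.rename ρ τ)
  | .ite i P Q => .ite (ρ i) (P.rename ρ τ) (Q.rename ρ τ)
  | .while i P => .while (ρ i) (P.rename ρ τ)

/-- The part of the configuration that a renamed program sees. -/
def State.pull (ρ τ : ℕ → ℕ) (s : State) : State := ⟨fun i => s.reg (ρ i), fun a => s.arr (τ a)⟩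

section

variable {ρ τ : ℕ → ℕ}

theorem State.pull_setReg (hρ : ρ.Injective) (s : State) (i v : ℕ) :
    (s.setReg (ρ i) v).pull ρ τ = (s.pull ρ τ).setReg i v :=
  congrArg (State.mk · _) (Function.update_comp_eq_of_injective s.reg hρ i v)

theorem State.pull_setArr (hτ : τ.Injective) (s : State) (a p v : ℕ) :
    (s.setArr (τ a) p v).pull ρ τ = (s.pull ρ τ).setArr a p v :=
  congrArg (State.mk _) (Function.update_comp_eq_of_injective s.arr hτ a _)

theorem Exec.rename (hρ : ρ.Injective) (hτ : τ.Injective) {P : Program} {s s₁ s₂ : State} {t : ℕ}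
    (h : Exec P s₁ s₂ t) (hs : s.pull ρ τ = s₁) :
    ∃ s', Exec (P.rename ρ τ) s s' t ∧ s'.pull ρ τ = s₂ := by
  induction h generalizing s with subst hs
  | const => exact ⟨_, .const .., State.pull_setReg hρ ..⟩
  | add => exact ⟨_, .add .., State.pull_setReg hρ ..⟩
  | sub => exact ⟨_, .sub .., State.pull_setReg hρ ..⟩
  | load => exact ⟨_, .load .., State.pull_setReg hρ ..⟩
  | store => exact ⟨_, .store .., State.pull_setArr hτ ..⟩
  | while_done h => exact ⟨_, .while_done h, rfl⟩
  | seq _ _ ih ih' =>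
    obtain ⟨s', h, hs'⟩ := ih rfl
    obtain ⟨s'', h', hs''⟩ := ih' hs'
    exact ⟨s'', .seq h h', hs''⟩
  | ite_true hi _ ih =>
    obtain ⟨s', h, hs'⟩ := ih rfl
    exact ⟨s', .ite_true hi h, hs'⟩
  | ite_false hi _ ih =>
    obtain ⟨s', h, hs'⟩ := ih rfl
    exact ⟨s', .ite_false hi h, hs'⟩
  | while_step hi _ _ ih ih' =>
    obtain ⟨s', h, hs'⟩ := ih rfl
    obtain ⟨s'', h', hs''⟩ := ih' hs'
    exact ⟨s'', .while_step hi h h', hs''⟩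

end

theorem PolyWritable.exists_program {F : List ℕ → List ℕ} (hF : PolyWritable F) :
    ∃ (T : ℕ[X]) (R : Program) (ρ τ : ℕ → ℕ), ρ.Injective ∧ τ.Injective ∧ ρ 0 = 0 ∧
      ∀ w M, (∀ v ∈ w, v ≤ M) → (F w).length ≤ T.eval M ∧
        R.HaltsWithin (initial w) (T.eval M) fun s => s.pull ρ τ = initial (F w) := by
  obtain ⟨T, hT, h⟩ := hF
  obtain ⟨P, hP⟩ := h [] 0
  set ρ : ℕ → ℕ := fun i => if i = 0 then 0 else i + P.regBound with hρ
  set τ : ℕ → ℕ := fun a => if a = 0 then 1 else a + 2 with hτ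
  refine ⟨T + (1 + (1 + T)), .seq P (.seq (.const 0 0) (.load 0 2 0)), ρ, τ, ?_, ?_, if_pos rfl,
    fun w M hw => ?_⟩
  · intro i j hij
    simp only [hρ] at hij
    split_ifs at hij <;> omega
  · intro a b hab
    simp only [hτ] at hab
    split_ifs at hab <;> omega
  have hwM : Bounded w M := ⟨hw, by simp [Context.vals]⟩
  have hlen := hT w M hwM
  obtain ⟨s₁, t₁, he₁, ht₁, hs₁, ho₁⟩ := hP w (initial w) M [] hwM
    ⟨by simp, rfl, fun p => by simp [initial, Context.word]⟩
    ⟨fun p => by simp [initial], by simp [initial]⟩ (by simp)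
  obtain ⟨_, t₂, he₂, ht₂, rfl⟩ := Program.haltsWithin_load 0 2 0 (s₁.setReg 0 0)
  rw [State.arr_setReg, State.reg_setReg, if_pos rfl, ho₁.length, List.nil_append] at ht₂ he₂
  refine ⟨hlen.trans (by simp), _, _, he₁.seq (.seq (.const s₁ 0 0) he₂), ?_,
    congrArg₂ State.mk (funext fun i => ?_) (funext₂ fun a p => ?_)⟩
  · simp only [Nat.size_zero, eval_add, eval_one]
    omega
  · by_cases hi : i = 0
    · simp [State.reg_setReg, hρ, hi]
    · simp [State.reg_setReg, hρ, hi, he₁.reg_of_regBound_le, initial]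
  · by_cases ha : a = 0
    · simp [State.arr_setReg, hτ, ha, ho₁.cells]
    · simp [State.arr_setReg, hτ, ha, hs₁.arr, initial]

theorem eval_le_mul_pow (T : ℕ[X]) {M : ℕ} (hM : 1 ≤ M) :
    T.eval M ≤ T.eval 1 * M ^ T.natDegree := by
  simp only [eval_eq_sum_range, one_pow, mul_one, Finset.sum_mul]
  gcongr with i hi
  exact Finset.mem_range_succ_iff.1 hi

theorem add_le_mul_pow_of_le_mul_pow {t₁ t₂ l b b' : ℝ} {C D K N : ℝ} {c e : ℕ} (hC : 0 ≤ C)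
    (hD : 0 ≤ D) (hK : 0 ≤ K) (hl₀ : 0 ≤ l) (hb' : 1 ≤ b') (hN : 1 ≤ N) (ht₁ : t₁ ≤ D * N ^ c)
    (hl : l ≤ D * N ^ c) (hb : b ≤ K * b') (ht₂ : t₂ ≤ C * b * l ^ e) :
    t₁ + t₂ ≤ (D + C * K * D ^ e) * b' * N ^ (c + c * e) :=
  calc t₁ + t₂ ≤ D * N ^ c + C * (K * b') * (D * N ^ c) ^ e := by
        refine add_le_add ht₁ (ht₂.trans ?_)
        gcongr
    _ = D * (1 * N ^ c) + C * K * D ^ e * (b' * N ^ (c * e)) := by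
        rw [mul_pow, ← pow_mul]
        ring
    _ ≤ D * (b' * N ^ (c + c * e)) + C * K * D ^ e * (b' * N ^ (c + c * e)) := by
        gcongr <;> first | exact hN | omega
    _ = (D + C * K * D ^ e) * b' * N ^ (c + c * e) := by ring

theorem SolvableInTime.of_reduction {ι κ : Type} {enc : ι → List ℕ} {enc' : κ → List ℕ}
    {yes : ι → Prop} {yes' : κ → Prop} {p : ι → ℕ} {p' : κ → ℕ} {β β' : ℝ} (red : ι → κ)
    {F : List ℕ → List ℕ} (hF : PolyWritable F) (henc : ∀ x, enc' (red x) = F (enc x))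
    (hyes : ∀ x, yes' (red x) ↔ yes x)
    (hbd : ∀ x, 1 ≤ (enc x).length ∧ ∀ v ∈ enc x, v ≤ (enc x).length) (hβ' : 1 ≤ β') (K : ℕ)
    (hK : ∀ x, β ^ p' (red x) ≤ K * β' ^ p x) (h : SolvableInTime enc' yes' p' β) :
    SolvableInTime enc yes p β' := by
  obtain ⟨T, R, ρ, τ, hρ, hτ, hρ0, hR⟩ := hF.exists_program
  obtain ⟨Q, C, e, hQ⟩ := h
  refine ⟨.seq R (Q.rename ρ τ), T.eval 1 + C * K * T.eval 1 ^ e,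
    T.natDegree + T.natDegree * e, fun x => ?_⟩
  obtain ⟨hlen, s₁, t₁, he₁, ht₁, hs₁⟩ := hR (enc x) _ (hbd x).2
  rw [← henc] at hlen hs₁
  obtain ⟨s₂, t₂, he₂, hy, ht₂⟩ := hQ (red x)
  obtain ⟨s₃, he₃, rfl⟩ := he₂.rename hρ hτ hs₁
  have hT := eval_le_mul_pow T (hbd x).1
  refine ⟨s₃, _, he₁.seq he₃, ?_, ?_⟩
  · rw [← hyes, ← hy]
    exact (congrArg (s₃.reg · ≠ 0) hρ0.symm).to_iff
  · push_cast
    exact add_le_mul_pow_of_le_mul_pow (by positivity) (by positivity) (by positivity)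
      (by positivity) (one_le_pow₀ hβ') (mod_cast (hbd x).1) (mod_cast ht₁.trans hT)
      (mod_cast hlen.trans hT) (hK x) ht₂

end RunningTime

section Constraints

open Finset

/-! ### Constraint satisfaction along a path decomposition -/

/-- A constraint satisfaction problem together with a path decomposition: `mem i v` says that the
bag `i` contains the variable `v`. The constraint `j` forbids that, for all `r < 3` at once, the
variable `var j r` takes the value `val j r` (see `Matches`). Everything is indexed by natural
numbers, so that the problem can be read off a word. -/
structure BagCSP : Type where
  numVars : ℕ
  numBags : ℕ
  numConstraints : ℕ
  mem : ℕ → ℕ → Bool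
  var : ℕ → ℕ → ℕ
  val : ℕ → ℕ → ℕ

/-- A change of alphabet, which writes a block of `t` variables over `a` values as `q` variables
over `b` values. -/
structure Recoding : Type where
  a : ℕ
  b : ℕ
  t : ℕ
  q : ℕ

/-- The alphabets are not trivial, and there are enough values for the block. -/
structure Recoding.Valid (p : Recoding) : Prop where
  two_le_a : 2 ≤ p.a
  two_le_b : 2 ≤ p.b
  t_pos : 0 < p.t
  q_pos : 0 < p.q
  pow_le : p.a ^ p.t ≤ p.b ^ p.q

theorem Recoding.Valid.a_pos {p : Recoding} (hp : p.Valid) : 0 < p.a :=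
  Nat.zero_lt_of_lt hp.two_le_a

theorem Recoding.Valid.b_pos {p : Recoding} (hp : p.Valid) : 0 < p.b :=
  Nat.zero_lt_of_lt hp.two_le_b

/-- The value `y` fits the pattern `v`. The pattern `a`, which is not a value, is a wildcard. -/
def Matches (a v y : ℕ) : Prop := v = y ∨ v = a

instance (a v y : ℕ) : Decidable (Matches a v y) := inferInstanceAs (Decidable (_ ∨ _))

theorem mul_add_div_of_lt {x n y : ℕ} (h : y < n) : (x * n + y) / n = x := by
  rw [mul_comm, Nat.mul_add_div (by omega), Nat.div_eq_of_lt h, add_zero]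

theorem mul_add_lt_mul {i m v n : ℕ} (hi : i < m) (hv : v < n) : i * n + v < m * n :=
  mul_comm n i ▸ mul_comm n m ▸ Nat.mul_add_lt_mul_of_lt_of_lt hi hv

namespace BagCSP

/-- Some assignment of values below `a` violates no constraint. -/
def Solvable (S : BagCSP) (a : ℕ) : Prop :=
  ∃ col : ℕ → ℕ, (∀ v, col v < a) ∧
    ∀ j < S.numConstraints, ∃ r < 3, ¬ Matches a (S.val j r) (col (S.var j r))

/-- The bags consist of variables, and those that contain a given variable are consecutive. -/
structure HasIntervals (S : BagCSP) : Prop where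
  mem_bound : ∀ i v, S.mem i v = true → i < S.numBags ∧ v < S.numVars
  interval : ∀ v i j l, i ≤ j → j ≤ l → S.mem i v = true → S.mem l v = true → S.mem j v = true

/-- The bags are those of a path decomposition of the primal graph. Constraints made of wildcards
only, which can never be satisfied, may have variables that lie in no bag. -/
structure WellFormed (S : BagCSP) (a : ℕ) : Prop extends S.HasIntervals where
  scope : ∀ j < S.numConstraints, (∀ r < 3, S.val j r = a) ∨
    ∀ r < 3, ∀ r' < 3, ∃ i, S.mem i (S.var j r) = true ∧ S.mem i (S.var j r') = true

variable (S : BagCSP) (p : Recoding)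

/-- The first bag that contains `v`, in a form that is visibly computable. -/
def firstBag (v : ℕ) : ℕ := #{i ∈ range S.numBags | ∀ i' < i + 1, ¬ S.mem i' v = true}

/-- The variables are ordered by their first appearance. -/
def Before (u v : ℕ) : Prop :=
  S.firstBag u < S.firstBag v ∨ S.firstBag u = S.firstBag v ∧ u < v

instance (u v : ℕ) : Decidable (S.Before u v) := inferInstanceAs (Decidable (_ ∨ _))

/-- The position of `v` in the bag `i`, with respect to the order `Before`. In the next bag it can
only decrease, which keeps the two copies of a variable close together. -/
def rank (i v : ℕ) : ℕ := #{u ∈ range S.numVars | S.mem i u = true ∧ S.Before u v}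

/-- The number of variables in the bag `i`. -/
def bagCard (i : ℕ) : ℕ := #{u ∈ range S.numVars | S.mem i u = true}

/-- The largest number of variables in a bag. -/
def maxBagCard : ℕ := maxBelow S.numBags S.bagCard

/-- The number of blocks of `t` places that are reserved for each bag. -/
def blocksPerBag : ℕ := S.maxBagCard / p.t + 1

/-- The place of the copy of the variable `v` that belongs to the bag `i`. -/
def place (i v : ℕ) : ℕ := i * (S.blocksPerBag p * p.t) + S.rank i v

/-- A bag that contains all variables of the constraint `j`. -/
def homeBag (j : ℕ) : ℕ := maxBelow 3 fun r => S.firstBag (S.var j r)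

/-- The number of constraints on the places: those of `S`, and for each bag, each variable and each
pair of values one that forbids this pair for the copies of the variable in this bag and in the
next one. -/
def numPlaceConstraints : ℕ := S.numConstraints + S.numBags * S.numVars * p.a * p.a

/-- The variable of the link constraint `j`. -/
def linkVar (j : ℕ) : ℕ := j / p.a / p.a % S.numVars

/-- The first bag of the link constraint `j`. -/
def linkBag (j : ℕ) : ℕ := j / p.a / p.a / S.numVars

/-- The link constraint `j` is about two different values and two copies that exist. -/
def IsLink (j : ℕ) : Prop :=
  j % p.a ≠ j / p.a % p.a ∧ S.mem (S.linkBag p j) (S.linkVar p j) = true ∧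
    S.mem (S.linkBag p j + 1) (S.linkVar p j) = true

instance (j : ℕ) : Decidable (S.IsLink p j) := inferInstanceAs (Decidable (_ ∧ _))

/-- The places in the constraint `j`. -/
def scopePlace (j r : ℕ) : ℕ :=
  if j < S.numConstraints then S.place p (S.homeBag j) (S.var j r) else
    if S.IsLink p (j - S.numConstraints) ∧ 0 < r then
      S.place p (S.linkBag p (j - S.numConstraints) + 1) (S.linkVar p (j - S.numConstraints))
    else S.place p (S.linkBag p (j - S.numConstraints)) (S.linkVar p (j - S.numConstraints))

/-- The patterns in the constraint `j`. The pattern `a + 1`, which nothing matches, switches off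
the link constraints that are not `IsLink`. -/
def pattern (j r : ℕ) : ℕ :=
  if j < S.numConstraints then S.val j r else
    if S.IsLink p (j - S.numConstraints) then
      if 0 < r then (j - S.numConstraints) / p.a % p.a else (j - S.numConstraints) % p.a
    else p.a + 1

/-- A block such that all places of the constraint `j` lie in this block or in one of the
`blocksPerBag` blocks that follow it. -/
def window (j : ℕ) : ℕ :=
  if j < S.numConstraints then S.homeBag j * S.blocksPerBag p else
    S.place p (S.linkBag p (j - S.numConstraints)) (S.linkVar p (j - S.numConstraints)) / p.t

/-- The problem on the places has a solution. -/
def PlaceSolvable : Prop :=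
  ∃ y : ℕ → ℕ, (∀ x, y x < p.a) ∧
    ∀ j < S.numPlaceConstraints p,
      ∃ r < 3, ¬ Matches p.a (S.pattern p j r) (y (S.scopePlace p j r))

variable {S p}

section Places

variable {i u v : ℕ}

theorem firstBag_eq (hi : i < S.numBags) (h : S.mem i v = true)
    (hmin : ∀ j < i, ¬ S.mem j v = true) : S.firstBag v = i := by
  have : {k ∈ range S.numBags | ∀ i' < k + 1, ¬ S.mem i' v = true} = range i := by
    ext k
    simp only [mem_filter, mem_range]
    refine ⟨fun hk => ?_, fun hk => ⟨by omega, fun i' hi' => hmin i' (by omega)⟩⟩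
    by_contra hik
    exact hk.2 i (by omega) h
  rw [firstBag, this, card_range]

theorem firstBag_le_numBags (v : ℕ) : S.firstBag v ≤ S.numBags :=
  (card_filter_le _ _).trans (card_range _).le

theorem homeBag_le_numBags (j : ℕ) : S.homeBag j ≤ S.numBags := by
  unfold homeBag maxBelow
  exact Finset.sup_le fun _ _ => firstBag_le_numBags _

theorem mem_firstBag_and_firstBag_le (hS : S.HasIntervals) (h : S.mem i v = true) :
    S.mem (S.firstBag v) v = true ∧ S.firstBag v ≤ i := by
  classical
  have hex : ∃ i, S.mem i v = true := ⟨i, h⟩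
  rw [firstBag_eq (hS.mem_bound _ _ (Nat.find_spec hex)).1 (Nat.find_spec hex)
    fun j hj => Nat.find_min hex hj]
  exact ⟨Nat.find_spec hex, Nat.find_min' hex h⟩

theorem mem_firstBag_of_le (hS : S.HasIntervals) (hu : S.mem i u = true) (hv : S.mem i v = true)
    (h : S.firstBag u ≤ S.firstBag v) : S.mem (S.firstBag v) u = true :=
  hS.interval u _ _ _ h (mem_firstBag_and_firstBag_le hS hv).2
    (mem_firstBag_and_firstBag_le hS hu).1 hu

theorem Before.trans {w : ℕ} (h : S.Before u v) (h' : S.Before v w) : S.Before u w := by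
  unfold Before at *
  omega

theorem rank_le_maxBagCard (hS : S.HasIntervals) (i v : ℕ) : S.rank i v ≤ S.maxBagCard := by
  by_cases hi : i < S.numBags
  · exact (card_le_card (monotone_filter_right _ fun u _ hu => hu.1)).trans
      (le_sup (f := S.bagCard) (mem_range.2 hi))
  · have : S.rank i v = 0 := card_eq_zero.2 <| filter_eq_empty_iff.2 fun u _ hu =>
      hi (hS.mem_bound _ _ hu.1).1
    omega

theorem rank_lt (hS : S.HasIntervals) (hp : p.Valid) (i v : ℕ) :
    S.rank i v < S.blocksPerBag p * p.t :=
  (rank_le_maxBagCard hS i v).trans_lt <| by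
    rw [blocksPerBag, mul_comm]
    exact Nat.lt_mul_div_succ _ hp.t_pos

theorem rank_lt_rank (hu : S.mem i u = true) (hun : u < S.numVars) (h : S.Before u v) :
    S.rank i u < S.rank i v := by
  refine card_lt_card ⟨monotone_filter_right _ fun w _ hw => ⟨hw.1, hw.2.trans h⟩, fun hsub => ?_⟩
  have : S.Before u u := (mem_filter.1 (hsub (mem_filter.2 ⟨mem_range.2 hun, hu, h⟩))).2.2
  unfold Before at this
  omega

theorem eq_of_rank_eq (hS : S.HasIntervals) (hu : S.mem i u = true) (hv : S.mem i v = true)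
    (h : S.rank i u = S.rank i v) : u = v := by
  by_contra hne
  have : S.Before u v ∨ S.Before v u := by
    unfold Before
    omega
  rcases this with h' | h'
  · exact (rank_lt_rank hu (hS.mem_bound _ _ hu).2 h').ne h
  · exact (rank_lt_rank hv (hS.mem_bound _ _ hv).2 h').ne' h

theorem rank_succ_le (hS : S.HasIntervals) (hv : S.mem i v = true) :
    S.rank (i + 1) v ≤ S.rank i v := by
  refine card_le_card <| monotone_filter_right _ fun u _ ⟨hu, huv⟩ => ⟨?_, huv⟩
  have hv := (mem_firstBag_and_firstBag_le hS hv).2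
  have hle : S.firstBag u ≤ i := by
    unfold Before at huv
    omega
  exact hS.interval u _ i _ hle (by omega) (mem_firstBag_and_firstBag_le hS hu).1 hu

theorem mem_homeBag (hS : S.HasIntervals) {j r : ℕ}
    (h : ∀ r < 3, ∀ r' < 3, ∃ i, S.mem i (S.var j r) = true ∧ S.mem i (S.var j r') = true)
    (hr : r < 3) : S.mem (S.homeBag j) (S.var j r) = true := by
  obtain ⟨r', hr', e⟩ :=
    exists_mem_eq_sup (range 3) ⟨0, by simp⟩ fun r => S.firstBag (S.var j r)
  have hle : S.firstBag (S.var j r) ≤ S.homeBag j :=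
    le_sup (f := fun r => S.firstBag (S.var j r)) (mem_range.2 hr)
  rw [homeBag, maxBelow, e] at hle ⊢
  obtain ⟨i, hi, hi'⟩ := h r hr r' (mem_range.1 hr')
  exact mem_firstBag_of_le hS hi hi' hle

theorem place_div (hS : S.HasIntervals) (hp : p.Valid) (i v : ℕ) :
    S.place p i v / (S.blocksPerBag p * p.t) = i :=
  mul_add_div_of_lt (rank_lt hS hp i v)

theorem place_injective (hS : S.HasIntervals) (hp : p.Valid) :
    Function.Injective fun z : {z : ℕ × ℕ // S.mem z.1 z.2 = true} => S.place p z.1.1 z.1.2 := by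
  rintro ⟨⟨i, v⟩, hv⟩ ⟨⟨i', v'⟩, hv'⟩ h
  obtain rfl : i = i' := by
    rw [← place_div hS hp i v, ← place_div hS hp i' v']
    exact congrArg (· / (S.blocksPerBag p * p.t)) h
  obtain rfl : v = v' := eq_of_rank_eq hS hv hv' (Nat.add_left_cancel h)
  rfl

theorem place_block (hS : S.HasIntervals) (hp : p.Valid) (i v : ℕ) :
    i * S.blocksPerBag p ≤ S.place p i v / p.t ∧
      S.place p i v / p.t < i * S.blocksPerBag p + S.blocksPerBag p := by
  rw [Nat.le_div_iff_mul_le hp.t_pos, Nat.div_lt_iff_lt_mul hp.t_pos, add_mul, mul_assoc, place]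
  exact ⟨Nat.le_add_right _ _, Nat.add_lt_add_left (rank_lt hS hp i v) _⟩

end Places

theorem exists_place_coloring (hS : S.HasIntervals) (hp : p.Valid) {col : ℕ → ℕ}
    (hcol : ∀ v, col v < p.a) :
    ∃ y : ℕ → ℕ, (∀ x, y x < p.a) ∧ ∀ i v, S.mem i v = true → y (S.place p i v) = col v := by
  classical
  refine ⟨Function.extend (fun z : {z : ℕ × ℕ // S.mem z.1 z.2 = true} => S.place p z.1.1 z.1.2)
    (fun z => col z.1.2) 0, fun x => ?_, fun i v hv =>
      (place_injective hS hp).extend_apply _ _ ⟨(i, v), hv⟩⟩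
  rw [Function.extend_def]
  split_ifs with h
  · exact hcol _
  · exact hp.a_pos

theorem placeSolvable_of_solvable (hS : S.WellFormed p.a) (hp : p.Valid) (h : S.Solvable p.a) :
    S.PlaceSolvable p := by
  obtain ⟨col, hcol, hC⟩ := h
  obtain ⟨y, hya, hy⟩ := exists_place_coloring hS.toHasIntervals hp hcol
  refine ⟨y, hya, fun j _ => ?_⟩
  by_cases hj : j < S.numConstraints
  · obtain ⟨r, hr, hm⟩ := hC j hj
    rcases hS.scope j hj with h | h
    · exact absurd (Or.inr (h r hr)) hm
    · refine ⟨r, hr, ?_⟩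
      simp only [pattern, scopePlace, hj, if_true]
      rwa [hy _ _ (mem_homeBag hS.toHasIntervals h hr)]
  · by_cases hl : S.IsLink p (j - S.numConstraints)
    · by_contra! hcon
      have h0 := hcon 0 (by omega)
      have h1 := hcon 1 (by omega)
      simp only [pattern, scopePlace, hj, hl, if_false, if_true, true_and, lt_irrefl,
        Nat.one_pos] at h0 h1
      rw [hy _ _ hl.2.1, Matches, or_iff_left (Nat.mod_lt _ hp.a_pos).ne] at h0
      rw [hy _ _ hl.2.2, Matches, or_iff_left (Nat.mod_lt _ hp.a_pos).ne] at h1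
      exact hl.1 (h0.trans h1.symm)
    · refine ⟨0, by omega, ?_⟩
      have := hya (S.scopePlace p j 0)
      simp only [pattern, hj, hl, if_false, Matches]
      omega

theorem exists_isLink {i v c c' : ℕ} (hi : i < S.numBags) (hv : v < S.numVars) (hc : c < p.a)
    (hc' : c' < p.a) (hne : c ≠ c') (h : S.mem i v = true) (h' : S.mem (i + 1) v = true) :
    ∃ j < S.numBags * S.numVars * p.a * p.a, S.IsLink p j ∧ S.linkBag p j = i ∧
      S.linkVar p j = v ∧ j % p.a = c ∧ j / p.a % p.a = c' := by
  refine ⟨((i * S.numVars + v) * p.a + c') * p.a + c,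
    mul_add_lt_mul (mul_add_lt_mul (mul_add_lt_mul hi hv) hc') hc, ?_⟩
  simp only [IsLink, linkBag, linkVar, mul_add_div_of_lt, Nat.mul_add_mod_of_lt, hc, hc', hv, h,
    h', ne_eq, hne, not_false_eq_true, and_self]

theorem place_coloring_succ (hS : S.HasIntervals) {y : ℕ → ℕ} (hy : ∀ x, y x < p.a)
    (hC : ∀ j < S.numPlaceConstraints p,
      ∃ r < 3, ¬ Matches p.a (S.pattern p j r) (y (S.scopePlace p j r)))
    {i v : ℕ} (h : S.mem i v = true) (h' : S.mem (i + 1) v = true) :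
    y (S.place p (i + 1) v) = y (S.place p i v) := by
  by_contra hne
  have hb := hS.mem_bound _ _ h
  obtain ⟨j, hj, hlink, hi, hv, hc, hc'⟩ :=
    exists_isLink hb.1 hb.2 (hy (S.place p i v)) (hy (S.place p (i + 1) v)) (Ne.symm hne) h h'
  obtain ⟨r, -, hm⟩ := hC (S.numConstraints + j) (Nat.add_lt_add_left hj _)
  simp only [pattern, scopePlace, Nat.not_lt.2 (Nat.le_add_right S.numConstraints j), if_false,
    Nat.add_sub_cancel_left, hlink, if_true, true_and, hc, hc', hi, hv] at hm
  split_ifs at hm <;> exact hm (Or.inl rfl)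

theorem place_coloring_eq_firstBag (hS : S.HasIntervals) {y : ℕ → ℕ}
    (hy : ∀ i v, S.mem i v = true → S.mem (i + 1) v = true →
      y (S.place p (i + 1) v) = y (S.place p i v)) {i v : ℕ} (h : S.mem i v = true) :
    y (S.place p i v) = y (S.place p (S.firstBag v) v) := by
  obtain ⟨hfirst, hle⟩ := mem_firstBag_and_firstBag_le hS h
  induction i, hle using Nat.le_induction with
  | base => rfl
  | succ i hle ih =>
    have hi := hS.interval v _ i _ hle i.le_succ hfirst h
    rw [hy i v hi h, ih hi]

theorem solvable_of_placeSolvable (hS : S.WellFormed p.a) (h : S.PlaceSolvable p) :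
    S.Solvable p.a := by
  obtain ⟨y, hy, hC⟩ := h
  refine ⟨fun v => y (S.place p (S.firstBag v) v), fun v => hy _, fun j hj => ?_⟩
  obtain ⟨r, hr, hm⟩ := hC j (Nat.lt_add_right _ hj)
  refine ⟨r, hr, fun hmatch => hm ?_⟩
  simp only [pattern, scopePlace, hj, if_true]
  rcases hS.scope j hj with h | h
  · exact Or.inr (h r hr)
  · rwa [place_coloring_eq_firstBag hS.toHasIntervals
      (fun i v => place_coloring_succ hS.toHasIntervals hy hC)
      (mem_homeBag hS.toHasIntervals h hr)]

theorem solvable_iff_placeSolvable (hS : S.WellFormed p.a) (hp : p.Valid) :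
    S.Solvable p.a ↔ S.PlaceSolvable p :=
  ⟨placeSolvable_of_solvable hS hp, solvable_of_placeSolvable hS⟩

theorem scopePlace_div_mem_window (hS : S.HasIntervals) (hp : p.Valid) (j r : ℕ) :
    S.window p j ≤ S.scopePlace p j r / p.t ∧
      S.scopePlace p j r / p.t ≤ S.window p j + S.blocksPerBag p := by
  unfold window scopePlace
  split_ifs with hj hl
  · have := place_block hS hp (S.homeBag j) (S.var j r)
    omega
  · set i := S.linkBag p (j - S.numConstraints)
    set v := S.linkVar p (j - S.numConstraints)
    have hi := place_block hS hp i v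
    have hi' := place_block hS hp (i + 1) v
    have hle : S.place p (i + 1) v ≤ S.place p i v + p.t * S.blocksPerBag p := by
      have : S.rank (i + 1) v ≤ S.rank i v := rank_succ_le hS hl.1.2.1
      unfold place
      rw [Nat.succ_mul, mul_comm p.t]
      omega
    have hdiv := Nat.div_le_div_right (c := p.t) hle
    rw [Nat.add_mul_div_left _ _ hp.t_pos] at hdiv
    rw [Nat.succ_mul] at hi'
    omega
  · omega

theorem window_lt (hS : S.HasIntervals) (hp : p.Valid) {j : ℕ}
    (hj : j < S.numPlaceConstraints p) : S.window p j < (S.numBags + 1) * S.blocksPerBag p := by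
  unfold window
  split_ifs with h
  · exact Nat.mul_lt_mul_of_pos_right (Nat.lt_succ_of_le (homeBag_le_numBags j)) (Nat.succ_pos _)
  · have hbag : S.linkBag p (j - S.numConstraints) < S.numBags := by
      unfold numPlaceConstraints at hj
      rw [linkBag]
      refine Nat.div_lt_of_lt_mul <| Nat.div_lt_of_lt_mul <| Nat.div_lt_of_lt_mul ?_
      linarith [show j - S.numConstraints < S.numBags * S.numVars * p.a * p.a by omega]
    have hblock := (place_block hS hp (S.linkBag p (j - S.numConstraints))
      (S.linkVar p (j - S.numConstraints))).2
    have := Nat.mul_le_mul_right (S.blocksPerBag p) hbag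
    rw [Nat.succ_mul] at this ⊢
    omega

end BagCSP

end Constraints

/-! ### Changing the alphabet -/

theorem digit_lt {b : ℕ} (hb : 0 < b) (x i : ℕ) : digit b x i < b := Nat.mod_lt _ hb

theorem exists_digits {b q : ℕ} {f : ℕ → ℕ} (hf : ∀ i < q, f i < b) :
    ∃ x < b ^ q, ∀ i < q, digit b x i = f i := by
  let g : Fin q → Fin b := fun i => ⟨f i, hf i i.2⟩
  refine ⟨finFunctionFinEquiv g, (finFunctionFinEquiv g).2, fun i hi => ?_⟩
  have := congrArg Fin.val (congrFun (finFunctionFinEquiv.symm_apply_apply g) ⟨i, hi⟩)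
  rwa [finFunctionFinEquiv_symm_apply_val] at this

theorem eq_of_digit_eq {b q x y : ℕ} (hx : x < b ^ q) (hy : y < b ^ q)
    (h : ∀ i < q, digit b x i = digit b y i) : x = y := by
  have : finFunctionFinEquiv.symm (⟨x, hx⟩ : Fin (b ^ q)) = finFunctionFinEquiv.symm ⟨y, hy⟩ :=
    funext fun i => Fin.ext <| by
      rw [finFunctionFinEquiv_symm_apply_val, finFunctionFinEquiv_symm_apply_val]
      exact h i i.2
  exact congrArg Fin.val (finFunctionFinEquiv.symm.injective this)

theorem digit_mul_pow_add {b q i : ℕ} (hi : i < q) (hb : 0 < b) (x y : ℕ) :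
    digit b (x * b ^ q + y) i = digit b y i := by
  rw [digit, show x * b ^ q = b ^ i * (b * (b ^ (q - i - 1) * x)) by
    rw [← mul_assoc, ← mul_assoc, ← pow_succ, ← pow_add, mul_comm]
    congr 2
    omega, Nat.mul_add_div (by positivity), Nat.mul_add_mod, ← digit]

namespace BagCSP

variable (S : BagCSP) (p : Recoding)

/-- The number of constraints over the new alphabet: one for each constraint on the places and each
choice of the contents of three blocks. -/
def numDigitConstraints : ℕ := S.numPlaceConstraints p * (p.b ^ p.q) ^ 3

/-- The constraint on the places from which the constraint `e` arises. -/
def source (e : ℕ) : ℕ := e / (p.b ^ p.q) ^ 3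

/-- The contents of the `r`-th block in the constraint `e`. -/
def code (e r : ℕ) : ℕ := digit (p.b ^ p.q) e r

/-- The contents of the blocks violate the constraint on the places. -/
def IsLive (e : ℕ) : Prop :=
  ∀ r < 3, Matches p.a (S.pattern p (source p e) r)
    (digit p.a (code p e r) (S.scopePlace p (source p e) r % p.t))

instance : DecidablePred (S.IsLive p) := fun _ => Nat.decidableBallLT _ _

/-- The variables in the constraint `e`, which are the digits of its three blocks. -/
def digitVar (e r : ℕ) : ℕ := S.scopePlace p (source p e) (r / p.q) / p.t * p.q + r % p.q

/-- The values in the constraint `e`. -/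
def digitVal (e r : ℕ) : ℕ := digit p.b (code p e (r / p.q)) (r % p.q)

/-- The problem over the new alphabet has a solution. -/
def DigitSolvable : Prop :=
  ∃ x : ℕ → ℕ, (∀ v, x v < p.b) ∧
    ∀ e < S.numDigitConstraints p, S.IsLive p e →
      ∃ r < 3 * p.q, x (S.digitVar p e r) ≠ digitVal p e r

variable {S p}

theorem digitSolvable_of_placeSolvable (hp : p.Valid) (h : S.PlaceSolvable p) :
    S.DigitSolvable p := by
  obtain ⟨y, hy, hC⟩ := h
  choose σ hσlt hσ using fun B => exists_digits (q := p.t) fun o _ => hy (B * p.t + o)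
  have hσlt B : σ B < p.b ^ p.q := (hσlt B).trans_le hp.pow_le
  refine ⟨fun v => digit p.b (σ (v / p.q)) (v % p.q), fun v => digit_lt hp.b_pos _ _,
    fun e he hlive => ?_⟩
  by_contra! hcon
  obtain ⟨r, hr, hm⟩ := hC (source p e) (Nat.div_lt_of_lt_mul (by rwa [mul_comm]))
  have hcode : σ (S.scopePlace p (source p e) r / p.t) = code p e r := by
    refine eq_of_digit_eq (hσlt _) (digit_lt (pow_pos hp.b_pos _) _ _) fun l hl => ?_
    have := hcon (r * p.q + l) (mul_add_lt_mul hr hl)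
    rwa [digitVal, digitVar, mul_add_div_of_lt hl, Nat.mul_add_mod_of_lt hl,
      mul_add_div_of_lt hl, Nat.mul_add_mod_of_lt hl] at this
  have := hlive r hr
  rw [← hcode, hσ _ _ (Nat.mod_lt _ hp.t_pos), Nat.div_add_mod'] at this
  exact hm this

theorem placeSolvable_of_digitSolvable (hp : p.Valid) (h : S.DigitSolvable p) :
    S.PlaceSolvable p := by
  obtain ⟨x, hx, hC⟩ := h
  choose σ hσlt hσ using fun B => exists_digits (q := p.q) fun l _ => hx (B * p.q + l)
  refine ⟨fun z => digit p.a (σ (z / p.t)) (z % p.t), fun z => digit_lt hp.a_pos _ _,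
    fun j hj => ?_⟩
  by_contra! hcon
  obtain ⟨τ, hτlt, hτ⟩ := exists_digits (q := 3) fun r _ => hσlt (S.scopePlace p j r / p.t)
  set e := j * (p.b ^ p.q) ^ 3 + τ with he
  have hsource : source p e = j := mul_add_div_of_lt hτlt
  have hcode : ∀ r < 3, code p e r = σ (S.scopePlace p j r / p.t) := fun r hr => by
    rw [code, he, digit_mul_pow_add hr (pow_pos hp.b_pos _), hτ r hr]
  obtain ⟨r, hr, hne⟩ := hC e (mul_add_lt_mul hj hτlt) fun r hr => by
    rw [hsource, hcode r hr]
    exact hcon r hr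
  apply hne
  rw [digitVar, digitVal, hsource, hcode _ ((Nat.div_lt_iff_lt_mul hp.q_pos).2 hr),
    hσ _ _ (Nat.mod_lt _ hp.q_pos)]

theorem solvable_iff_digitSolvable (hS : S.WellFormed p.a) (hp : p.Valid) :
    S.Solvable p.a ↔ S.DigitSolvable p :=
  (solvable_iff_placeSolvable hS hp).trans
    ⟨digitSolvable_of_placeSolvable hp, placeSolvable_of_digitSolvable hp⟩

end BagCSP

section Lists

variable {α β : Type} {P : α → Prop} {f : ∀ x, P x → β} {l : List α} {h : ∀ x ∈ l, P x}

theorem exists_mem_iff_exists_getD (l : List α) (d : α) (P : α → Prop) :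
    (∃ x ∈ l, P x) ↔ ∃ i < l.length, P (l.getD i d) := by
  rw [List.exists_mem_iff_exists_getElem]
  exact exists_congr fun i => by grind

theorem forall_mem_pmap_iff {Q : β → Prop} {Q' : α → Prop} (hQ : ∀ x hx, Q (f x hx) ↔ Q' x) :
    (∀ y ∈ l.pmap f h, Q y) ↔ ∀ x ∈ l, Q' x := by
  grind

theorem exists_mem_pmap_iff {Q : β → Prop} {Q' : α → Prop} (hQ : ∀ x hx, Q (f x hx) ↔ Q' x) :
    (∃ y ∈ l.pmap f h, Q y) ↔ ∃ x ∈ l, Q' x := by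
  grind

theorem encodeList_pmap {g : β → List ℕ} {g' : α → List ℕ} (hg : ∀ x hx, g (f x hx) = g' x) :
    encodeList g (l.pmap f h) = encodeList g' l := by
  simp only [encodeList, List.length_pmap, List.flatMap_def, List.map_pmap, hg,
    List.pmap_eq_map]

end Lists

/-- The list of bags `B`, with its entries regarded as elements of `Fin n`. -/
def liftBags (n : ℕ) (B : List (List ℕ)) (h : ∀ l ∈ B, ∀ v ∈ l, v < n) : List (List (Fin n)) :=
  B.pmap (fun l hl => l.pmap Fin.mk hl) h

/-- The list of pairs `E`, with its entries regarded as pairs of elements of `Fin n`. -/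
def liftEdges (n : ℕ) (E : List (ℕ × ℕ)) (h : ∀ e ∈ E, e.1 < n ∧ e.2 < n) :
    List (Fin n × Fin n) :=
  E.pmap (fun e he => (⟨e.1, he.1⟩, ⟨e.2, he.2⟩)) h

/-- The list of clauses `F`, with its variables regarded as elements of `Fin n`. -/
def liftClauses (n : ℕ) (F : List (List (ℕ × Bool))) (h : ∀ C ∈ F, ∀ l ∈ C, l.1 < n) : CNF n :=
  F.pmap (fun C hC => C.pmap (fun l hl => (⟨l.1, hl⟩, l.2)) hC) h

section Bags

variable {n : ℕ} {B : List (List ℕ)} {h : ∀ l ∈ B, ∀ v ∈ l, v < n}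

theorem encodeBags_liftBags :
    encodeBags (liftBags n B h) = encodeList (encodeList fun v => [v]) B :=
  encodeList_pmap fun _ _ => encodeList_pmap fun _ _ => rfl

theorem getD_bagSets (B : List (List (Fin n))) (i : ℕ) :
    (bagSets B).getD i ∅ = (B.getD i []).toFinset :=
  List.getD_map B [] List.toFinset

theorem mem_getD_liftBags {i : ℕ} {v : Fin n} :
    v ∈ (bagSets (liftBags n B h)).getD i ∅ ↔ (v : ℕ) ∈ B.getD i [] := by
  rw [getD_bagSets, List.mem_toFinset]
  by_cases hi : i < B.length
  · simp [liftBags, hi, Fin.ext_iff]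
  · simp [liftBags, hi]

theorem isPathDecomposition_liftBags {G : SimpleGraph (Fin n)}
    (vertex_mem : ∀ v < n, ∃ i < B.length, v ∈ B.getD i [])
    (edge_mem : ∀ v w : Fin n, G.Adj v w →
      ∃ i < B.length, (v : ℕ) ∈ B.getD i [] ∧ (w : ℕ) ∈ B.getD i [])
    (interval : ∀ v i j l, i ≤ j → j ≤ l → v ∈ B.getD i [] → v ∈ B.getD l [] → v ∈ B.getD j []) :
    IsPathDecomposition G (bagSets (liftBags n B h)) := by
  have hlen : (bagSets (liftBags n B h)).length = B.length := by simp [bagSets, liftBags]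
  refine ⟨fun v => ?_, fun v w hvw => ?_, fun v i j l hij hjl => ?_⟩
  · rw [exists_mem_iff_exists_getD _ ∅, hlen]
    simpa only [mem_getD_liftBags] using vertex_mem v v.2
  · rw [exists_mem_iff_exists_getD _ ∅, hlen]
    simpa only [mem_getD_liftBags] using edge_mem v w hvw
  · simpa only [mem_getD_liftBags] using interval v i j l hij hjl

theorem width_liftBags_le {c : ℕ} (hc : ∀ l ∈ B, l.length ≤ c) :
    width (bagSets (liftBags n B h)) ≤ c := by
  refine (Nat.sub_le _ _).trans (List.max_le_of_forall_le _ _ ?_)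
  simp only [bagSets, liftBags, List.map_pmap, List.mem_pmap]
  rintro _ ⟨l, hl, rfl⟩
  exact (List.toFinset_card_le _).trans ((List.length_pmap ..).le.trans (hc l hl))

theorem card_getD_le_width_add_one {V : Type} (B : List (Finset V)) (i : ℕ) :
    (B.getD i ∅).card ≤ width B + 1 := by
  by_cases hi : i < B.length
  · rw [List.getD_eq_getElem _ _ hi]
    have : B[i].card ≤ (B.map Finset.card).foldr max 0 :=
      List.le_max_of_le (List.mem_map_of_mem (List.getElem_mem hi)) le_rfl
    unfold width
    omega
  · rw [List.getD_eq_default _ _ (by omega)]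
    simp

end Bags

theorem edgeGraph_colorable_iff {n k : ℕ} (hk : 0 < k) {E : List (Fin n × Fin n)}
    (hE : ∀ e ∈ E, e.1 ≠ e.2) :
    (edgeGraph E).Colorable k ↔
      ∃ col : ℕ → ℕ, (∀ v, col v < k) ∧ ∀ e ∈ E, col e.1 ≠ col e.2 := by
  constructor
  · rintro ⟨C⟩
    refine ⟨fun v => if h : v < n then C ⟨v, h⟩ else 0, fun v => by grind, fun e he => ?_⟩
    have : C e.1 ≠ C e.2 := C.valid ((SimpleGraph.fromRel_adj _ _ _).2 ⟨hE e he, Or.inl he⟩)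
    simpa [Fin.ext_iff] using this
  · rintro ⟨col, hcol, hC⟩
    refine ⟨SimpleGraph.Coloring.mk (fun v => ⟨col v, hcol v⟩) fun {v w} hvw => ?_⟩
    rcases ((SimpleGraph.fromRel_adj _ _ _).1 hvw).2 with h | h
    · exact Fin.ne_of_val_ne (hC _ h)
    · exact Fin.ne_of_val_ne (hC _ h).symm

theorem CNF.satisfiable_iff {n : ℕ} {φ : CNF n} :
    φ.Satisfiable ↔
      ∃ x : ℕ → ℕ, (∀ v, x v < 2) ∧ ∀ C ∈ φ, ∃ l ∈ C, x l.1 = l.2.toNat := by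
  constructor
  · rintro ⟨σ, hσ⟩
    refine ⟨fun v => if h : v < n then (σ ⟨v, h⟩).toNat else 0, fun v => ?_, fun C hC => ?_⟩
    · grind [Bool.toNat_lt]
    · obtain ⟨l, hl, h⟩ := hσ C hC
      exact ⟨l, hl, by simp [← h]⟩
  · rintro ⟨x, -, hx⟩
    refine ⟨fun v => decide (x v = 1), fun C hC => ?_⟩
    obtain ⟨l, hl, h⟩ := hx C hC
    exact ⟨l, hl, by cases hb : l.2 <;> simp [h, hb]⟩

/-! ### The path decomposition of the constructed instance -/

namespace BagCSP

variable (S : BagCSP) (p : Recoding)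

/-- The number of windows. -/
def numWindows : ℕ := (S.numBags + 1) * S.blocksPerBag p

/-- The number of vertices for the digits. -/
def numDigitVertices : ℕ := (S.numWindows p + S.blocksPerBag p) * p.q

/-- The number of auxiliary vertices for one constraint. -/
def auxSize : ℕ := 12 * p.q + 1

/-- The number of vertices: first a palette of `b` vertices, then those for the digits, and then the
auxiliary vertices of the constraints. -/
def numVertices : ℕ := p.b + S.numDigitVertices p + S.numDigitConstraints p * auxSize p

/-- The vertex for the digit `v`. -/
def digitVertex (v : ℕ) : ℕ := p.b + v

/-- The auxiliary vertices for the constraint `e`. -/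
def auxVertex (e i : ℕ) : ℕ := p.b + S.numDigitVertices p + e * auxSize p + i

/-- The number of constructed bags: for each window one for each constraint, and one more, so that
there are bags even if there are no constraints. -/
def numGadgetBags : ℕ := S.numWindows p * (S.numDigitConstraints p + 1)

/-- The index of the bag that receives the auxiliary vertices for the constraint `e`. -/
def gadgetIndex (e : ℕ) : ℕ := S.window p (source p e) * (S.numDigitConstraints p + 1) + e

/-- The number of auxiliary vertices in the bag `f`. -/
def auxCount (f : ℕ) : ℕ :=
  if f % (S.numDigitConstraints p + 1) < S.numDigitConstraints p ∧
      S.window p (source p (f % (S.numDigitConstraints p + 1))) =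
        f / (S.numDigitConstraints p + 1) then auxSize p
  else 0

/-- The constructed bag `f`: the palette, the digits in the blocks of a window, and the auxiliary
vertices of at most one constraint. -/
def gadgetBag (f : ℕ) : List ℕ :=
  List.range p.b ++
    (List.range ((S.blocksPerBag p + 1) * p.q)).map
      (fun i => p.b + f / (S.numDigitConstraints p + 1) * p.q + i) ++
    (List.range (S.auxCount p f)).map (S.auxVertex p (f % (S.numDigitConstraints p + 1)))

/-- The constructed bags. -/
def gadgetBags : List (List ℕ) := (List.range (S.numGadgetBags p)).map (S.gadgetBag p)

/-- The vertices that are involved in the gadget for the constraint `e`. -/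
def IsNear (e v : ℕ) : Prop :=
  v < p.b ∨ (∃ r, v = digitVertex p (S.digitVar p e r)) ∨
    ∃ i < auxSize p, v = S.auxVertex p e i

variable {S p} {e f i v : ℕ}

theorem numWindows_pos : 0 < S.numWindows p := Nat.mul_pos (Nat.succ_pos _) (Nat.succ_pos _)

theorem numGadgetBags_pos : 0 < S.numGadgetBags p := Nat.mul_pos numWindows_pos (Nat.succ_pos _)

theorem length_gadgetBags : (S.gadgetBags p).length = S.numGadgetBags p := by simp [gadgetBags]

theorem gadgetIndex_div (he : e < S.numDigitConstraints p) :
    S.gadgetIndex p e / (S.numDigitConstraints p + 1) = S.window p (source p e) :=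
  mul_add_div_of_lt (by omega)

theorem gadgetIndex_mod (he : e < S.numDigitConstraints p) :
    S.gadgetIndex p e % (S.numDigitConstraints p + 1) = e := by
  rw [gadgetIndex, mul_comm, Nat.mul_add_mod, Nat.mod_eq_of_lt (by omega)]

theorem lt_auxCount_iff :
    i < S.auxCount p f ↔
      ∃ e < S.numDigitConstraints p, f = S.gadgetIndex p e ∧ i < auxSize p := by
  unfold auxCount
  constructor
  · intro h
    split_ifs at h with hf
    · refine ⟨_, hf.1, ?_, h⟩
      rw [gadgetIndex, hf.2, mul_comm, Nat.div_add_mod]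
    · omega
  · rintro ⟨e, he, rfl, hi⟩
    rwa [gadgetIndex_div he, gadgetIndex_mod he, if_pos ⟨he, rfl⟩]

theorem mem_gadgetBag_iff :
    v ∈ S.gadgetBag p f ↔ v < p.b ∨
      (p.b + f / (S.numDigitConstraints p + 1) * p.q ≤ v ∧
        v < p.b + (f / (S.numDigitConstraints p + 1) + (S.blocksPerBag p + 1)) * p.q) ∨
      ∃ e < S.numDigitConstraints p, f = S.gadgetIndex p e ∧
        ∃ i < auxSize p, v = S.auxVertex p e i := by
  simp only [gadgetBag, List.mem_append, List.mem_map, List.mem_range, lt_auxCount_iff, or_assoc]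
  refine or_congr Iff.rfl (or_congr ⟨?_, fun h => ?_⟩ ⟨?_, ?_⟩)
  · rintro ⟨i, hi, rfl⟩
    rw [add_mul]
    omega
  · rw [add_mul] at h
    exact ⟨v - (p.b + f / (S.numDigitConstraints p + 1) * p.q), by omega, by omega⟩
  · rintro ⟨i, ⟨e, he, rfl, hi⟩, rfl⟩
    exact ⟨e, he, rfl, i, hi, by rw [gadgetIndex_mod he]⟩
  · rintro ⟨e, he, rfl, i, hi, rfl⟩
    exact ⟨i, ⟨e, he, rfl, hi⟩, by rw [gadgetIndex_mod he]⟩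

theorem mem_getD_gadgetBags_iff :
    v ∈ (S.gadgetBags p).getD f [] ↔ f < S.numGadgetBags p ∧ v ∈ S.gadgetBag p f := by
  by_cases hf : f < S.numGadgetBags p <;> simp [gadgetBags, hf]

theorem length_gadgetBag_le :
    (S.gadgetBag p f).length ≤ p.b + (S.blocksPerBag p + 1) * p.q + auxSize p := by
  have : S.auxCount p f ≤ auxSize p := by
    unfold auxCount
    split_ifs <;> omega
  simpa [gadgetBag, add_assoc] using this

theorem auxVertex_lt (he : e < S.numDigitConstraints p) (hi : i < auxSize p) :
    S.auxVertex p e i < S.numVertices p := by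
  have := mul_add_lt_mul he hi
  unfold auxVertex numVertices
  omega

theorem eq_of_auxVertex_eq {e' i' : ℕ} (hi : i < auxSize p) (hi' : i' < auxSize p)
    (h : S.auxVertex p e i = S.auxVertex p e' i') : e = e' := by
  rw [← mul_add_div_of_lt (x := e) hi, ← mul_add_div_of_lt (x := e') hi']
  unfold auxVertex at h
  congr 1
  omega

theorem source_lt (he : e < S.numDigitConstraints p) : source p e < S.numPlaceConstraints p :=
  Nat.div_lt_of_lt_mul (by rwa [mul_comm, ← numDigitConstraints])

theorem div_lt_numWindows (hf : f < S.numGadgetBags p) :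
    f / (S.numDigitConstraints p + 1) < S.numWindows p :=
  Nat.div_lt_of_lt_mul (by rwa [mul_comm, ← numGadgetBags])

theorem window_end_le_numDigitVertices (hf : f < S.numGadgetBags p) :
    (f / (S.numDigitConstraints p + 1) + (S.blocksPerBag p + 1)) * p.q ≤
      S.numDigitVertices p := by
  have := div_lt_numWindows hf
  exact Nat.mul_le_mul_right _ (by omega)

theorem lt_numVertices_of_mem (hf : f < S.numGadgetBags p) (h : v ∈ S.gadgetBag p f) :
    v < S.numVertices p := by
  rcases mem_gadgetBag_iff.1 h with h | h | ⟨e, he, -, i, hi, rfl⟩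
  · unfold numVertices
    omega
  · have := window_end_le_numDigitVertices hf
    unfold numVertices
    omega
  · exact auxVertex_lt he hi

theorem gadgetBags_lt : ∀ l ∈ S.gadgetBags p, ∀ v ∈ l, v < S.numVertices p := by
  simp only [gadgetBags, List.mem_map, List.mem_range]
  rintro _ ⟨f, hf, rfl⟩ v hv
  exact lt_numVertices_of_mem hf hv

theorem gadgetIndex_lt (hS : S.HasIntervals) (hp : p.Valid) (he : e < S.numDigitConstraints p) :
    S.gadgetIndex p e < S.numGadgetBags p :=
  mul_add_lt_mul (window_lt hS hp (source_lt he)) (Nat.lt_succ_of_lt he)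

theorem exists_mem_gadgetBag_of_lt_numDigitVertices (hp : p.Valid)
    (hv : v < S.numDigitVertices p) :
    ∃ f < S.numGadgetBags p, digitVertex p v ∈ S.gadgetBag p f := by
  have hB : v / p.q < S.numWindows p + S.blocksPerBag p := (Nat.div_lt_iff_lt_mul hp.q_pos).2 hv
  have hW := S.numWindows_pos (p := p)
  refine ⟨min (v / p.q) (S.numWindows p - 1) * (S.numDigitConstraints p + 1),
    Nat.mul_lt_mul_of_pos_right (by omega) (Nat.succ_pos _), mem_gadgetBag_iff.2 ?_⟩
  rw [Nat.mul_div_cancel _ (Nat.succ_pos _), digitVertex]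
  refine .inr (.inl ⟨Nat.add_le_add_left ?_ _, Nat.add_lt_add_left ?_ _⟩)
  · exact (Nat.mul_le_mul_right _ (min_le_left _ _)).trans (Nat.div_mul_le_self _ _)
  · exact (Nat.div_lt_iff_lt_mul hp.q_pos).1 (by omega)

theorem exists_mem_gadgetBag (hS : S.HasIntervals) (hp : p.Valid) (hv : v < S.numVertices p) :
    ∃ f < S.numGadgetBags p, v ∈ S.gadgetBag p f := by
  by_cases h1 : v < p.b
  · exact ⟨0, numGadgetBags_pos, mem_gadgetBag_iff.2 (.inl h1)⟩
  by_cases h2 : v < p.b + S.numDigitVertices p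
  · have := exists_mem_gadgetBag_of_lt_numDigitVertices (S := S) hp (v := v - p.b) (by omega)
    rwa [digitVertex, Nat.add_sub_cancel' (by omega)] at this
  · obtain ⟨w, rfl⟩ := Nat.exists_eq_add_of_le (not_lt.1 h2)
    have hA : 0 < auxSize p := Nat.succ_pos _
    have he : w / auxSize p < S.numDigitConstraints p :=
      (Nat.div_lt_iff_lt_mul hA).2 (by unfold numVertices at hv; omega)
    refine ⟨_, gadgetIndex_lt hS hp he, mem_gadgetBag_iff.2
      (.inr (.inr ⟨_, he, rfl, _, Nat.mod_lt w hA, ?_⟩))⟩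
    rw [auxVertex, add_assoc _ _ (w % _), Nat.div_add_mod']

theorem mem_gadgetBag_of_le_of_le {l : ℕ} (hfi : f ≤ i) (hil : i ≤ l)
    (hl : l < S.numGadgetBags p) (hvf : v ∈ S.gadgetBag p f) (hvl : v ∈ S.gadgetBag p l) :
    v ∈ S.gadgetBag p i := by
  rw [mem_gadgetBag_iff] at hvf hvl ⊢
  have bound_f := window_end_le_numDigitVertices (hfi.trans_lt (hil.trans_lt hl))
  have bound_l := window_end_le_numDigitVertices hl
  rcases hvf with hvf | hvf | ⟨e, he, hef, x, hx, hv⟩ <;>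
    rcases hvl with hvl | hvl | ⟨e', he', hel, x', hx', hv'⟩
  any_goals (left; assumption)
  · have h1 : f / (S.numDigitConstraints p + 1) ≤ i / (S.numDigitConstraints p + 1) :=
      Nat.div_le_div_right hfi
    have h2 : i / (S.numDigitConstraints p + 1) ≤ l / (S.numDigitConstraints p + 1) :=
      Nat.div_le_div_right hil
    refine .inr (.inl ⟨?_, hvf.2.trans_le ?_⟩)
    · exact (Nat.add_le_add_left (Nat.mul_le_mul_right _ h2) _).trans hvl.1
    · gcongr
  · unfold auxVertex at hv'
    omega
  · unfold auxVertex at hv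
    omega
  · obtain rfl := eq_of_auxVertex_eq hx hx' (hv.symm.trans hv')
    exact .inr (.inr ⟨e, he, by omega, x, hx, hv⟩)

theorem IsNear.mem_gadgetBag (hS : S.HasIntervals) (hp : p.Valid)
    (he : e < S.numDigitConstraints p) (h : S.IsNear p e v) :
    v ∈ S.gadgetBag p (S.gadgetIndex p e) := by
  rw [mem_gadgetBag_iff, gadgetIndex_div he]
  rcases h with h | ⟨r, rfl⟩ | ⟨i, hi, rfl⟩
  · exact .inl h
  · obtain ⟨h1, h2⟩ := scopePlace_div_mem_window hS hp (source p e) (r / p.q)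
    refine .inr (.inl ⟨Nat.add_le_add_left ?_ _, Nat.add_lt_add_left ?_ _⟩)
    · exact (Nat.mul_le_mul_right _ h1).trans (Nat.le_add_right _ _)
    · exact mul_add_lt_mul (by omega) (Nat.mod_lt r hp.q_pos)
  · exact .inr (.inr ⟨e, he, rfl, i, hi, rfl⟩)

theorem IsNear.lt_numVertices (hS : S.HasIntervals) (hp : p.Valid)
    (he : e < S.numDigitConstraints p) (h : S.IsNear p e v) : v < S.numVertices p :=
  lt_numVertices_of_mem (gadgetIndex_lt hS hp he) (h.mem_gadgetBag hS hp he)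

theorem digitVar_lt (hS : S.HasIntervals) (hp : p.Valid) (he : e < S.numDigitConstraints p)
    (r : ℕ) : S.digitVar p e r < S.numDigitVertices p := by
  have h1 := window_lt hS hp (source_lt he)
  have h2 := (scopePlace_div_mem_window hS hp (source p e) (r / p.q)).2
  exact mul_add_lt_mul (by unfold numWindows; omega) (Nat.mod_lt r hp.q_pos)

theorem isPathDecomposition_gadgetBags (hS : S.HasIntervals) (hp : p.Valid)
    {G : SimpleGraph (Fin (S.numVertices p))}
    (h : ∀ v w, G.Adj v w → ∃ f < S.numGadgetBags p,
      (v : ℕ) ∈ S.gadgetBag p f ∧ (w : ℕ) ∈ S.gadgetBag p f) :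
    IsPathDecomposition G (bagSets (liftBags _ (S.gadgetBags p) gadgetBags_lt)) := by
  refine isPathDecomposition_liftBags (fun v hv => ?_) (fun v w hvw => ?_)
    fun v i j l hij hjl hi hl => ?_
  · obtain ⟨f, hf, hv⟩ := exists_mem_gadgetBag hS hp hv
    exact ⟨f, by rwa [length_gadgetBags], mem_getD_gadgetBags_iff.2 ⟨hf, hv⟩⟩
  · obtain ⟨f, hf, hv, hw⟩ := h v w hvw
    exact ⟨f, by rwa [length_gadgetBags], mem_getD_gadgetBags_iff.2 ⟨hf, hv⟩,
      mem_getD_gadgetBags_iff.2 ⟨hf, hw⟩⟩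
  · rw [mem_getD_gadgetBags_iff] at hi hl ⊢
    exact ⟨by omega, mem_gadgetBag_of_le_of_le hij hjl hl.1 hi.2 hl.2⟩

theorem width_gadgetBags_le :
    width (bagSets (liftBags _ (S.gadgetBags p) gadgetBags_lt)) ≤
      p.b + (S.blocksPerBag p + 1) * p.q + auxSize p := by
  refine width_liftBags_le ?_
  simp only [gadgetBags, List.mem_map]
  rintro _ ⟨f, -, rfl⟩
  exact length_gadgetBag_le

end BagCSP

/-! ### The constructed graph -/

/-- A color other than `x` and `2`. -/
def otherColor (x : ℕ) : ℕ := if x = 0 then 1 else 0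

theorem otherColor_lt_two (x : ℕ) : otherColor x < 2 := by
  unfold otherColor
  split_ifs <;> omega

theorem otherColor_ne (x : ℕ) : otherColor x ≠ x := by
  unfold otherColor
  split_ifs <;> omega

theorem exists_color_permutation {b : ℕ} {col : ℕ → ℕ} (hb : ∀ c < b, col c < b)
    (hcol : ∀ c < b, ∀ c' < b, c ≠ c' → col c ≠ col c') :
    ∃ π : ℕ → ℕ, (∀ y < b, π y < b) ∧ (∀ y < b, ∀ y' < b, π y = π y' → y = y') ∧
      ∀ c < b, π (col c) = c := by
  let f : Fin b → Fin b := fun c => ⟨col c, hb c c.2⟩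
  have hf : Function.Injective f := fun c c' h => by
    by_contra hne
    exact hcol c c.2 c' c'.2 (Fin.val_ne_of_ne hne) (Fin.mk.inj_iff.1 h)
  let F := Equiv.ofBijective f (Finite.injective_iff_bijective.1 hf)
  refine ⟨fun y => if h : y < b then F.symm ⟨y, h⟩ else 0, fun y hy => ?_,
    fun y hy y' hy' h => ?_, fun c hc => ?_⟩
  · simp only [hy, dif_pos, Fin.is_lt]
  · simp only [hy, hy', dif_pos] at h
    simpa using F.symm.injective (Fin.ext h)
  · have : F ⟨c, hc⟩ = ⟨col c, hb c hc⟩ := rfl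
    simp only [hb c hc, dif_pos, ← this, Equiv.symm_apply_apply]

namespace BagCSP

variable (S : BagCSP) (p : Recoding)

/-- The colors that are allowed at the auxiliary vertices. Those with `i % 4 = 0` form the chain
that transports the color `0`; it cannot do so through all the steps of a constraint. -/
def IsAllowed (e i c : ℕ) : Prop :=
  (i % 4 = 0 ∧ c < 2 ∧ (i = 0 → c = 0) ∧ (i = 12 * p.q → S.IsLive p e → c = 1)) ∨
  (i % 4 = 1 ∧ (c = digitVal p e (i / 4) ∨ c = otherColor (digitVal p e (i / 4)))) ∨
  (i % 4 = 2 ∧ (c = otherColor (digitVal p e (i / 4)) ∨ c = 2)) ∨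
  (i % 4 = 3 ∧ c < 3)

instance (e i c : ℕ) : Decidable (S.IsAllowed p e i c) := inferInstanceAs (Decidable (_ ∨ _))

/-- The edge between two vertices of the palette; where there is none, the edge `(0, 1)` is
repeated. -/
def paletteEdge (c c' : ℕ) : ℕ × ℕ := if c ≠ c' then (c, c') else (0, 1)

/-- The edge of the palette graph that excludes the color `c` at an auxiliary vertex; if this color
is allowed, the edge `(0, 1)` is repeated. -/
def exclusionEdge (e i c : ℕ) : ℕ × ℕ :=
  if S.IsAllowed p e i c then (0, 1) else (c, S.auxVertex p e i)

/-- The edges of the step `r` in the chain of the constraint `e`. -/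
def stepEdges (e r : ℕ) : List (ℕ × ℕ) :=
  [(digitVertex p (S.digitVar p e r), S.auxVertex p e (4 * r + 1)),
    (S.auxVertex p e (4 * r + 1), S.auxVertex p e (4 * r + 2)),
    (S.auxVertex p e (4 * r + 2), S.auxVertex p e (4 * r + 3)),
    (S.auxVertex p e (4 * r + 3), S.auxVertex p e (4 * r)),
    (S.auxVertex p e (4 * r + 3), S.auxVertex p e (4 * r + 4))]

/-- The edges of the constructed graph. -/
def edgeList : List (ℕ × ℕ) :=
  ((List.range p.b).flatMap fun c => (List.range p.b).map (paletteEdge c)) ++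
    (List.range (S.numDigitConstraints p)).flatMap fun e =>
      ((List.range (auxSize p)).flatMap fun i => (List.range p.b).map (S.exclusionEdge p e i)) ++
        (List.range (3 * p.q)).flatMap (S.stepEdges p e)

/-- The value at the position `r` in the chain of the constraint `e` if the digits are given by `x`:
it changes from `0` to `1` as soon as a digit differs from the forbidden one. -/
def chainValue (x : ℕ → ℕ) (e r : ℕ) : ℕ :=
  if S.IsLive p e ∧ ∃ r₀ < r, x (S.digitVar p e r₀) ≠ digitVal p e r₀ then 1 else 0

/-- The color of the auxiliary vertex `4 * r + j` of the constraint `e`, for `j < 4`, if the digits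
are given by `x`. -/
def stepColor (x : ℕ → ℕ) (e r j : ℕ) : ℕ :=
  match j with
  | 0 => S.chainValue p x e r
  | 1 => if x (S.digitVar p e r) = digitVal p e r then otherColor (digitVal p e r)
    else digitVal p e r
  | 2 => if x (S.digitVar p e r) = digitVal p e r then 2 else otherColor (digitVal p e r)
  | _ => if x (S.digitVar p e r) = digitVal p e r then 1 - S.chainValue p x e r else 2

/-- The function on the vertices that is the identity on the palette, and that is given by `x` on
the digits and by `g` on the auxiliary vertices. -/
def assemble (x : ℕ → ℕ) (g : ℕ → ℕ → ℕ) (v : ℕ) : ℕ :=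
  if v < p.b then v else
    if v < p.b + S.numDigitVertices p then x (v - p.b) else
      g ((v - (p.b + S.numDigitVertices p)) / auxSize p)
        ((v - (p.b + S.numDigitVertices p)) % auxSize p)

variable {S p} {e i r : ℕ} {x : ℕ → ℕ} {g : ℕ → ℕ → ℕ}

theorem forall_edgeList_iff {P : ℕ → ℕ → Prop} (h01 : P 0 1) :
    (∀ x ∈ S.edgeList p, P x.1 x.2) ↔
      (∀ c < p.b, ∀ c' < p.b, c ≠ c' → P c c') ∧ ∀ e < S.numDigitConstraints p,
        (∀ i < auxSize p, ∀ c < p.b, ¬ S.IsAllowed p e i c → P c (S.auxVertex p e i)) ∧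
        ∀ r < 3 * p.q, ∀ x ∈ S.stepEdges p e r, P x.1 x.2 := by
  have hpal c c' : P (paletteEdge c c').1 (paletteEdge c c').2 ↔ (c ≠ c' → P c c') := by
    unfold paletteEdge
    split_ifs with h <;> simp [h, h01]
  have hexc e i c : P (S.exclusionEdge p e i c).1 (S.exclusionEdge p e i c).2 ↔
      (¬ S.IsAllowed p e i c → P c (S.auxVertex p e i)) := by
    unfold exclusionEdge
    split_ifs with h <;> simp [h, h01]
  simp only [edgeList, List.forall_mem_append, List.forall_mem_flatMap, List.forall_mem_map,
    List.mem_range, hpal, hexc]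

theorem isNear_auxVertex (h : i < auxSize p) : S.IsNear p e (S.auxVertex p e i) :=
  .inr (.inr ⟨i, h, rfl⟩)

theorem isNear_digitVertex : S.IsNear p e (digitVertex p (S.digitVar p e r)) :=
  .inr (.inl ⟨r, rfl⟩)

theorem le_auxVertex (e i : ℕ) : p.b + S.numDigitVertices p ≤ S.auxVertex p e i := by
  unfold auxVertex
  omega

theorem stepEdges_ne_and_isNear (hS : S.HasIntervals) (hp : p.Valid)
    (he : e < S.numDigitConstraints p) (hr : r < 3 * p.q) :
    ∀ x ∈ S.stepEdges p e r, x.1 ≠ x.2 ∧ S.IsNear p e x.1 ∧ S.IsNear p e x.2 := by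
  have hnear i (hi : i ≤ 4) : S.IsNear p e (S.auxVertex p e (4 * r + i)) :=
    isNear_auxVertex (by unfold auxSize; omega)
  have hne i j (hij : i ≠ j) : S.auxVertex p e (4 * r + i) ≠ S.auxVertex p e (4 * r + j) := by
    unfold auxVertex
    omega
  have hdigit : digitVertex p (S.digitVar p e r) ≠ S.auxVertex p e (4 * r + 1) := by
    have := le_auxVertex (S := S) (p := p) e (4 * r + 1)
    have := digitVar_lt hS hp he r
    unfold digitVertex
    omega
  simp only [stepEdges, List.forall_mem_cons, List.not_mem_nil, false_imp_iff, implies_true,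
    and_true]
  exact ⟨⟨hdigit, isNear_digitVertex, hnear 1 (by omega)⟩,
    ⟨hne 1 2 (by omega), hnear 1 (by omega), hnear 2 (by omega)⟩,
    ⟨hne 2 3 (by omega), hnear 2 (by omega), hnear 3 (by omega)⟩,
    ⟨hne 3 0 (by omega), hnear 3 (by omega), hnear 0 (by omega)⟩,
    ⟨hne 3 4 (by omega), hnear 3 (by omega), hnear 4 (by omega)⟩⟩

theorem edgeList_ne_and_isNear (hS : S.HasIntervals) (hp : p.Valid) :
    ∀ x ∈ S.edgeList p, x.1 ≠ x.2 ∧ ((x.1 < p.b ∧ x.2 < p.b) ∨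
      ∃ e < S.numDigitConstraints p, S.IsNear p e x.1 ∧ S.IsNear p e x.2) := by
  have hb := hp.two_le_b
  rw [forall_edgeList_iff (P := fun u v => u ≠ v ∧ ((u < p.b ∧ v < p.b) ∨
    ∃ e < S.numDigitConstraints p, S.IsNear p e u ∧ S.IsNear p e v)) ⟨by omega, by omega⟩]
  refine ⟨fun c hc c' hc' hne => ⟨hne, .inl ⟨hc, hc'⟩⟩, fun e he =>
    ⟨fun i hi c hc _ => ⟨?_, .inr ⟨e, he, .inl hc, isNear_auxVertex hi⟩⟩, fun r hr y hy => ?_⟩⟩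
  · have := le_auxVertex (S := S) (p := p) e i
    omega
  · have := stepEdges_ne_and_isNear hS hp he hr y hy
    exact ⟨this.1, .inr ⟨e, he, this.2⟩⟩

theorem digitVal_lt (hb : 0 < p.b) (e r : ℕ) : digitVal p e r < p.b := digit_lt hb _ _

theorem chainValue_lt_two (x : ℕ → ℕ) (e r : ℕ) : S.chainValue p x e r < 2 := by
  unfold chainValue
  split_ifs <;> omega

theorem chainValue_zero : S.chainValue p x e 0 = 0 := by simp [chainValue]

theorem chainValue_eq_one (he : S.IsLive p e)
    (h : ∃ r₀ < r, x (S.digitVar p e r₀) ≠ digitVal p e r₀) : S.chainValue p x e r = 1 :=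
  if_pos ⟨he, h⟩

theorem chainValue_succ (h : x (S.digitVar p e r) = digitVal p e r) :
    S.chainValue p x e (r + 1) = S.chainValue p x e r := by
  simp only [chainValue, Nat.exists_lt_succ_right, h, ne_eq, not_true_eq_false, or_false]

theorem assemble_of_lt {v : ℕ} (hv : v < p.b) : S.assemble p x g v = v := if_pos hv

theorem assemble_digitVertex {v : ℕ} (hv : v < S.numDigitVertices p) :
    S.assemble p x g (digitVertex p v) = x v := by
  unfold assemble digitVertex
  rw [if_neg (by omega), if_pos (by omega), Nat.add_sub_cancel_left]

theorem assemble_auxVertex (hi : i < auxSize p) :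
    S.assemble p x g (S.auxVertex p e i) = g e i := by
  have h := le_auxVertex (S := S) (p := p) e i
  have hsub : S.auxVertex p e i - (p.b + S.numDigitVertices p) = e * auxSize p + i := by
    unfold auxVertex
    omega
  unfold assemble
  rw [if_neg (by omega), if_neg (by omega), hsub, mul_add_div_of_lt hi, Nat.mul_add_mod_of_lt hi]

theorem assemble_lt (hx : ∀ v, x v < p.b) (hg : ∀ e i, g e i < p.b) (v : ℕ) :
    S.assemble p x g v < p.b := by
  unfold assemble
  split_ifs
  exacts [‹_›, hx _, hg _ _]

theorem stepColor_lt (h3 : 3 ≤ p.b) (x : ℕ → ℕ) (e r j : ℕ) : S.stepColor p x e r j < p.b := by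
  have := chainValue_lt_two (S := S) (p := p) x e r
  have := digitVal_lt (p := p) (by omega) e r
  have := otherColor_lt_two (digitVal p e r)
  unfold stepColor
  split <;> (try split_ifs) <;> omega

theorem isAllowed_stepColor
    (hx : S.IsLive p e → ∃ r < 3 * p.q, x (S.digitVar p e r) ≠ digitVal p e r) (i : ℕ) :
    S.IsAllowed p e i (S.stepColor p x e (i / 4) (i % 4)) := by
  have hchain := chainValue_lt_two (S := S) (p := p) x e (i / 4)
  have hi : i % 4 < 4 := Nat.mod_lt _ (by omega)
  unfold IsAllowed
  generalize hj : i % 4 = j at hi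
  interval_cases j
  · refine .inl ⟨rfl, hchain, fun h => ?_, fun h hl => ?_⟩
    · simp [stepColor, h, chainValue_zero]
    · rw [h, show 12 * p.q / 4 = 3 * p.q by omega]
      exact chainValue_eq_one hl (hx hl)
  · refine .inr (.inl ⟨rfl, ?_⟩)
    simp only [stepColor]
    split_ifs <;> simp
  · refine .inr (.inr (.inl ⟨rfl, ?_⟩))
    simp only [stepColor]
    split_ifs <;> simp
  · refine .inr (.inr (.inr ⟨rfl, ?_⟩))
    simp only [stepColor]
    split_ifs <;> omega

theorem stepEdges_ne_of_stepColor {col : ℕ → ℕ}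
    (hdigit : col (digitVertex p (S.digitVar p e r)) = x (S.digitVar p e r))
    (haux : ∀ i < auxSize p, col (S.auxVertex p e i) = S.stepColor p x e (i / 4) (i % 4))
    (hr : r < 3 * p.q) : ∀ y ∈ S.stepEdges p e r, col y.1 ≠ col y.2 := by
  have hcol j (hj : j < 4) : col (S.auxVertex p e (4 * r + j)) = S.stepColor p x e r j := by
    rw [haux _ (by unfold auxSize; omega), show (4 * r + j) / 4 = r by omega,
      show (4 * r + j) % 4 = j by omega]
  have hlast : col (S.auxVertex p e (4 * r + 4)) = S.chainValue p x e (r + 1) := by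
    rw [haux _ (by unfold auxSize; omega), show (4 * r + 4) / 4 = r + 1 by omega,
      show (4 * r + 4) % 4 = 0 by omega, stepColor]
  have hchain := chainValue_lt_two (S := S) (p := p) x e r
  have hchain' := chainValue_lt_two (S := S) (p := p) x e (r + 1)
  have hlt := otherColor_lt_two (digitVal p e r)
  have hne := otherColor_ne (digitVal p e r)
  simp only [stepEdges, List.forall_mem_cons, List.not_mem_nil, false_imp_iff, implies_true,
    and_true, hdigit, hlast, hcol 1 (by omega), hcol 2 (by omega), hcol 3 (by omega),
    show col (S.auxVertex p e (4 * r)) = _ from hcol 0 (by omega), stepColor]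
  by_cases hk : x (S.digitVar p e r) = digitVal p e r
  · have := chainValue_succ hk
    simp only [if_pos hk]
    omega
  · simp only [if_neg hk]
    omega

theorem exists_coloring_of_digitSolvable (hS : S.HasIntervals) (hp : p.Valid) (h3 : 3 ≤ p.b)
    (h : S.DigitSolvable p) :
    ∃ col : ℕ → ℕ, (∀ v, col v < p.b) ∧ ∀ x ∈ S.edgeList p, col x.1 ≠ col x.2 := by
  obtain ⟨x, hx, hC⟩ := h
  set col := S.assemble p x fun e i => S.stepColor p x e (i / 4) (i % 4)
  have hpal c (hc : c < p.b) : col c = c := assemble_of_lt hc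
  have haux e i (hi : i < auxSize p) :
      col (S.auxVertex p e i) = S.stepColor p x e (i / 4) (i % 4) := assemble_auxVertex hi
  refine ⟨col, assemble_lt hx fun e i => stepColor_lt h3 _ _ _ _, ?_⟩
  rw [forall_edgeList_iff (P := fun u v => col u ≠ col v)
    (by rw [hpal 0 (by omega), hpal 1 (by omega)]; omega)]
  refine ⟨fun c hc c' hc' hne => by rwa [hpal c hc, hpal c' hc'], fun e he =>
    ⟨fun i hi c hc hnot heq => hnot ?_, fun r hr =>
      stepEdges_ne_of_stepColor (assemble_digitVertex (digitVar_lt hS hp he r)) (haux e) hr⟩⟩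
  rw [hpal c hc, haux e i hi] at heq
  exact heq ▸ isAllowed_stepColor (hC e he) i

theorem exists_normalized_coloring (h2 : 2 ≤ p.b)
    (h : ∃ col : ℕ → ℕ, (∀ v, col v < p.b) ∧ ∀ x ∈ S.edgeList p, col x.1 ≠ col x.2) :
    ∃ col : ℕ → ℕ, (∀ v, col v < p.b) ∧ (∀ c < p.b, col c = c) ∧
      ∀ x ∈ S.edgeList p, col x.1 ≠ col x.2 := by
  obtain ⟨col, hlt, hcol⟩ := h
  have h01 : col 0 ≠ col 1 := hcol (0, 1) (by
    simp only [edgeList, List.mem_append, List.mem_flatMap, List.mem_map, List.mem_range]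
    exact .inl ⟨0, by omega, 1, by omega, rfl⟩)
  obtain ⟨π, hπ, hinj, hπc⟩ := exists_color_permutation (fun c _ => hlt c)
    ((forall_edgeList_iff (P := fun u v => col u ≠ col v) h01).1 hcol).1
  exact ⟨fun v => π (col v), fun v => hπ _ (hlt v), hπc,
    fun x hx h => hcol x hx (hinj _ (hlt _) _ (hlt _) h)⟩

theorem chain_eq_zero {col : ℕ → ℕ}
    (hallowed : ∀ i < auxSize p, S.IsAllowed p e i (col (S.auxVertex p e i)))
    (hstep : ∀ r < 3 * p.q, ∀ y ∈ S.stepEdges p e r, col y.1 ≠ col y.2)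
    (hdigit : ∀ r < 3 * p.q, col (digitVertex p (S.digitVar p e r)) = digitVal p e r) :
    ∀ r ≤ 3 * p.q, col (S.auxVertex p e (4 * r)) = 0 := by
  have hA : auxSize p = 12 * p.q + 1 := rfl
  intro r
  induction r with
  | zero =>
    intro _
    have := hallowed 0 (by omega)
    unfold IsAllowed at this
    rw [mul_zero]
    omega
  | succ r ih =>
    intro hr
    have hstart := ih (by omega)
    have hval := hdigit r (by omega)
    have hlt := otherColor_lt_two (digitVal p e r)
    have hedges := hstep r (by omega)
    simp only [stepEdges, List.forall_mem_cons, List.not_mem_nil, false_imp_iff, implies_true,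
      and_true] at hedges
    have h1 := hallowed (4 * r + 1) (by omega)
    have h2 := hallowed (4 * r + 2) (by omega)
    have h3 := hallowed (4 * r + 3) (by omega)
    have h4 := hallowed (4 * r + 4) (by omega)
    unfold IsAllowed at h1 h2 h3 h4
    rw [show (4 * r + 1) / 4 = r by omega] at h1
    rw [show (4 * r + 2) / 4 = r by omega] at h2
    rw [mul_add, mul_one]
    omega

theorem digitSolvable_of_exists_coloring (h2 : 2 ≤ p.b)
    (h : ∃ col : ℕ → ℕ, (∀ v, col v < p.b) ∧ ∀ x ∈ S.edgeList p, col x.1 ≠ col x.2) :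
    S.DigitSolvable p := by
  obtain ⟨col, hlt, hpal, hcol⟩ := exists_normalized_coloring h2 h
  rw [forall_edgeList_iff (P := fun u v => col u ≠ col v)
    (by rw [hpal 0 (by omega), hpal 1 (by omega)]; omega)] at hcol
  refine ⟨fun v => col (digitVertex p v), fun v => hlt _, fun e he hl => ?_⟩
  by_contra! hdigit
  obtain ⟨hexclusion, hstep⟩ := hcol.2 e he
  have hallowed i (hi : i < auxSize p) : S.IsAllowed p e i (col (S.auxVertex p e i)) := by
    by_contra hnot
    exact hexclusion i hi _ (hlt _) hnot (hpal _ (hlt _))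
  have hzero : col (S.auxVertex p e (12 * p.q)) = 0 := by
    rw [show 12 * p.q = 4 * (3 * p.q) by ring]
    exact chain_eq_zero hallowed hstep hdigit _ le_rfl
  have hend := hallowed (12 * p.q) (Nat.lt_succ_self _)
  rw [hzero] at hend
  rcases hend with ⟨-, -, -, h⟩ | h | h | h
  · exact absurd (h rfl hl) (by omega)
  all_goals omega

theorem digitSolvable_iff_exists_coloring (hS : S.HasIntervals) (hp : p.Valid) (h3 : 3 ≤ p.b) :
    S.DigitSolvable p ↔
      ∃ col : ℕ → ℕ, (∀ v, col v < p.b) ∧ ∀ x ∈ S.edgeList p, col x.1 ≠ col x.2 :=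
  ⟨exists_coloring_of_digitSolvable hS hp h3, digitSolvable_of_exists_coloring hp.two_le_b⟩

end BagCSP

/-! ### The constructed formula -/

namespace BagCSP

variable (S : BagCSP) (p : Recoding)

/-- The clauses that fix the two ends of the chain of the constraint `e`. -/
def endClauses (e : ℕ) : List (List (ℕ × Bool)) :=
  [[(S.auxVertex p e 0, false)], [(S.auxVertex p e (12 * p.q), decide (S.IsLive p e))]]

/-- The clause of the step `r` in the chain of the constraint `e`: the chain can change from false
to true only if the digit differs from the forbidden one. -/
def stepClause (e r : ℕ) : List (ℕ × Bool) :=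
  [(S.auxVertex p e (4 * r), true),
    (digitVertex p (S.digitVar p e r), decide (digitVal p e r = 0)),
    (S.auxVertex p e (4 * r + 4), false)]

/-- The clauses of the constructed formula. -/
def clauseList : List (List (ℕ × Bool)) :=
  (List.range (S.numDigitConstraints p)).flatMap fun e =>
    S.endClauses p e ++ (List.range (3 * p.q)).map (S.stepClause p e)

variable {S p} {e r : ℕ} {x : ℕ → ℕ}

theorem forall_clauseList_iff {P : List (ℕ × Bool) → Prop} :
    (∀ C ∈ S.clauseList p, P C) ↔ ∀ e < S.numDigitConstraints p,
      (P [(S.auxVertex p e 0, false)] ∧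
        P [(S.auxVertex p e (12 * p.q), decide (S.IsLive p e))]) ∧
      ∀ r < 3 * p.q, P (S.stepClause p e r) := by
  simp only [clauseList, endClauses, List.forall_mem_append, List.forall_mem_flatMap,
    List.forall_mem_map, List.mem_range, List.forall_mem_cons, List.not_mem_nil, false_imp_iff,
    implies_true, and_true]

theorem clauseList_length_le_and_isNear :
    ∀ C ∈ S.clauseList p, C.length ≤ 3 ∧
      ∃ e < S.numDigitConstraints p, ∀ l ∈ C, S.IsNear p e l.1 := by
  have hnear e i (hi : i ≤ 12 * p.q) : S.IsNear p e (S.auxVertex p e i) :=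
    isNear_auxVertex (Nat.lt_succ_of_le hi)
  rw [forall_clauseList_iff]
  refine fun e he => ⟨⟨⟨by simp, e, he, ?_⟩, ⟨by simp, e, he, ?_⟩⟩, fun r hr =>
    ⟨by simp [stepClause], e, he, ?_⟩⟩
  · simpa using hnear e 0 (by omega)
  · simpa using hnear e _ le_rfl
  · simpa [stepClause] using
      ⟨hnear e _ (by omega), isNear_digitVertex, hnear e _ (by omega)⟩

theorem exists_mem_stepClause_iff {y : ℕ → ℕ} : (∃ l ∈ S.stepClause p e r, y l.1 = l.2.toNat) ↔
    y (S.auxVertex p e (4 * r)) = 1 ∨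
      y (digitVertex p (S.digitVar p e r)) = (decide (digitVal p e r = 0)).toNat ∨
      y (S.auxVertex p e (4 * r + 4)) = 0 := by
  simp [stepClause]

theorem eq_toNat_iff_ne_digitVal (h2 : p.b = 2) {y : ℕ} (hy : y < 2) (e r : ℕ) :
    y = (decide (digitVal p e r = 0)).toNat ↔ y ≠ digitVal p e r := by
  have hd := digitVal_lt (p := p) (by omega) e r
  by_cases h0 : digitVal p e r = 0
  · simp only [h0, decide_true, Bool.toNat_true]
    omega
  · simp only [h0, decide_false, Bool.toNat_false]
    omega

theorem exists_assignment_of_digitSolvable (hS : S.HasIntervals) (hp : p.Valid) (h2 : p.b = 2)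
    (h : S.DigitSolvable p) :
    ∃ y : ℕ → ℕ, (∀ v, y v < 2) ∧ ∀ C ∈ S.clauseList p, ∃ l ∈ C, y l.1 = l.2.toNat := by
  obtain ⟨x, hx, hC⟩ := h
  set y := S.assemble p x fun e i => S.chainValue p x e (i / 4)
  have hdigit e (he : e < S.numDigitConstraints p) r :
      y (digitVertex p (S.digitVar p e r)) = x (S.digitVar p e r) :=
    assemble_digitVertex (digitVar_lt hS hp he r)
  have haux e i (hi : i ≤ 12 * p.q) :
      y (S.auxVertex p e i) = S.chainValue p x e (i / 4) :=
    assemble_auxVertex (Nat.lt_succ_of_le hi)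
  refine ⟨y, fun v => h2 ▸ assemble_lt hx (fun e i => h2 ▸ chainValue_lt_two x e _) v,
    forall_clauseList_iff.2 fun e he => ⟨⟨?_, ?_⟩, fun r hr => exists_mem_stepClause_iff.2 ?_⟩⟩
  · simp [haux e 0 (by omega), chainValue_zero]
  · rw [List.exists_mem_cons_iff, haux e _ le_rfl, show 12 * p.q / 4 = 3 * p.q by omega]
    by_cases hl : S.IsLive p e
    · simp [hl, chainValue_eq_one hl (hC e he hl)]
    · simp [hl, chainValue]
  · rw [hdigit e he, haux e _ (by omega), haux e _ (by omega), show 4 * r / 4 = r by omega,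
      show (4 * r + 4) / 4 = r + 1 by omega, eq_toNat_iff_ne_digitVal h2 (h2 ▸ hx _)]
    by_cases hk : x (S.digitVar p e r) = digitVal p e r
    · have := chainValue_lt_two (S := S) (p := p) x e r
      rw [chainValue_succ hk]
      omega
    · exact .inr (.inl hk)

theorem digitSolvable_of_exists_assignment (h2 : p.b = 2)
    (h : ∃ y : ℕ → ℕ, (∀ v, y v < 2) ∧ ∀ C ∈ S.clauseList p, ∃ l ∈ C, y l.1 = l.2.toNat) :
    S.DigitSolvable p := by
  obtain ⟨y, hy, hC⟩ := h
  refine ⟨fun v => y (digitVertex p v), fun v => h2 ▸ hy _, fun e he hl => ?_⟩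
  obtain ⟨⟨hstart, hend⟩, hstep⟩ := forall_clauseList_iff.1 hC e he
  by_contra! hdigit
  have hchain : ∀ r ≤ 3 * p.q, y (S.auxVertex p e (4 * r)) = 0 := fun r => by
    induction r with
    | zero => simpa using hstart
    | succ r ih =>
      intro hr
      have hclause := exists_mem_stepClause_iff.1 (hstep r hr)
      rw [ih (by omega), eq_toNat_iff_ne_digitVal h2 (hy _)] at hclause
      simpa [hdigit r hr, mul_add_one] using hclause
  have hzero := hchain _ le_rfl
  rw [show 4 * (3 * p.q) = 12 * p.q by ring] at hzero
  simp [hzero, hl] at hend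

theorem digitSolvable_iff_exists_assignment (hS : S.HasIntervals) (hp : p.Valid) (h2 : p.b = 2) :
    S.DigitSolvable p ↔
      ∃ y : ℕ → ℕ, (∀ v, y v < 2) ∧ ∀ C ∈ S.clauseList p, ∃ l ∈ C, y l.1 = l.2.toNat :=
  ⟨exists_assignment_of_digitSolvable hS hp h2, digitSolvable_of_exists_assignment h2⟩

end BagCSP

/-! ### The constructed instances -/

theorem mem_of_edgeGraph_liftEdges_adj {n : ℕ} {E : List (ℕ × ℕ)}
    {h : ∀ e ∈ E, e.1 < n ∧ e.2 < n} {v w : Fin n} (hvw : (edgeGraph (liftEdges n E h)).Adj v w) :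
    ((v : ℕ), (w : ℕ)) ∈ E ∨ ((w : ℕ), (v : ℕ)) ∈ E := by
  have hmem {v w : Fin n} (hvw : (v, w) ∈ liftEdges n E h) : ((v : ℕ), (w : ℕ)) ∈ E := by
    simp only [liftEdges, List.mem_pmap, Prod.mk.injEq] at hvw
    obtain ⟨x, hx, rfl, rfl⟩ := hvw
    exact hx
  exact ((SimpleGraph.fromRel_adj _ _ _).1 hvw).2.imp hmem hmem

theorem exists_clause_of_primalGraph_liftClauses_adj {n : ℕ} {F : List (List (ℕ × Bool))}
    {h : ∀ C ∈ F, ∀ l ∈ C, l.1 < n} {v w : Fin n} (hvw : (liftClauses n F h).primalGraph.Adj v w) :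
    ∃ C ∈ F, (∃ l ∈ C, l.1 = v) ∧ ∃ l ∈ C, l.1 = w := by
  have hmem {v w : Fin n} : (∃ C ∈ liftClauses n F h, (∃ b, (v, b) ∈ C) ∧ ∃ b, (w, b) ∈ C) →
      ∃ C ∈ F, (∃ l ∈ C, l.1 = v) ∧ ∃ l ∈ C, l.1 = w := by
    simp only [liftClauses, List.mem_pmap]
    rintro ⟨_, ⟨C, hC, rfl⟩, ⟨b, hv⟩, b', hw⟩
    simp only [List.mem_pmap, Prod.mk.injEq, Fin.ext_iff] at hv hw
    obtain ⟨l, hl, hv, -⟩ := hv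
    obtain ⟨l', hl', hw, -⟩ := hw
    exact ⟨C, hC, ⟨l, hl, hv⟩, l', hl', hw⟩
  rcases ((SimpleGraph.fromRel_adj _ _ _).1 hvw).2 with h | h
  · exact hmem h
  · obtain ⟨C, hC, hw, hv⟩ := hmem h
    exact ⟨C, hC, hv, hw⟩

namespace BagCSP

variable {S : BagCSP} {p : Recoding}

theorem edgeList_lt (hS : S.HasIntervals) (hp : p.Valid) :
    ∀ x ∈ S.edgeList p, x.1 < S.numVertices p ∧ x.2 < S.numVertices p := fun x hx => by
  rcases (edgeList_ne_and_isNear hS hp x hx).2 with h | ⟨e, he, hv, hw⟩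
  · unfold numVertices
    omega
  · exact ⟨hv.lt_numVertices hS hp he, hw.lt_numVertices hS hp he⟩

theorem clauseList_lt (hS : S.HasIntervals) (hp : p.Valid) :
    ∀ C ∈ S.clauseList p, ∀ l ∈ C, l.1 < S.numVertices p := fun C hC l hl => by
  obtain ⟨-, e, he, hnear⟩ := clauseList_length_le_and_isNear C hC
  exact (hnear l hl).lt_numVertices hS hp he

theorem exists_gadgetBag_of_mem_edgeList (hS : S.HasIntervals) (hp : p.Valid) {v w : ℕ}
    (h : (v, w) ∈ S.edgeList p) :
    ∃ f < S.numGadgetBags p, v ∈ S.gadgetBag p f ∧ w ∈ S.gadgetBag p f := by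
  rcases (edgeList_ne_and_isNear hS hp _ h).2 with ⟨hv, hw⟩ | ⟨e, he, hv, hw⟩
  · exact ⟨0, numGadgetBags_pos, mem_gadgetBag_iff.2 (.inl hv), mem_gadgetBag_iff.2 (.inl hw)⟩
  · exact ⟨_, gadgetIndex_lt hS hp he, hv.mem_gadgetBag hS hp he, hw.mem_gadgetBag hS hp he⟩

/-- The constructed input of `k`-Coloring. -/
def toColoring (hS : S.HasIntervals) (hp : p.Valid) : ColoringInstance where
  n := S.numVertices p
  edges := liftEdges _ (S.edgeList p) (edgeList_lt hS hp)
  bags := liftBags _ (S.gadgetBags p) gadgetBags_lt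
  loopless := (forall_mem_pmap_iff (Q' := fun x => x.1 ≠ x.2) fun _ _ => by simp).2
    fun x hx => (edgeList_ne_and_isNear hS hp x hx).1
  decomposition := isPathDecomposition_gadgetBags hS hp fun v w hvw => by
    rcases mem_of_edgeGraph_liftEdges_adj hvw with h | h
    · exact exists_gadgetBag_of_mem_edgeList hS hp h
    · exact (exists_gadgetBag_of_mem_edgeList hS hp h).imp fun f hf => ⟨hf.1, hf.2.symm⟩

/-- The constructed input of 3-SAT. -/
def toThreeSAT (hS : S.HasIntervals) (hp : p.Valid) : ThreeSATInstance where
  n := S.numVertices p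
  formula := liftClauses _ (S.clauseList p) (clauseList_lt hS hp)
  bags := liftBags _ (S.gadgetBags p) gadgetBags_lt
  arity := (forall_mem_pmap_iff (Q' := fun C => C.length ≤ 3) fun _ _ => by
    rw [List.length_pmap]).2 fun C hC => (clauseList_length_le_and_isNear C hC).1
  decomposition := isPathDecomposition_gadgetBags hS hp fun v w hvw => by
    obtain ⟨C, hC, ⟨l, hl, hv⟩, l', hl', hw⟩ := exists_clause_of_primalGraph_liftClauses_adj hvw
    obtain ⟨-, e, he, hnear⟩ := clauseList_length_le_and_isNear C hC
    exact ⟨_, gadgetIndex_lt hS hp he, hv ▸ (hnear l hl).mem_gadgetBag hS hp he,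
      hw ▸ (hnear l' hl').mem_gadgetBag hS hp he⟩

variable (S p) in
/-- The encoding of the constructed bags. -/
def bagWord : List ℕ := encodeList (encodeList fun v => [v]) (S.gadgetBags p)

variable (S p) in
/-- The encoding of the constructed input of `k`-Coloring. -/
def coloringWord : List ℕ :=
  S.numVertices p :: (encodeList (fun e => [e.1, e.2]) (S.edgeList p) ++ S.bagWord p)

variable (S p) in
/-- The encoding of the constructed input of 3-SAT. -/
def threeSATWord : List ℕ :=
  S.numVertices p ::
    (encodeList (encodeList fun l => [l.1, l.2.toNat]) (S.clauseList p) ++ S.bagWord p)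

theorem encode_toColoring (hS : S.HasIntervals) (hp : p.Valid) :
    (toColoring hS hp).encode = S.coloringWord p :=
  congrArg (_ :: ·) (congrArg₂ (· ++ ·) (encodeList_pmap fun _ _ => rfl) encodeBags_liftBags)

theorem encode_toThreeSAT (hS : S.HasIntervals) (hp : p.Valid) :
    (toThreeSAT hS hp).encode = S.threeSATWord p :=
  congrArg (_ :: ·) (congrArg₂ (· ++ ·)
    (encodeList_pmap fun _ _ => encodeList_pmap fun _ _ => rfl) encodeBags_liftBags)

theorem colorable_toColoring_iff (hS : S.WellFormed p.a) (hp : p.Valid) (h3 : 3 ≤ p.b) :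
    (edgeGraph (toColoring hS.toHasIntervals hp).edges).Colorable p.b ↔ S.Solvable p.a := by
  rw [edgeGraph_colorable_iff (by omega) (toColoring _ hp).loopless,
    solvable_iff_digitSolvable hS hp, digitSolvable_iff_exists_coloring hS.toHasIntervals hp h3]
  exact exists_congr fun col => and_congr_right fun _ => forall_mem_pmap_iff fun _ _ => Iff.rfl

theorem satisfiable_toThreeSAT_iff (hS : S.WellFormed p.a) (hp : p.Valid) (h2 : p.b = 2) :
    (toThreeSAT hS.toHasIntervals hp).formula.Satisfiable ↔ S.Solvable p.a := by
  rw [CNF.satisfiable_iff, solvable_iff_digitSolvable hS hp,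
    digitSolvable_iff_exists_assignment hS.toHasIntervals hp h2]
  exact exists_congr fun x => and_congr_right fun _ =>
    forall_mem_pmap_iff fun _ _ => exists_mem_pmap_iff fun _ _ => Iff.rfl

end BagCSP

section Reading

open Finset

/-! ### Reading lists from a word -/

/-- The list `l` stands in the word `w` from the address `o` on. -/
def StandsAt (w : List ℕ) (o : ℕ) (l : List ℕ) : Prop :=
  ∀ i < l.length, w.getD (o + i) 0 = l.getD i 0

theorem standsAt_self (w : List ℕ) : StandsAt w 0 w := fun i _ => by rw [zero_add]

theorem standsAt_append {w : List ℕ} {o : ℕ} {l l' : List ℕ} :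
    StandsAt w o (l ++ l') ↔ StandsAt w o l ∧ StandsAt w (o + l.length) l' := by
  refine ⟨fun h => ⟨fun i hi => ?_, fun i hi => ?_⟩, fun ⟨h, h'⟩ i hi => ?_⟩
  · rw [h i (by simp; omega), List.getD_append _ _ _ _ hi]
  · rw [add_assoc, h _ (by simp; omega), List.getD_append_right _ _ _ _ (by omega),
      Nat.add_sub_cancel_left]
  · rcases lt_or_ge i l.length with hl | hl
    · rw [List.getD_append _ _ _ _ hl, h i hl]
    · rw [List.length_append] at hi
      rw [List.getD_append_right _ _ _ _ hl, ← h' _ (by omega), add_assoc,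
        Nat.add_sub_cancel' hl]

theorem standsAt_cons {w : List ℕ} {o x : ℕ} {l : List ℕ} :
    StandsAt w o (x :: l) ↔ w.getD o 0 = x ∧ StandsAt w (o + 1) l := by
  rw [← List.singleton_append, standsAt_append]
  simp [StandsAt]

section Blocks

variable {α : Type} {w : List ℕ} {o s i : ℕ} {L : List α} {f : α → List ℕ}

theorem StandsAt.getElem (h : StandsAt w o (L.flatMap f)) (hi : i < L.length) :
    StandsAt w (o + ((L.take i).flatMap f).length) (f L[i]) := by
  rw [← List.take_append_drop i L, List.flatMap_append, List.drop_eq_getElem_cons hi,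
    List.flatMap_cons] at h
  exact (standsAt_append.1 (standsAt_append.1 h).2).1

theorem StandsAt.getElem_of_length_eq (h : StandsAt w o (L.flatMap f))
    (hf : ∀ x, (f x).length = s) (hi : i < L.length) : StandsAt w (o + s * i) (f L[i]) := by
  have := h.getElem hi
  rwa [List.length_flatMap, List.map_congr_left fun x _ => hf x, List.map_const',
    List.sum_replicate, List.length_take_of_le hi.le, smul_eq_mul, mul_comm] at this

/-- The address of the list number `i` in a sequence of lists that is written from the address `o`
on, where each entry of a list takes `s` cells. -/
def listAddress (s o : ℕ) (w : List ℕ) : ℕ → ℕ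
  | 0 => o
  | i + 1 => listAddress s o w i + 1 + s * w.getD (listAddress s o w i) 0

theorem length_encodeList (hf : ∀ x, (f x).length = s) (l : List α) :
    (encodeList f l).length = s * l.length + 1 := by
  rw [encodeList, List.length_cons, List.length_flatMap, List.map_congr_left fun x _ => hf x,
    List.map_const', List.sum_replicate, smul_eq_mul, mul_comm]

theorem listAddress_eq {L : List (List α)} (h : StandsAt w o (L.flatMap (encodeList f)))
    (hf : ∀ x, (f x).length = s) (hi : i ≤ L.length) :
    listAddress s o w i = o + ((L.take i).flatMap (encodeList f)).length := by
  induction i with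
  | zero => rfl
  | succ i ih =>
    have hlen := (standsAt_cons.1 (h.getElem hi)).1
    rw [listAddress, ih (by omega), hlen, List.take_succ_eq_append_getElem hi, List.flatMap_append,
      List.length_append, List.flatMap_singleton, length_encodeList hf]
    omega

theorem StandsAt.getElem_listAddress {L : List (List α)}
    (h : StandsAt w o (L.flatMap (encodeList f))) (hf : ∀ x, (f x).length = s)
    (hi : i < L.length) : StandsAt w (listAddress s o w i) (encodeList f L[i]) := by
  rw [listAddress_eq h hf hi.le]
  exact h.getElem hi

end Blocks

/-- Membership in the bags that are written from the address `o` on. -/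
def bagMem (o : ℕ) (w : List ℕ) (i v : ℕ) : Bool :=
  decide (i < w.getD o 0 ∧ ∃ x < w.getD (listAddress 1 (o + 1) w i) 0,
    w.getD (listAddress 1 (o + 1) w i + 1 + x) 0 = v)

theorem bagMem_iff {n o : ℕ} {w : List ℕ} {B : List (List (Fin n))}
    (h : StandsAt w o (encodeBags B)) (i v : ℕ) :
    bagMem o w i v = true ↔ ∃ u : Fin n, (u : ℕ) = v ∧ u ∈ (bagSets B).getD i ∅ := by
  obtain ⟨hlen, hbags⟩ := standsAt_cons.1 h
  rw [bagMem, decide_eq_true_iff, hlen, getD_bagSets]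
  by_cases hi : i < B.length
  · obtain ⟨hcard, hbag⟩ := standsAt_cons.1 (hbags.getElem_listAddress (fun _ => rfl) hi)
    have hentry x (hx : x < B[i].length) :
        w.getD (listAddress 1 (o + 1) w i + 1 + x) 0 = B[i][x] := by
      have := hbag.getElem_of_length_eq (s := 1) (fun _ => rfl) hx
      rw [one_mul] at this
      exact (standsAt_cons.1 this).1
    rw [hcard, List.getD_eq_getElem _ _ hi]
    simp only [hi, true_and, List.mem_toFinset, List.mem_iff_getElem]
    grind
  · simp [hi]

namespace BagCSP

/-- The bags of the constraint satisfaction problem are the sets in the list `B`. -/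
structure HasBags (S : BagCSP) {n : ℕ} (B : List (Finset (Fin n))) : Prop where
  numVars_eq : S.numVars = n
  numBags_eq : S.numBags = B.length
  mem_iff : ∀ i v, S.mem i v = true ↔ ∃ u : Fin n, (u : ℕ) = v ∧ u ∈ B.getD i ∅

section HasBags

variable {S : BagCSP} {n : ℕ} {G : SimpleGraph (Fin n)} {B : List (Finset (Fin n))}

theorem HasBags.hasIntervals (hB : S.HasBags B) (hG : IsPathDecomposition G B) :
    S.HasIntervals := by
  refine ⟨fun i v h => ?_, fun v i j l hij hjl hi hl => ?_⟩
  · obtain ⟨u, rfl, hu⟩ := (hB.mem_iff i v).1 h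
    refine ⟨?_, hB.numVars_eq ▸ u.2⟩
    by_contra hi
    rw [List.getD_eq_default _ _ (by rw [← hB.numBags_eq]; omega)] at hu
    exact notMem_empty _ hu
  · obtain ⟨u, rfl, hu⟩ := (hB.mem_iff i v).1 hi
    obtain ⟨u', hu', hl'⟩ := (hB.mem_iff l u).1 hl
    rw [Fin.ext hu'] at hl'
    exact (hB.mem_iff j u).2 ⟨u, rfl, hG.interval u i j l hij hjl hu hl'⟩

theorem HasBags.exists_mem_of_eq_or_adj (hB : S.HasBags B) (hG : IsPathDecomposition G B)
    {u u' : Fin n} (h : u = u' ∨ G.Adj u u') : ∃ i, S.mem i u = true ∧ S.mem i u' = true := by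
  have hbag : ∃ b ∈ B, u ∈ b ∧ u' ∈ b := by
    rcases h with rfl | h
    · simpa only [and_self] using hG.vertex_mem u
    · exact hG.edge_mem u u' h
  obtain ⟨i, -, hu, hu'⟩ := (exists_mem_iff_exists_getD B ∅ fun b => u ∈ b ∧ u' ∈ b).1 hbag
  exact ⟨i, (hB.mem_iff _ _).2 ⟨u, rfl, hu⟩, (hB.mem_iff _ _).2 ⟨u', rfl, hu'⟩⟩

theorem HasBags.maxBagCard_le (hB : S.HasBags B) : S.maxBagCard ≤ width B + 1 := by
  unfold maxBagCard maxBelow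
  refine Finset.sup_le fun i _ => ?_
  have hsub : {v ∈ range S.numVars | S.mem i v = true} ⊆ (B.getD i ∅).map Fin.valEmbedding := by
    intro v hv
    obtain ⟨u, rfl, hu⟩ := (hB.mem_iff i v).1 (mem_filter.1 hv).2
    exact mem_map_of_mem _ hu
  calc S.bagCard i ≤ ((B.getD i ∅).map Fin.valEmbedding).card := card_le_card hsub
    _ = (B.getD i ∅).card := card_map _
    _ ≤ width B + 1 := card_getD_le_width_add_one B i

end HasBags

end BagCSP

/-! ### The size of the input -/

section Length

variable {α : Type} {f : α → List ℕ} {l : List α}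

theorem length_lt_length_encodeList (hf : ∀ x, 1 ≤ (f x).length) :
    l.length < (encodeList f l).length := by
  rw [encodeList, List.length_cons, Nat.lt_succ_iff, List.length_flatMap]
  simpa using List.card_nsmul_le_sum (l.map fun x => (f x).length) 1
    (by simpa using fun x _ => hf x)

theorem length_le_length_encodeList_of_mem {x : α} (hx : x ∈ l) :
    (f x).length ≤ (encodeList f l).length := by
  rw [encodeList, List.length_cons, List.length_flatMap]
  exact (List.le_sum_of_mem (List.mem_map_of_mem (f := fun a => (f a).length) hx)).trans
    (Nat.le_succ _)

theorem forall_mem_encodeList_le {m : ℕ} (hl : l.length ≤ m) (hf : ∀ x ∈ l, ∀ v ∈ f x, v ≤ m) :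
    ∀ v ∈ encodeList f l, v ≤ m := by
  simpa only [encodeList, List.forall_mem_cons, List.forall_mem_flatMap] using ⟨hl, hf⟩

end Length

section Bags

variable {n : ℕ} {G : SimpleGraph (Fin n)} {B : List (List (Fin n))}

theorem le_length_encodeBags (h : IsPathDecomposition G (bagSets B)) :
    n ≤ (encodeBags B).length := by
  have hsub : (univ : Finset (Fin n)) ⊆ B.flatten.toFinset := fun v _ => by
    obtain ⟨b, hb, hv⟩ := h.vertex_mem v
    simp only [bagSets, List.mem_map] at hb
    obtain ⟨l, hl, rfl⟩ := hb
    exact List.mem_toFinset.2 (List.mem_flatten.2 ⟨l, hl, List.mem_toFinset.1 hv⟩)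
  have hcard := (card_le_card hsub).trans (List.toFinset_card_le _)
  rw [card_univ, Fintype.card_fin, List.length_flatten] at hcard
  rw [encodeBags, encodeList, List.length_cons, List.length_flatMap]
  refine (hcard.trans (List.sum_le_sum fun l _ => ?_)).trans (Nat.le_succ _)
  exact (length_lt_length_encodeList fun _ => le_rfl).le

theorem forall_mem_encodeBags_le (h : IsPathDecomposition G (bagSets B)) :
    ∀ v ∈ encodeBags B, v ≤ (encodeBags B).length := by
  have hn := le_length_encodeBags h
  refine forall_mem_encodeList_le (length_lt_length_encodeList fun l => by simp [encodeList]).le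
    fun l hl v hv => ?_
  have hlen := length_le_length_encodeList_of_mem (f := encodeList fun v : Fin n => [(v : ℕ)]) hl
  refine forall_mem_encodeList_le ((length_lt_length_encodeList fun _ => le_rfl).le.trans hlen)
    (fun u _ v hv => ?_) v hv
  rw [List.mem_singleton.1 hv]
  exact u.2.le.trans hn

end Bags

theorem ColoringInstance.forall_mem_encode_le (I : ColoringInstance) :
    ∀ v ∈ I.encode, v ≤ I.encode.length := by
  have hn := le_length_encodeBags I.decomposition
  have hlen : I.edges.length <
      (encodeList (fun e : Fin I.n × Fin I.n => [(e.1 : ℕ), (e.2 : ℕ)]) I.edges).length :=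
    length_lt_length_encodeList fun _ => by simp
  rw [ColoringInstance.encode, List.length_cons, List.length_append, List.forall_mem_cons,
    List.forall_mem_append]
  refine ⟨by omega, forall_mem_encodeList_le (by omega) fun e _ => ?_, fun v hv => ?_⟩
  · simp only [List.forall_mem_cons, List.not_mem_nil, false_imp_iff, implies_true, and_true]
    omega
  · have := forall_mem_encodeBags_le I.decomposition v hv
    omega

theorem ThreeSATInstance.forall_mem_encode_le (I : ThreeSATInstance) :
    ∀ v ∈ I.encode, v ≤ I.encode.length := by
  have hn := le_length_encodeBags I.decomposition
  have hlen : I.formula.length <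
      (encodeList (encodeList fun l : Literal I.n => [(l.1 : ℕ), l.2.toNat]) I.formula).length :=
    length_lt_length_encodeList fun _ => by simp [encodeList]
  rw [ThreeSATInstance.encode, List.length_cons, List.length_append, List.forall_mem_cons,
    List.forall_mem_append]
  refine ⟨by omega, forall_mem_encodeList_le (by omega) fun C hC => ?_, fun v hv => ?_⟩
  · have hclause : C.length <
        (encodeList (fun l : Literal I.n => [(l.1 : ℕ), l.2.toNat]) C).length :=
      length_lt_length_encodeList fun _ => by simp
    have hsize := length_le_length_encodeList_of_mem
      (f := encodeList fun l : Literal I.n => [(l.1 : ℕ), l.2.toNat]) hC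
    refine forall_mem_encodeList_le (by omega) fun l _ => ?_
    have := Bool.toNat_le l.2
    simp only [List.forall_mem_cons, List.not_mem_nil, false_imp_iff, implies_true, and_true]
    omega
  · have := forall_mem_encodeBags_le I.decomposition v hv
    omega

end Reading

open BagCSP

/-! ### Coloring as a constraint satisfaction problem -/

/-- The problem that is described by an input `w` of `k`-Coloring: the constraint `e * k + c`
forbids that both ends of the edge `e` have the color `c`. -/
def coloringCSP (k : ℕ) (w : List ℕ) : BagCSP where
  numVars := w.getD 0 0
  numBags := w.getD (2 + 2 * w.getD 1 0) 0
  numConstraints := w.getD 1 0 * k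
  mem := bagMem (2 + 2 * w.getD 1 0) w
  var j r := w.getD (2 + 2 * (j / k) + min r 1) 0
  val j _ := j % k

namespace ColoringInstance

variable (I : ColoringInstance) (k : ℕ)

theorem standsAt_edges :
    StandsAt I.encode 2 (I.edges.flatMap fun e => [(e.1 : ℕ), (e.2 : ℕ)]) :=
  (standsAt_append.1 (standsAt_cons.1 (standsAt_cons.1 (standsAt_self I.encode)).2).2).1

theorem standsAt_bags : StandsAt I.encode (2 + 2 * I.edges.length) (encodeBags I.bags) := by
  have h := (standsAt_append.1 (standsAt_cons.1 (standsAt_self I.encode)).2).2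
  rw [length_encodeList (s := 2) fun _ => rfl] at h
  convert h using 1
  omega

theorem hasBags : (coloringCSP k I.encode).HasBags (bagSets I.bags) where
  numVars_eq := rfl
  numBags_eq := by
    rw [bagSets, List.length_map]
    exact (standsAt_cons.1 I.standsAt_bags).1
  mem_iff := bagMem_iff I.standsAt_bags

theorem forall_lt_numConstraints_iff {P : ℕ → Prop} :
    (∀ j < (coloringCSP k I.encode).numConstraints, P j) ↔
      ∀ e < I.edges.length, ∀ c < k, P (e * k + c) := by
  refine ⟨fun h e he c hc => h _ (mul_add_lt_mul he hc), fun h j hj => ?_⟩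
  have hk : 0 < k := Nat.pos_of_mul_pos_left (Nat.zero_lt_of_lt hj)
  rw [← Nat.div_add_mod' j k]
  exact h _ (Nat.div_lt_of_lt_mul (mul_comm k _ ▸ hj)) _ (Nat.mod_lt _ hk)

variable {I k} {e c : ℕ} (he : e < I.edges.length) (hc : c < k)
include he hc

theorem var_coloringCSP (r : ℕ) : (coloringCSP k I.encode).var (e * k + c) r =
    if r = 0 then ((I.edges[e]).1 : ℕ) else ((I.edges[e]).2 : ℕ) := by
  obtain ⟨hfst, hsnd⟩ := standsAt_cons.1 (I.standsAt_edges.getElem_of_length_eq (s := 2)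
    (fun _ => rfl) he)
  simp only [coloringCSP, mul_add_div_of_lt hc]
  rcases r.eq_zero_or_pos with rfl | hr
  · exact hfst
  · rw [if_neg hr.ne', min_eq_right hr]
    exact (standsAt_cons.1 hsnd).1

theorem exists_bag_coloringCSP (r r' : ℕ) :
    ∃ i, (coloringCSP k I.encode).mem i ((coloringCSP k I.encode).var (e * k + c) r) = true ∧
      (coloringCSP k I.encode).mem i ((coloringCSP k I.encode).var (e * k + c) r') = true := by
  have hmem : I.edges[e] ∈ I.edges := List.getElem_mem he
  have hadj : (edgeGraph I.edges).Adj (I.edges[e]).1 (I.edges[e]).2 :=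
    (SimpleGraph.fromRel_adj _ _ _).2 ⟨I.loopless _ hmem, Or.inl hmem⟩
  have hbag {u u' : Fin I.n} := (I.hasBags k).exists_mem_of_eq_or_adj I.decomposition (u := u)
    (u' := u')
  rw [var_coloringCSP he hc, var_coloringCSP he hc]
  split_ifs
  · exact hbag (Or.inl rfl)
  · exact hbag (Or.inr hadj)
  · exact hbag (Or.inr hadj.symm)
  · exact hbag (Or.inl rfl)

theorem exists_not_matches_iff (col : ℕ → ℕ) :
    (∃ r < 3, ¬ Matches k ((coloringCSP k I.encode).val (e * k + c) r)
      (col ((coloringCSP k I.encode).var (e * k + c) r))) ↔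
      ¬ (c = col (I.edges[e]).1 ∧ c = col (I.edges[e]).2) := by
  have hmatch y : Matches k c y ↔ c = y := or_iff_left hc.ne
  have hval r : (coloringCSP k I.encode).val (e * k + c) r = c :=
    (Nat.mul_add_mod_self_right e k c).trans (Nat.mod_eq_of_lt hc)
  simp only [hval, hmatch, var_coloringCSP he hc]
  constructor
  · rintro ⟨r, -, h⟩ ⟨hfst, hsnd⟩
    split_ifs at h <;> contradiction
  · intro h
    by_cases hfst : c = col (I.edges[e]).1
    · exact ⟨1, by omega, fun hsnd => h ⟨hfst, hsnd⟩⟩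
    · exact ⟨0, by omega, hfst⟩

omit he hc

variable (I k)

theorem coloringCSP_wellFormed : (coloringCSP k I.encode).WellFormed k where
  toHasIntervals := (I.hasBags k).hasIntervals I.decomposition
  scope := (I.forall_lt_numConstraints_iff k).2 fun _ he _ hc =>
    Or.inr fun r _ r' _ => exists_bag_coloringCSP he hc r r'

theorem coloringCSP_solvable_iff (hk : 0 < k) :
    (coloringCSP k I.encode).Solvable k ↔ (edgeGraph I.edges).Colorable k := by
  rw [edgeGraph_colorable_iff hk I.loopless, Solvable]
  refine exists_congr fun col => and_congr_right fun hcol => ?_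
  rw [I.forall_lt_numConstraints_iff, List.forall_mem_iff_getElem]
  refine forall₂_congr fun e he => ?_
  refine ⟨fun h heq => ?_, fun h c hc => ?_⟩
  · exact (exists_not_matches_iff he (hcol _) col).1 (h _ (hcol _)) ⟨rfl, heq⟩
  · exact (exists_not_matches_iff he hc col).2 fun hcon => h (hcon.1.symm.trans hcon.2)

end ColoringInstance

/-! ### Satisfiability as a constraint satisfaction problem -/

/-- The address of the literal number `r` of the clause `j` in an input `w` of 3-SAT. The last
literal is repeated if there are too few. -/
def literalAddress (w : List ℕ) (j r : ℕ) : ℕ :=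
  listAddress 2 2 w j + 1 + 2 * min r (w.getD (listAddress 2 2 w j) 0 - 1)

/-- The problem that is described by an input `w` of 3-SAT: the constraint `j` forbids that all
literals of the clause `j` are false. The value `2` is a wildcard, for the empty clauses. -/
def threeSATCSP (w : List ℕ) : BagCSP where
  numVars := w.getD 0 0
  numBags := w.getD (listAddress 2 2 w (w.getD 1 0)) 0
  numConstraints := w.getD 1 0
  mem := bagMem (listAddress 2 2 w (w.getD 1 0)) w
  var j r := w.getD (literalAddress w j r) 0
  val j r := if w.getD (listAddress 2 2 w j) 0 = 0 then 2 else
    1 - w.getD (literalAddress w j r + 1) 0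

namespace ThreeSATInstance

variable (I : ThreeSATInstance)

theorem standsAt_clauses : StandsAt I.encode 2
    (I.formula.flatMap (encodeList fun l => [(l.1 : ℕ), l.2.toNat])) :=
  (standsAt_append.1 (standsAt_cons.1 (standsAt_cons.1 (standsAt_self I.encode)).2).2).1

theorem standsAt_bags :
    StandsAt I.encode (listAddress 2 2 I.encode I.formula.length) (encodeBags I.bags) := by
  rw [listAddress_eq I.standsAt_clauses (fun _ => rfl) le_rfl, List.take_length]
  exact (standsAt_append.1 (standsAt_cons.1 (standsAt_cons.1 (standsAt_self I.encode)).2).2).2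

theorem hasBags : (threeSATCSP I.encode).HasBags (bagSets I.bags) where
  numVars_eq := rfl
  numBags_eq := by
    rw [bagSets, List.length_map]
    exact (standsAt_cons.1 I.standsAt_bags).1
  mem_iff := bagMem_iff I.standsAt_bags

variable {I} {j : ℕ} (hj : j < I.formula.length)
include hj

theorem getD_listAddress_encode :
    I.encode.getD (listAddress 2 2 I.encode j) 0 = (I.formula[j]).length :=
  (standsAt_cons.1 (I.standsAt_clauses.getElem_listAddress (fun _ => rfl) hj)).1

theorem val_threeSATCSP_of_eq_nil (h : I.formula[j] = []) (r : ℕ) :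
    (threeSATCSP I.encode).val j r = 2 := by
  simp only [threeSATCSP, getD_listAddress_encode hj, h, List.length_nil, if_true]

theorem exists_bag_of_mem {l l' : Literal I.n} (hl : l ∈ I.formula[j]) (hl' : l' ∈ I.formula[j]) :
    ∃ i, (threeSATCSP I.encode).mem i l.1 = true ∧ (threeSATCSP I.encode).mem i l'.1 = true := by
  refine I.hasBags.exists_mem_of_eq_or_adj I.decomposition <| or_iff_not_imp_left.2 fun hne => ?_
  rw [CNF.primalGraph, SimpleGraph.fromRel_adj]
  exact ⟨hne, Or.inl ⟨_, List.getElem_mem hj, ⟨_, hl⟩, _, hl'⟩⟩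

variable (hpos : 0 < (I.formula[j]).length) (r : ℕ)
include hpos

theorem standsAt_literal : StandsAt I.encode (literalAddress I.encode j r)
    [((I.formula[j])[min r ((I.formula[j]).length - 1)].1 : ℕ),
      (I.formula[j])[min r ((I.formula[j]).length - 1)].2.toNat] := by
  rw [literalAddress, getD_listAddress_encode hj]
  exact (standsAt_cons.1 (I.standsAt_clauses.getElem_listAddress (fun _ => rfl) hj)).2
    |>.getElem_of_length_eq (fun _ => rfl) _

theorem var_threeSATCSP : (threeSATCSP I.encode).var j r =
    (I.formula[j])[min r ((I.formula[j]).length - 1)].1 :=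
  (standsAt_cons.1 (standsAt_literal hj hpos r)).1

theorem val_threeSATCSP : (threeSATCSP I.encode).val j r =
    1 - (I.formula[j])[min r ((I.formula[j]).length - 1)].2.toNat := by
  simp only [threeSATCSP, getD_listAddress_encode hj, if_neg hpos.ne']
  exact congrArg (1 - ·)
    (standsAt_cons.1 (standsAt_cons.1 (standsAt_literal hj hpos r)).2).1

omit hpos

theorem exists_not_matches_iff {x : ℕ → ℕ} (hx : ∀ v, x v < 2) :
    (∃ r < 3, ¬ Matches 2 ((threeSATCSP I.encode).val j r)
      (x ((threeSATCSP I.encode).var j r))) ↔ ∃ l ∈ I.formula[j], x l.1 = l.2.toNat := by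
  have hmatch (l : Literal I.n) : ¬ Matches 2 (1 - l.2.toNat) (x l.1) ↔ x l.1 = l.2.toNat := by
    have := hx l.1
    have := Bool.toNat_le l.2
    unfold Matches
    omega
  rcases (I.formula[j]).length.eq_zero_or_pos with hzero | hpos
  · have hnil := List.length_eq_zero_iff.1 hzero
    simp [val_threeSATCSP_of_eq_nil hj hnil, hnil, Matches]
  · simp only [var_threeSATCSP hj hpos, val_threeSATCSP hj hpos, hmatch]
    refine ⟨fun ⟨r, _, h⟩ => ⟨_, List.getElem_mem _, h⟩, fun ⟨l, hl, h⟩ => ?_⟩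
    obtain ⟨r, hr, rfl⟩ := List.mem_iff_getElem.1 hl
    refine ⟨r, hr.trans_le (I.arity _ (List.getElem_mem hj)), ?_⟩
    simpa only [min_eq_left (Nat.le_sub_one_of_lt hr)] using h

omit hj

variable (I)

theorem threeSATCSP_wellFormed : (threeSATCSP I.encode).WellFormed 2 where
  toHasIntervals := I.hasBags.hasIntervals I.decomposition
  scope j hj := by
    replace hj : j < I.formula.length := hj
    rcases (I.formula[j]).length.eq_zero_or_pos with hzero | hpos
    · exact Or.inl fun r _ => val_threeSATCSP_of_eq_nil hj (List.length_eq_zero_iff.1 hzero) r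
    · refine Or.inr fun r _ r' _ => ?_
      rw [var_threeSATCSP hj hpos, var_threeSATCSP hj hpos]
      exact exists_bag_of_mem hj (List.getElem_mem _) (List.getElem_mem _)

theorem threeSATCSP_solvable_iff :
    (threeSATCSP I.encode).Solvable 2 ↔ I.formula.Satisfiable := by
  rw [CNF.satisfiable_iff, Solvable]
  refine exists_congr fun x => and_congr_right fun hx => ?_
  rw [List.forall_mem_iff_getElem]
  exact forall₂_congr fun j hj => exists_not_matches_iff hj hx

end ThreeSATInstance

open Context

section

variable {α β : Type} [Context α]

/-- The list `L x`, whose entries are encoded by `enc`, can be written in polynomial time. Its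
length, which precedes the entries in a word, is computed separately. -/
structure PolyEncodable (enc : β → List ℕ) (L : α → List β) : Prop where
  length : PolyComputable fun x => (L x).length
  entries : PolyWritable fun x => (L x).flatMap enc

namespace PolyEncodable

variable {enc : β → List ℕ} {L L' : α → List β}

theorem encodeList (h : PolyEncodable enc L) : PolyWritable fun x => encodeList enc (L x) :=
  .cons h.length h.entries

theorem append (h : PolyEncodable enc L) (h' : PolyEncodable enc L') :
    PolyEncodable enc fun x => L x ++ L' x where
  length := (h.length.add h'.length).congr fun _ => List.length_append
  entries := (h.entries.append h'.entries).congr fun _ => List.flatMap_append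

theorem singleton {y : α → β} (h : PolyWritable fun x => enc (y x)) :
    PolyEncodable enc fun x => [y x] where
  length := .const 1
  entries := h.congr fun _ => List.flatMap_singleton _ _

theorem cons {y : α → β} (h : PolyWritable fun x => enc (y x)) (hL : PolyEncodable enc L) :
    PolyEncodable enc fun x => y x :: L x :=
  (singleton h).append hL

theorem flatMap {n : α → ℕ} {L : α → ℕ → List β} (hn : PolyComputable n)
    (hL : PolyEncodable enc fun x : α × ℕ => L x.1 x.2) :
    PolyEncodable enc fun x => (List.range (n x)).flatMap (L x) where
  length := (PolyComputable.sum (g := fun x i => (L x i).length) hn hL.length).congr fun _ =>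
    List.length_flatMap
  entries := (PolyWritable.flatMap (g := fun x i => (L x i).flatMap enc) hn hL.entries).congr
    fun _ => List.flatMap_assoc

theorem map {n : α → ℕ} {y : α → ℕ → β} (hn : PolyComputable n)
    (hy : PolyWritable fun x : α × ℕ => enc (y x.1 x.2)) :
    PolyEncodable enc fun x => (List.range (n x)).map (y x) :=
  (funext fun _ => List.map_eq_flatMap : (fun x => (List.range (n x)).map (y x)) = _) ▸
    flatMap (L := fun x i => [y x i]) hn (singleton hy)

end PolyEncodable

theorem PolyWritable.ite_pair {c : α → Prop} [DecidablePred c] {f f' g g' : α → ℕ}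
    (hc : PolyDecidable c) (hf : PolyComputable f) (hf' : PolyComputable f')
    (hg : PolyComputable g) (hg' : PolyComputable g') :
    PolyWritable fun x =>
      (fun e : ℕ × ℕ => [e.1, e.2]) (if c x then (f x, f' x) else (g x, g' x)) :=
  (cons (.ite hc hf hg) (singleton (.ite hc hf' hg'))).congr fun x => by
    by_cases hx : c x <;> simp only [hx, if_true, if_false]

theorem PolyComputable.min {f g : α → ℕ} (hf : PolyComputable f) (hg : PolyComputable g) :
    PolyComputable fun x => min (f x) (g x) :=
  (hf.sub (hf.sub hg)).congr fun _ => by omega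

theorem PolyComputable.toNat_decide {c : α → Prop} [DecidablePred c] (hc : PolyDecidable c) :
    PolyComputable fun x => (decide (c x)).toNat :=
  (ite hc (const 1) (const 0)).congr fun x => by
    by_cases hx : c x <;> simp [hx]

open Polynomial in
theorem PolyComputable.listAddress {o i : α → ℕ} (s : ℕ) (ho : PolyComputable o)
    (hi : PolyComputable i) : PolyComputable fun x => listAddress s (o x) (word x) (i x) := by
  obtain ⟨S, hS, -⟩ := id hi
  obtain ⟨U, hU, -⟩ := id ho
  refine recursion (F := fun x k => PathwidthSETH.listAddress s (o x) (word x) k)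
    (step := fun y => y.2 + 1 + s * (word y.1.1).getD y.2 0) hi ho
    ((snd.add (const 1)).add ((const s).mul (read snd))) (fun _ _ => rfl)
    (U + S * (1 + C s * X)) fun x M hx k hk => ?_
  have hbound (k : ℕ) : PathwidthSETH.listAddress s (o x) (word x) k ≤ o x + k * (1 + s * M) := by
    induction k with
    | zero => simp [PathwidthSETH.listAddress]
    | succ k ih =>
      have := Nat.mul_le_mul_left s (hx.getD_le (PathwidthSETH.listAddress s (o x) (word x) k))
      rw [PathwidthSETH.listAddress, Nat.succ_mul]
      omega
  have hval : (U + S * (1 + C s * X)).eval M = U.eval M + S.eval M * (1 + s * M) := by simp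
  rw [hval]
  exact (hbound k).trans (by gcongr; exacts [hU x M hx, hk.trans (hS x M hx)])

theorem PolyDecidable.imp {c d : α → Prop} (hc : PolyDecidable c) (hd : PolyDecidable d) :
    PolyDecidable fun x => c x → d x :=
  (hc.not.or hd).congr fun _ => imp_iff_not_or

theorem PolyDecidable.bagMem {o i v : α → ℕ} (ho : PolyComputable o) (hi : PolyComputable i)
    (hv : PolyComputable v) :
    PolyDecidable fun x => bagMem (o x) (word x) (i x) (v x) = true := by
  have hadr := PolyComputable.listAddress 1 (ho.add (.const 1)) hi
  refine ((lt hi (.read ho)).and (exists_lt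
    (p := fun x y => (word x).getD (listAddress 1 (o x + 1) (word x) (i x) + 1 + y) 0 = v x)
    (.read hadr) (eq (.read (α := α × ℕ) ((hadr.fst.add (.const 1)).add .snd)) hv.fst))).congr
    fun x => ?_
  rw [PathwidthSETH.bagMem, decide_eq_true_iff]

end

open Context

/-! ### The construction takes polynomial time -/

/-- The data of the problem `csp w` can be computed from the word `w` in polynomial time. -/
structure PolyReadable (csp : List ℕ → BagCSP) : Prop where
  numVars {α : Type} [Context α] : PolyComputable fun x : α => (csp (word x)).numVars
  numBags {α : Type} [Context α] : PolyComputable fun x : α => (csp (word x)).numBags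
  numConstraints {α : Type} [Context α] : PolyComputable fun x : α => (csp (word x)).numConstraints
  mem {α : Type} [Context α] {f g : α → ℕ} : PolyComputable f → PolyComputable g →
    PolyDecidable fun x => (csp (word x)).mem (f x) (g x) = true
  var {α : Type} [Context α] {f g : α → ℕ} : PolyComputable f → PolyComputable g →
    PolyComputable fun x => (csp (word x)).var (f x) (g x)
  val {α : Type} [Context α] {f g : α → ℕ} : PolyComputable f → PolyComputable g →
    PolyComputable fun x => (csp (word x)).val (f x) (g x)

theorem polyReadable_coloringCSP (k : ℕ) : PolyReadable (coloringCSP k) :=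
  have bagAddress {α : Type} [Context α] :
      PolyComputable fun x : α => 2 + 2 * (word x).getD 1 0 :=
    .add (.const 2) (.mul (.const 2) (.read (.const 1)))
  { numVars := .read (.const 0)
    numBags := .read bagAddress
    numConstraints := .mul (.read (.const 1)) (.const k)
    mem := .bagMem bagAddress
    var := fun hf hg => .read (.add (.add (.const 2) (.mul (.const 2) (hf.div (.const k))))
      (hg.min (.const 1)))
    val := fun hf _ => hf.mod (.const k) }

theorem polyReadable_threeSATCSP : PolyReadable threeSATCSP :=
  have clauseAddress {α : Type} [Context α] {f : α → ℕ} (hf : PolyComputable f) :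
      PolyComputable fun x => listAddress 2 2 (word x) (f x) := .listAddress 2 (.const 2) hf
  have literalAddress {α : Type} [Context α] {f g : α → ℕ} (hf : PolyComputable f)
      (hg : PolyComputable g) : PolyComputable fun x => literalAddress (word x) (f x) (g x) :=
    .add (.add (clauseAddress hf) (.const 1))
      (.mul (.const 2) (hg.min (.sub (.read (clauseAddress hf)) (.const 1))))
  { numVars := .read (.const 0)
    numBags := .read (clauseAddress (.read (.const 1)))
    numConstraints := .read (.const 1)
    mem := .bagMem (clauseAddress (.read (.const 1)))
    var := fun hf hg => .read (literalAddress hf hg)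
    val := fun hf hg => .ite (.eq (.read (clauseAddress hf)) (.const 0)) (.const 2)
      (.sub (.const 1) (.read (.add (literalAddress hf hg) (.const 1)))) }

namespace PolyReadable

open BagCSP

section

variable (p : Recoding) {α : Type} [Context α] {f g : α → ℕ}

theorem source (hf : PolyComputable f) : PolyComputable fun x => source p (f x) := hf.div (.const _)

theorem code (hf : PolyComputable f) (hg : PolyComputable g) :
    PolyComputable fun x => code p (f x) (g x) :=
  hf.digit _ hg

theorem digitVal (hf : PolyComputable f) (hg : PolyComputable g) :
    PolyComputable fun x => digitVal p (f x) (g x) :=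
  (code p hf (hg.div (.const p.q))).digit p.b (hg.mod (.const p.q))

theorem digitVertex (hf : PolyComputable f) : PolyComputable fun x => digitVertex p (f x) :=
  .add (.const p.b) hf

theorem otherColor (hf : PolyComputable f) : PolyComputable fun x => otherColor (f x) :=
  .ite (.eq hf (.const 0)) (.const 1) (.const 0)

end

variable {csp : List ℕ → BagCSP} (h : PolyReadable csp) (p : Recoding) {α : Type} [Context α]
  {f g : α → ℕ}
include h

theorem firstBag (hf : PolyComputable f) : PolyComputable fun x => (csp (word x)).firstBag (f x) :=
  .count (p := fun x i => ∀ i' < i + 1, ¬ (csp (word x)).mem i' (f x) = true) h.numBags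
    (.forall_lt (n := fun x : α × ℕ => x.2 + 1)
      (p := fun x i' => ¬ (csp (word x)).mem i' (f x.1) = true) (.add .snd (.const 1))
      (h.mem .snd hf.fst.fst).not)

theorem before (hf : PolyComputable f) (hg : PolyComputable g) :
    PolyDecidable fun x => (csp (word x)).Before (f x) (g x) :=
  .or (.lt (h.firstBag hf) (h.firstBag hg))
    (.and (.eq (h.firstBag hf) (h.firstBag hg)) (.lt hf hg))

theorem rank (hf : PolyComputable f) (hg : PolyComputable g) :
    PolyComputable fun x => (csp (word x)).rank (f x) (g x) :=
  .count (p := fun x u => (csp (word x)).mem (f x) u = true ∧ (csp (word x)).Before u (g x))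
    h.numVars ((h.mem hf.fst .snd).and (h.before .snd hg.fst))

theorem bagCard (hf : PolyComputable f) : PolyComputable fun x => (csp (word x)).bagCard (f x) :=
  .count (p := fun x u => (csp (word x)).mem (f x) u = true) h.numVars (h.mem hf.fst .snd)

theorem maxBagCard : PolyComputable fun x : α => (csp (word x)).maxBagCard :=
  .maxBelow (g := fun x => (csp (word x)).bagCard) h.numBags (h.bagCard .snd)

theorem blocksPerBag : PolyComputable fun x : α => (csp (word x)).blocksPerBag p :=
  .add (h.maxBagCard.div (.const p.t)) (.const 1)

theorem place (hf : PolyComputable f) (hg : PolyComputable g) :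
    PolyComputable fun x => (csp (word x)).place p (f x) (g x) :=
  .add (.mul hf (.mul (h.blocksPerBag p) (.const p.t))) (h.rank hf hg)

theorem homeBag (hf : PolyComputable f) : PolyComputable fun x => (csp (word x)).homeBag (f x) :=
  .maxBelow (g := fun x r => (csp (word x)).firstBag ((csp (word x)).var (f x) r)) (.const 3)
    (h.firstBag (h.var hf.fst .snd))

theorem numPlaceConstraints : PolyComputable fun x : α => (csp (word x)).numPlaceConstraints p :=
  .add h.numConstraints (.mul (.mul (.mul h.numBags h.numVars) (.const p.a)) (.const p.a))

theorem linkVar (hf : PolyComputable f) : PolyComputable fun x => (csp (word x)).linkVar p (f x) :=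
  .mod (.div (.div hf (.const p.a)) (.const p.a)) h.numVars

theorem linkBag (hf : PolyComputable f) : PolyComputable fun x => (csp (word x)).linkBag p (f x) :=
  .div (.div (.div hf (.const p.a)) (.const p.a)) h.numVars

theorem isLink (hf : PolyComputable f) : PolyDecidable fun x => (csp (word x)).IsLink p (f x) :=
  .and (.not (.eq (hf.mod (.const p.a)) (.mod (hf.div (.const p.a)) (.const p.a))))
    (.and (h.mem (h.linkBag p hf) (h.linkVar p hf))
      (h.mem (.add (h.linkBag p hf) (.const 1)) (h.linkVar p hf)))

theorem scopePlace (hf : PolyComputable f) (hg : PolyComputable g) :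
    PolyComputable fun x => (csp (word x)).scopePlace p (f x) (g x) :=
  have hlink := hf.sub h.numConstraints
  .ite (.lt hf h.numConstraints) (h.place p (h.homeBag hf) (h.var hf hg))
    (.ite (.and (h.isLink p hlink) (.lt (.const 0) hg))
      (h.place p (.add (h.linkBag p hlink) (.const 1)) (h.linkVar p hlink))
      (h.place p (h.linkBag p hlink) (h.linkVar p hlink)))

theorem pattern (hf : PolyComputable f) (hg : PolyComputable g) :
    PolyComputable fun x => (csp (word x)).pattern p (f x) (g x) :=
  have hlink := hf.sub h.numConstraints
  .ite (.lt hf h.numConstraints) (h.val hf hg)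
    (.ite (h.isLink p hlink)
      (.ite (.lt (.const 0) hg) (.mod (hlink.div (.const p.a)) (.const p.a))
        (hlink.mod (.const p.a)))
      (.const (p.a + 1)))

theorem window (hf : PolyComputable f) : PolyComputable fun x => (csp (word x)).window p (f x) :=
  have hlink := hf.sub h.numConstraints
  .ite (.lt hf h.numConstraints) (.mul (h.homeBag hf) (h.blocksPerBag p))
    (.div (h.place p (h.linkBag p hlink) (h.linkVar p hlink)) (.const p.t))

theorem numDigitConstraints : PolyComputable fun x : α => (csp (word x)).numDigitConstraints p :=
  (h.numPlaceConstraints p).mul (.const _)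

theorem isLive (hf : PolyComputable f) : PolyDecidable fun x => (csp (word x)).IsLive p (f x) :=
  have hsource := source p hf.fst
  have hpattern := h.pattern p hsource .snd
  .forall_lt (n := fun _ => 3)
    (p := fun x r => Matches p.a ((csp (word x)).pattern p (BagCSP.source p (f x)) r)
      (digit p.a (BagCSP.code p (f x) r)
        ((csp (word x)).scopePlace p (BagCSP.source p (f x)) r % p.t))) (.const 3)
    (.or (.eq hpattern (.digit p.a (code p hf.fst .snd)
      (.mod (h.scopePlace p hsource .snd) (.const p.t)))) (.eq hpattern (.const p.a)))

theorem digitVar (hf : PolyComputable f) (hg : PolyComputable g) :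
    PolyComputable fun x => (csp (word x)).digitVar p (f x) (g x) :=
  .add (.mul (.div (h.scopePlace p (source p hf) (hg.div (.const p.q))) (.const p.t)) (.const p.q))
    (hg.mod (.const p.q))

theorem numWindows : PolyComputable fun x : α => (csp (word x)).numWindows p :=
  .mul (.add h.numBags (.const 1)) (h.blocksPerBag p)

theorem numDigitVertices : PolyComputable fun x : α => (csp (word x)).numDigitVertices p :=
  .mul (.add (h.numWindows p) (h.blocksPerBag p)) (.const p.q)

theorem numVertices : PolyComputable fun x : α => (csp (word x)).numVertices p :=
  .add (.add (.const p.b) (h.numDigitVertices p)) (.mul (h.numDigitConstraints p) (.const _))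

theorem auxVertex (hf : PolyComputable f) (hg : PolyComputable g) :
    PolyComputable fun x => (csp (word x)).auxVertex p (f x) (g x) :=
  .add (.add (.add (.const p.b) (h.numDigitVertices p)) (.mul hf (.const _))) hg

theorem numGadgetBags : PolyComputable fun x : α => (csp (word x)).numGadgetBags p :=
  .mul (h.numWindows p) (.add (h.numDigitConstraints p) (.const 1))

theorem auxCount (hf : PolyComputable f) :
    PolyComputable fun x => (csp (word x)).auxCount p (f x) :=
  have hE := (h.numDigitConstraints (α := α) p).add (.const 1)
  .ite (.and (.lt (hf.mod hE) (h.numDigitConstraints p))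
    (.eq (h.window p (source p (hf.mod hE))) (hf.div hE))) (.const _) (.const 0)

theorem gadgetBag (hf : PolyComputable f) :
    PolyEncodable (fun v => [v]) fun x => (csp (word x)).gadgetBag p (f x) := by
  have hE := (h.numDigitConstraints (α := α × ℕ) p).add (.const 1)
  refine .append (.append ?_ (.map (.mul (.add (h.blocksPerBag p) (.const 1)) (.const p.q)) ?_))
    (.map (h.auxCount p hf) (.singleton (h.auxVertex p (hf.fst.mod hE) .snd)))
  · simpa only [List.map_id'] using PolyEncodable.map (enc := fun v => [v]) (y := fun _ i => i)
      (.const p.b) (.singleton (.snd (α := α)))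
  · exact .singleton (.add (.add (.const p.b) (.mul (hf.fst.div hE) (.const p.q))) .snd)

theorem bagWord : PolyWritable fun x : α => (csp (word x)).bagWord p :=
  (PolyEncodable.map (y := fun x => (csp (word x)).gadgetBag p) (h.numGadgetBags p)
    (h.gadgetBag p .snd).encodeList).encodeList

theorem isAllowed {c : α → ℕ} (hf : PolyComputable f) (hg : PolyComputable g)
    (hc : PolyComputable c) :
    PolyDecidable fun x => (csp (word x)).IsAllowed p (f x) (g x) (c x) := by
  have hmod (i : ℕ) : PolyDecidable fun x => g x % 4 = i := .eq (hg.mod (.const 4)) (.const i)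
  have hval := digitVal p hf (hg.div (.const 4))
  have hother := otherColor hval
  refine .or (.and (hmod 0) (.and (.lt hc (.const 2)) (.and ?_ ?_)))
    (.or (.and (hmod 1) (.or (.eq hc hval) (.eq hc hother)))
    (.or (.and (hmod 2) (.or (.eq hc hother) (.eq hc (.const 2))))
      (.and (hmod 3) (.lt hc (.const 3)))))
  · exact .imp (.eq hg (.const 0)) (.eq hc (.const 0))
  · exact .imp (.eq hg (.const _)) (.imp (h.isLive p hf) (.eq hc (.const 1)))

theorem edgeList :
    PolyEncodable (fun e => [e.1, e.2]) fun x : α => (csp (word x)).edgeList p := by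
  have haux (i : ℕ) : PolyComputable fun x : (α × ℕ) × ℕ =>
      (csp (word x)).auxVertex p x.1.2 (4 * x.2 + i) :=
    h.auxVertex p (.fst .snd) (.add (.mul (.const 4) .snd) (.const i))
  have hpair {f g : (α × ℕ) × ℕ → ℕ} (hf : PolyComputable f) (hg : PolyComputable g) :
      PolyWritable fun x => [f x, g x] := .cons hf (.singleton hg)
  refine .append (.flatMap (.const p.b) (.map (.const p.b) ?_))
    (.flatMap (h.numDigitConstraints p) (.append
      (.flatMap (.const _) (.map (.const p.b) ?_)) (.flatMap (.const _) ?_)))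
  · exact .ite_pair (.not (.eq (.fst .snd) .snd)) (.fst .snd) .snd (.const 0) (.const 1)
  · exact .ite_pair (h.isAllowed p (.fst (.fst .snd)) (.fst .snd) .snd) (.const 0) (.const 1) .snd
      (h.auxVertex p (.fst (.fst .snd)) (.fst .snd))
  · exact .cons (hpair (digitVertex p (h.digitVar p (.fst .snd) .snd)) (haux 1))
      (.cons (hpair (haux 1) (haux 2)) (.cons (hpair (haux 2) (haux 3))
        (.cons (hpair (haux 3) (haux 0)) (.singleton (hpair (haux 3) (haux 4))))))

theorem coloringWord : PolyWritable fun x : α => (csp (word x)).coloringWord p :=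
  .cons (h.numVertices p) (.append (h.edgeList p).encodeList (h.bagWord p))

theorem clauseList :
    PolyEncodable (encodeList fun l => [l.1, l.2.toNat])
      fun x : α => (csp (word x)).clauseList p := by
  have hliteral {γ : Type} [Context γ] {v : γ → ℕ} {c : γ → Bool} (hv : PolyComputable v)
      (hc : PolyComputable fun x => (c x).toNat) :
      PolyWritable fun x => [(v x, c x).1, (v x, c x).2.toNat] := .cons hv (.singleton hc)
  have haux (i : ℕ) : PolyComputable fun x : (α × ℕ) × ℕ =>
      (csp (word x)).auxVertex p x.1.2 (4 * x.2 + i) :=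
    h.auxVertex p (.fst .snd) (.add (.mul (.const 4) .snd) (.const i))
  refine .flatMap (h.numDigitConstraints p) (.append
    (.cons (PolyEncodable.encodeList (.singleton ?_))
      (.singleton (PolyEncodable.encodeList (.singleton ?_))))
    (.map (.const _) (PolyEncodable.encodeList (.cons ?_ (.cons ?_ (.singleton ?_))))))
  · exact hliteral (h.auxVertex p .snd (.const 0)) (.const 0)
  · exact hliteral (h.auxVertex p .snd (.const _)) (.toNat_decide (h.isLive p .snd))
  · exact hliteral (haux 0) (.const 1)
  · exact hliteral (digitVertex p (h.digitVar p (.fst .snd) .snd))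
      (.toNat_decide (.eq (digitVal p (.fst .snd) .snd) (.const 0)))
  · exact hliteral (haux 4) (.const 0)

theorem threeSATWord : PolyWritable fun x : α => (csp (word x)).threeSATWord p :=
  .cons (h.numVertices p) (.append (h.clauseList p).encodeList (h.bagWord p))

end PolyReadable

/-! ### The running time -/

theorem pow_clog_le {b n : ℕ} (hb : 2 ≤ b) (hn : 1 < n) {β : ℝ} (hβ : 1 ≤ β) :
    β ^ Nat.clog b n ≤ β * (n : ℝ) ^ Real.logb b β := by
  have hb1 : (1 : ℝ) < b := mod_cast hb
  have hlt : (b : ℝ) ^ (Nat.clog b n - 1) ≤ n := mod_cast (Nat.pow_pred_clog_lt_self hb hn).le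
  have hlog : 0 ≤ Real.logb b β := Real.logb_nonneg hb1 hβ
  calc β ^ Nat.clog b n = β * β ^ (Nat.clog b n - 1) := by
        rw [← pow_succ', Nat.sub_add_cancel (Nat.clog_pos hb hn)]
    _ = β * ((b : ℝ) ^ (Nat.clog b n - 1)) ^ Real.logb b β := by
        rw [← Real.rpow_pow_comm (by positivity),
          Real.rpow_logb (by positivity) hb1.ne' (by positivity)]
    _ ≤ β * (n : ℝ) ^ Real.logb b β := by gcongr

/-- With `q = clog b (a ^ t)`, rounding up costs at most a factor `β`. As `β = b ^ θ` with `θ < 1`,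
this factor disappears in a slightly larger base `β'` if `t` is large. -/
theorem exists_recoding {a b : ℕ} (ha : 2 ≤ a) (hb : 2 ≤ b) {β : ℝ} (h1 : 1 ≤ β) (hβ : β < b) :
    ∃ (t q : ℕ) (β' : ℝ), (⟨a, b, t, q⟩ : Recoding).Valid ∧ 1 ≤ β' ∧ β' < a ∧ β ^ q ≤ β' ^ t := by
  have ha1 : (1 : ℝ) < a := mod_cast ha
  have hb1 : (1 : ℝ) < b := mod_cast hb
  set θ := Real.logb b β
  have hθ0 : 0 ≤ θ := Real.logb_nonneg hb1 h1
  have hθ1 : θ < 1 := (Real.logb_lt_iff_lt_rpow hb1 (by positivity)).2 (by rwa [Real.rpow_one])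
  obtain ⟨t, ht⟩ := pow_unbounded_of_one_lt β
    (Real.one_lt_rpow ha1 (show 0 < (1 - θ) / 2 by linarith))
  have ht0 : t ≠ 0 := by
    rintro rfl
    exact absurd ht (by simpa using h1)
  have hat : 1 < a ^ t := Nat.one_lt_pow ht0 ha
  refine ⟨t, Nat.clog b (a ^ t), (a : ℝ) ^ ((1 + θ) / 2),
    ⟨ha, hb, ht0.bot_lt, Nat.clog_pos hb hat, Nat.le_pow_clog hb _⟩,
    Real.one_le_rpow ha1.le (by linarith), Real.rpow_lt_self_of_one_lt ha1 (by linarith), ?_⟩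
  calc β ^ Nat.clog b (a ^ t) ≤ β * ((a ^ t : ℕ) : ℝ) ^ θ := pow_clog_le hb hat h1
    _ ≤ ((a : ℝ) ^ ((1 - θ) / 2)) ^ t * ((a : ℝ) ^ θ) ^ t := by
        rw [Nat.cast_pow, ← Real.rpow_pow_comm (by positivity)]
        gcongr
    _ = ((a : ℝ) ^ ((1 + θ) / 2)) ^ t := by
        rw [← mul_pow, ← Real.rpow_add (by positivity)]
        ring_nf

theorem exists_pow_le_mul_pow {p : Recoding} {β β' : ℝ} (h1 : 1 ≤ β) (h1' : 1 ≤ β')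
    (h : β ^ p.q ≤ β' ^ p.t) :
    ∃ K : ℕ, ∀ (S : BagCSP) (w w' : ℕ), S.maxBagCard ≤ w + 1 →
      w' ≤ p.b + (S.blocksPerBag p + 1) * p.q + auxSize p → β ^ w' ≤ K * β' ^ w := by
  obtain ⟨K, hK⟩ := exists_nat_ge (β ^ (p.b + auxSize p) * β' ^ (1 + 2 * p.t))
  refine ⟨K, fun S w w' hS hw => ?_⟩
  have hblocks : p.t * (S.blocksPerBag p + 1) ≤ w + (1 + 2 * p.t) := by
    have := Nat.mul_div_le S.maxBagCard p.t
    rw [blocksPerBag, Nat.mul_succ, Nat.mul_succ]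
    omega
  calc β ^ w' ≤ β ^ (p.b + (S.blocksPerBag p + 1) * p.q + auxSize p) := pow_le_pow_right₀ h1 hw
    _ = β ^ (p.b + auxSize p) * (β ^ p.q) ^ (S.blocksPerBag p + 1) := by ring
    _ ≤ β ^ (p.b + auxSize p) * (β' ^ p.t) ^ (S.blocksPerBag p + 1) := by gcongr
    _ ≤ β ^ (p.b + auxSize p) * β' ^ (w + (1 + 2 * p.t)) := by
        rw [← pow_mul]
        gcongr
    _ = β ^ (p.b + auxSize p) * β' ^ (1 + 2 * p.t) * β' ^ w := by ring
    _ ≤ K * β' ^ w := by gcongr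

theorem SolvableInTime.mono {ι : Type} {enc : ι → List ℕ} {yes : ι → Prop} {p : ι → ℕ} {β β' : ℝ}
    (hβ : 0 ≤ β) (h : β ≤ β') (hs : SolvableInTime enc yes p β) : SolvableInTime enc yes p β' := by
  obtain ⟨P, C, c, hP⟩ := hs
  refine ⟨P, C, c, fun x => ?_⟩
  obtain ⟨s, t, hexec, hyes, ht⟩ := hP x
  exact ⟨s, t, hexec, hyes, ht.trans (by gcongr)⟩

theorem exists_threeSATSolvableInTime {k : ℕ} (hk : 3 ≤ k) {β : ℝ} (h0 : 0 < β) (hβ : β < k)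
    (h : ColoringSolvableInTime k β) : ∃ β' : ℝ, 1 ≤ β' ∧ β' < 2 ∧ ThreeSATSolvableInTime β' := by
  have hk1 : (1 : ℝ) < k := mod_cast (show 1 < k by omega)
  obtain ⟨t, q, β', hp, h1', h2', hpow⟩ :=
    exists_recoding (a := 2) le_rfl (show 2 ≤ k by omega) (le_max_right β 1) (max_lt hβ hk1)
  obtain ⟨K, hK⟩ := exists_pow_le_mul_pow (p := ⟨2, k, t, q⟩) (le_max_right β 1) h1' hpow
  exact ⟨β', h1', mod_cast h2', (h.mono h0.le (le_max_left β 1)).of_reduction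
    (fun I : ThreeSATInstance => toColoring I.threeSATCSP_wellFormed.toHasIntervals hp)
    (polyReadable_threeSATCSP.coloringWord _) (fun I => encode_toColoring _ hp)
    (fun I => (colorable_toColoring_iff I.threeSATCSP_wellFormed hp hk).trans
      I.threeSATCSP_solvable_iff)
    (fun I => ⟨Nat.succ_pos _, I.forall_mem_encode_le⟩) h1' K
    fun I => hK _ _ _ I.hasBags.maxBagCard_le width_gadgetBags_le⟩

theorem exists_coloringSolvableInTime {k : ℕ} (hk : 2 ≤ k) {β : ℝ} (h0 : 0 < β) (hβ : β < 2)
    (h : ThreeSATSolvableInTime β) : ∃ β' : ℝ, 1 ≤ β' ∧ β' < k ∧ ColoringSolvableInTime k β' := by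
  obtain ⟨t, q, β', hp, h1', h2', hpow⟩ :=
    exists_recoding (b := 2) hk le_rfl (le_max_right β 1) (max_lt (mod_cast hβ) (by norm_num))
  obtain ⟨K, hK⟩ := exists_pow_le_mul_pow (p := ⟨k, 2, t, q⟩) (le_max_right β 1) h1' hpow
  exact ⟨β', h1', h2', (h.mono h0.le (le_max_left β 1)).of_reduction
    (fun I : ColoringInstance => toThreeSAT (I.coloringCSP_wellFormed k).toHasIntervals hp)
    ((polyReadable_coloringCSP k).threeSATWord _) (fun I => encode_toThreeSAT _ hp)
    (fun I => (satisfiable_toThreeSAT_iff (I.coloringCSP_wellFormed k) hp rfl).trans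
      (I.coloringCSP_solvable_iff k (by omega)))
    (fun I => ⟨Nat.succ_pos _, I.forall_mem_encode_le⟩) h1' K
    fun I => hK _ _ _ (I.hasBags k).maxBagCard_le width_gadgetBags_le⟩

end PathwidthSETH

theorem mainTheorem8 (k : ℕ) (hk : 3 ≤ k) :
    (∃ ε : ℝ, 0 < ε ∧ ε < k ∧ PathwidthSETH.ColoringSolvableInTime k (k - ε)) ↔
      ¬ PathwidthSETH.PPSETH := by
  constructor
  · rintro ⟨ε, h0, h1, h⟩ hP
    obtain ⟨β, h2, h3, h4⟩ :=
      PathwidthSETH.exists_threeSATSolvableInTime hk (sub_pos.2 h1) (by linarith) h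
    refine hP (2 - β) (by linarith) (by linarith) ?_
    rwa [sub_sub_cancel]
  · intro hP
    unfold PathwidthSETH.PPSETH at hP
    push Not at hP
    obtain ⟨ε, h0, h1, h⟩ := hP
    obtain ⟨β, h2, h3, h4⟩ := PathwidthSETH.exists_coloringSolvableInTime (k := k) (by omega)
      (sub_pos.2 h1) (by linarith) h
    exact ⟨k - β, by linarith, by linarith, by rwa [sub_sub_cancel]⟩
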